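/- **Setting.** Let $H$ be a separable real Hilbert space with norm $|\cdot|$, continuously and densely embedded into a real Banach space $E$ with Borel $\sigma$-algebra $\mathcal B$. Identify $E'\subset H'\equiv H\subset E$, and write $|\xi|$ for the $H$-norm of $\xi\in E'$. Given probability measures $(\nu_t)_{t>0}$ on $(E,\mathcal B)$, set for $\mathcal B$-measurable $f:E\to[0,\infty]$ $$P_tf(x)=\int_E f(x+y)\,\nu_t(dy),\qquad U_\alpha f(x)=\int_0^\infty e^{-\alpha t}P_tf(x)\,dt\quad(\alpha>0).$$ For $\beta>0$, a $\mathcal B$-measurable $u:E\to[0,\infty]$ is called $\mathcal U_\beta$-excessive if $\alpha U_{\beta+\alpha}u\le u$ for all $\alpha>0$ and $\lim_{\alpha\to\infty}\alpha U_{\beta+\alpha}u(x)=u(x)$ for all $x\in E$. For $M\subset E$ let $$R^M_\beta 1=\inf\{u : u \text{ is } \mathcal U_\beta\text{-excessive},\ u\ge 1\text{ on }M\},\qquad \widehat{R^M_\beta 1}(x)=\sup_{\alpha>0}\alpha U_{\beta+\alpha}(R^M_\beta 1)(x).$$ A set $M\in\mathcal B$ is polar if $\widehat{R^M_\beta 1}=0$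 on $E$ for every $\beta>0$. **Proposition.** The space $H$ is a Borel subset of $E$ and is polar in each of the following two cases. (a) (Brownian motion on an abstract Wiener space.) $\dim H=\infty$; $\mu$ is a probability measure on $(E,\mathcal B)$ under which every $l\in E'$ is normally distributed with mean $0$ and variance $|l|^2$; and $\nu_t$ is the image of $\mu$ under $z\mapsto\sqrt t\,z$, $t>0$. (b) (Lévy process on a Hilbert space.) $E$ is a Hilbert space; $\psi:H\to\mathbb C$ is a continuous negative definite function with $\psi(0)=0$; the probability measures $\nu_t$ satisfy $$\int_E e^{i\xi(z)}\,\nu_t(dz)=e^{-t\psi(\xi)}\qquad(\xi\in E',\ t>0);$$ and the following hypotheses hold: * (HS) the embedding $H\subset E$ is Hilbert–Schmidt; * (H)(i) there is $C>0$ such that $\int_E \xi(z)^2\,\nu_t(dz)\le C(1+t^2)|\xi|^2$ for all $\xi\in E'$ and $t>0$; * (H)(ii) $\nu_t(H)=0$ for all $t>0$. Here $\psi$ is negative definite if for all $n$ and $x_1,\dots,x_n\in H$ the matrix $\bigl(\psi(x_j)+\overline{\psi(x_k)}-\psi(x_j-x_k)\bigr)_{j,k}$ is Hermitian and positive semidefinite.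 -/

import Mathlib

open MeasureTheory ProbabilityTheory Filter Topology
open scoped ENNReal NNReal ComplexConjugate ComplexOrder

noncomputable section

namespace WienerLevy

/-! ### Potential theory of a convolution semigroup

`ν t`, for `t > 0`, are measures on `E`; the values `ν t` for `t ≤ 0` are never used. -/

section Potential

variable {E : Type*} [AddCommGroup E] [MeasurableSpace E]

/-- The transition kernels `P_t f (x) = ∫ f (x + y) ν_t(dy)`. -/
def transition (ν : ℝ → Measure E) (t : ℝ) (f : E → ℝ≥0∞) (x : E) : ℝ≥0∞ :=
  ∫⁻ y, f (x + y) ∂(ν t)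

/-- The resolvent kernels `U_α f (x) = ∫₀^∞ e^{-α t} P_t f (x) dt`. -/
def resolventKernel (ν : ℝ → Measure E) (α : ℝ) (f : E → ℝ≥0∞) (x : E) : ℝ≥0∞ :=
  ∫⁻ t in Set.Ioi (0 : ℝ), ENNReal.ofReal (Real.exp (-α * t)) * transition ν t f x

/-- `u` is a measurable excessive function of the resolvent `𝓤_β = (U_{β+α})_{α>0}`. -/
structure IsExcessive (ν : ℝ → Measure E) (β : ℝ) (u : E → ℝ≥0∞) : Prop where
  measurable : Measurable u
  supermedian : ∀ α : ℝ, 0 < α → ∀ x, ENNReal.ofReal α * resolventKernel ν (β + α) u x ≤ u x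
  tendsto : ∀ x,
    Tendsto (fun α : ℝ => ENNReal.ofReal α * resolventKernel ν (β + α) u x) atTop (𝓝 (u x))

/-- The reduced function `R_β^M v`: the pointwise infimum of all `𝓤_β`-excessive functions
that dominate `v` on `M`. -/
def reduced (ν : ℝ → Measure E) (β : ℝ) (M : Set E) (v : E → ℝ≥0∞) (x : E) : ℝ≥0∞ :=
  ⨅ (u : E → ℝ≥0∞) (_ : IsExcessive ν β u ∧ ∀ y ∈ M, v y ≤ u y), u x

/-- The `𝓤_β`-excessive regularization `û = sup_{α>0} α U_{β+α} u`. -/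
def regularization (ν : ℝ → Measure E) (β : ℝ) (u : E → ℝ≥0∞) (x : E) : ℝ≥0∞ :=
  ⨆ (α : ℝ) (_ : 0 < α), ENNReal.ofReal α * resolventKernel ν (β + α) u x

/-- A measurable set `M` is polar if the excessive regularization of `R_β^M 1` vanishes
identically, for every `β > 0`. -/
def IsPolar (ν : ℝ → Measure E) (M : Set E) : Prop :=
  MeasurableSet M ∧
    ∀ β : ℝ, 0 < β → ∀ x, regularization ν β (reduced ν β M (fun _ => 1)) x = 0

end Potential

/-! ### Continuous dense embeddings `H ⊂ E` and abstract Wiener spaces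

The inclusion is an injective continuous linear map `i : H →L[ℝ] E` with dense range. A functional
`l ∈ E'` is identified with its restriction `l ∘ i ∈ H'`, hence with an element of `H`; its
`H`-norm `|l|` is `‖l.comp i‖`. -/

section Spaces

variable {H E : Type*} [NormedAddCommGroup H] [InnerProductSpace ℝ H]
  [NormedAddCommGroup E] [NormedSpace ℝ E]

/-- `i` realizes `H` as a continuously and densely embedded linear subspace of `E`. -/
structure IsDenseInclusion (i : H →L[ℝ] E) : Prop where
  injective : Function.Injective i
  denseRange : DenseRange i

/-- `(E, H, μ)` is an abstract Wiener space: `H ⊂ E` continuously and densely, and under `μ` each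
`l ∈ E'` is normally distributed with mean `0` and variance `|l|²`. -/
structure IsAbstractWienerSpace [MeasurableSpace E] (i : H →L[ℝ] E) (μ : Measure E) :
    Prop where
  inclusion : IsDenseInclusion i
  isProbabilityMeasure : IsProbabilityMeasure μ
  gaussian : ∀ l : StrongDual ℝ E, μ.map l = gaussianReal 0 (‖l.comp i‖₊ ^ 2)

/-- The Gaussian semigroup: `μ_t` is the image of `μ` under `z ↦ √t z`. -/
def gaussianSemigroup [MeasurableSpace E] (μ : Measure E) (t : ℝ) : Measure E :=
  μ.map (fun z => Real.sqrt t • z)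

/-- The element of `H` that represents `ξ ∈ E'`, under `E' ⊂ H' ≡ H`. -/
def dualToH [CompleteSpace H] (i : H →L[ℝ] E) (ξ : StrongDual ℝ E) : H :=
  (InnerProductSpace.toDual ℝ H).symm (ξ.comp i)

/-- Negative definite functions `ψ : H → ℂ`: all the matrices
`ψ(x_j) + conj ψ(x_k) - ψ(x_j - x_k)` are Hermitian and positive semidefinite. -/
def IsNegativeDefinite (ψ : H → ℂ) : Prop :=
  ∀ (n : ℕ) (x : Fin n → H),
    (Matrix.of fun j k : Fin n => ψ (x j) + conj (ψ (x k)) - ψ (x j - x k)).PosSemidef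

/-- `ψ` is a continuous negative definite function with `ψ 0 = 0`. -/
structure IsLevyExponent (ψ : H → ℂ) : Prop where
  continuous : Continuous ψ
  negativeDefinite : IsNegativeDefinite ψ
  map_zero : ψ 0 = 0

/-- Hilbert–Schmidt operators: `∑ ‖i e_j‖² < ∞` along an orthonormal basis of `H`. -/
def IsHilbertSchmidt (i : H →L[ℝ] E) : Prop :=
  ∃ (s : Set H) (b : HilbertBasis s ℝ H), Summable fun j : s => ‖i (b j)‖ ^ 2

/-- `(ν_t)_{t>0}` is the family of probability measures on `E` with Fourier transform
`∫ exp(i ξ(z)) ν_t(dz) = exp(-t ψ(ξ))` for `ξ ∈ E' ⊂ H`. -/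
structure IsLevySemigroup [CompleteSpace H] [MeasurableSpace E] (i : H →L[ℝ] E) (ψ : H → ℂ)
    (ν : ℝ → Measure E) : Prop where
  isProbabilityMeasure : ∀ t : ℝ, 0 < t → IsProbabilityMeasure (ν t)
  fourier : ∀ t : ℝ, 0 < t → ∀ ξ : StrongDual ℝ E,
    charFunDual (ν t) ξ = Complex.exp (-(t : ℂ) * ψ (dualToH i ξ))

/-- Hypothesis (H): (i) the weak second moments satisfy
`∫ ξ(z)² ν_t(dz) ≤ C (1 + t²) |ξ|²`, and (ii) `ν_t(H) = 0`. -/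
structure HypothesisH [MeasurableSpace E] (i : H →L[ℝ] E) (ν : ℝ → Measure E) : Prop where
  moments : ∃ C : ℝ, 0 < C ∧ ∀ (ξ : StrongDual ℝ E) (t : ℝ), 0 < t →
    ∫⁻ z, ENNReal.ofReal (ξ z ^ 2) ∂(ν t) ≤ ENNReal.ofReal (C * (1 + t ^ 2) * ‖ξ.comp i‖ ^ 2)
  null : ∀ t : ℝ, 0 < t → ν t (Set.range i) = 0

end Spaces

end WienerLevy

end

/-! By countable additivity of excessive functions it suffices to find, for each ball of radius `n`
in `H`, an excessive `u ≥ 1` on that ball with `α U_{β+α} u (x)` as small as desired; summing over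
`n` then gives an admissible function for `R_β^H 1` with small smoothed value. The candidate is `u =
U_β f`, where `f` is a multiple of the Gaussian cylinder function `exp(-‖Ξ* y‖² / 2)` and `Ξ` maps a
Euclidean space `V` linearly into the span of finitely many functionals on `E`. In Fourier terms,
with `γ` the standard Gaussian measure on `V` and `Ψ = ψ ∘ Ξ`, `u(y) = c Re ∫ exp(i⟨Ξ v, y⟩) / (β +
Ψ(v)) γ(dv)`. By the resolvent equation `α U_{β+α} u = U_β f - U_{β+α} f`, so its size is governed
by `∫ |1 + Re Ψ/β|⁻² dγ`, whereas on the ball `u` should be comparable with `c D / β`, `D = ∫ (1 +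
Re Ψ/β)⁻¹ dγ`. Choosing `c = 2β / D`, everything reduces to: the second moment of `(1 + Re Ψ/β)⁻¹`
is negligible against `D`, and neither `Im Ψ` nor the phase of a nearby `y` destroys the lower bound
(`IsTameExponent.exists_threshold`).

That estimate needs constants independent of `dim V`, and they come from a Gaussian Poincaré
inequality. Negative definiteness makes `√(Re ψ)` subadditive, and the moment bound makes it at most
linear. Hence `log(1 + Re Ψ/β)`, and a bounded substitute for the argument of `1 + Ψ/β`, have slope
`O((1 + Re Ψ/β)^{-1/2})`, and their fluctuations are `O(D)`. If moreover `1 + Re Ψ/β ≥ L` with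
probability at least `1/2`, then the event `1 + Re Ψ/β ≤ κ` has probability `O(D / log²(L/κ))`,
which is negligible against `D` for large `L`.

It remains to make `Re Ψ` large. By Fubini, `∫ exp(-2 Re Ψ) dγ = ∫∫ exp(-‖Ξ*(z - z')‖² / 2) ν_1(dz)
ν_1(dz')`. If `Ξ` is `δ` times an isometry onto the span of more and more members of an orthonormal
basis of `H` taken from `E'`, the exponent diverges unless `z - z' ∈ H`. This exceptional event is
null, because the moment bound together with `ν_1(H) = 0` makes every translate of `H` null. The
Wiener case is the special case `ψ(h) = |h|² / 2`. -/

section GaussianPoincare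

/-! ### Dimension-free Gaussian Poincaré inequality with a pointwise slope -/

theorem norm_fderiv_le_of_local_bound {V : Type*} [NormedAddCommGroup V] [NormedSpace ℝ V]
    {Φ : V → ℝ} {x : V} {s c : ℝ} (hs : 0 ≤ s)
    (hd : DifferentiableAt ℝ Φ x)
    (h : ∀ y, |Φ (x + y) - Φ x| ≤ s * ‖y‖ + c * ‖y‖ ^ 2) : ‖fderiv ℝ Φ x‖ ≤ s := by
  refine le_of_forall_pos_le_add fun ε hε => ?_
  refine hd.hasFDerivAt.le_of_lip' (by positivity) ?_
  have h1 : Tendsto (fun z : V => c * ‖z - x‖) (𝓝 x) (𝓝 0) := by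
    have : Continuous fun z : V => c * ‖z - x‖ := by fun_prop
    simpa using this.tendsto x
  filter_upwards [h1.eventually (gt_mem_nhds hε)] with z hz
  have := h (z - x)
  rw [add_sub_cancel] at this
  rw [Real.norm_eq_abs]
  nlinarith [norm_nonneg (z - x)]

theorem tendsto_circle_difference_quotient {V : Type*} [NormedAddCommGroup V]
    [NormedSpace ℝ V] {Φ : V → ℝ} {x : V}
    (hd : DifferentiableAt ℝ Φ x)
    (y : V) :
    Tendsto (fun n : ℕ => (n : ℝ) * (Φ (Real.cos (Real.pi / 2 / n) • x
      + Real.sin (Real.pi / 2 / n) • y) - Φ x)) atTop (𝓝 (Real.pi / 2 * fderiv ℝ Φ x y)) := by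
  have h1 : HasDerivAt (fun θ : ℝ => Real.cos θ • x + Real.sin θ • y) y 0 := by
    simpa using ((Real.hasDerivAt_cos 0).smul_const x).fun_add ((Real.hasDerivAt_sin 0).smul_const y)
  have h2 : HasDerivAt (fun θ : ℝ => Φ (Real.cos θ • x + Real.sin θ • y)) (fderiv ℝ Φ x y) 0 := by
    have hx : HasFDerivAt Φ (fderiv ℝ Φ x) (Real.cos 0 • x + Real.sin 0 • y) := by
      simpa using hd.hasFDerivAt
    exact hx.comp_hasDerivAt (0 : ℝ) h1
  have h3 := h2.tendsto_slope_zero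
  have hlim : Tendsto (fun n : ℕ => Real.pi / 2 / (n : ℝ)) atTop (𝓝[≠] 0) := by
    refine tendsto_nhdsWithin_iff.2 ⟨tendsto_const_div_atTop_nhds_zero_nat _, ?_⟩
    filter_upwards [eventually_ne_atTop 0] with n hn
    have : (n : ℝ) ≠ 0 := by exact_mod_cast hn
    have := Real.pi_ne_zero
    simp only [Set.mem_compl_iff, Set.mem_singleton_iff]
    positivity
  have h4 := (h3.comp hlim).const_mul (Real.pi / 2)
  refine h4.congr' ?_
  filter_upwards [eventually_ne_atTop 0] with n hn
  have : (n : ℝ) ≠ 0 := by exact_mod_cast hn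
  have := Real.pi_ne_zero
  simp only [Function.comp, zero_add, Real.cos_zero, Real.sin_zero, one_smul, zero_smul, add_zero,
    smul_eq_mul]
  field_simp

variable {V : Type*} [NormedAddCommGroup V] [InnerProductSpace ℝ V] [FiniteDimensional ℝ V]
  [MeasurableSpace V] [BorelSpace V]

/-- The explicit Gaussian density has the right characteristic function. Absolute continuity is what
allows Rademacher's theorem to be used almost surely for the Gaussian measure. -/
theorem stdGaussian_absolutelyContinuous : stdGaussian V ≪ (volume : Measure V) := by
  set c : ℝ := ((Real.pi / (1 / 2)) ^ (Module.finrank ℝ V / 2 : ℝ))⁻¹ with hc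
  have hc0 : 0 ≤ c := by positivity
  set d : V → ℝ≥0 := fun v => Real.toNNReal (c * Real.exp (-(1 / 2) * ‖v‖ ^ 2)) with hd
  have hdm : Measurable d := by fun_prop
  have hdc : ∀ v, ((d v : ℝ) : ℂ) = c * Complex.exp (-(1 / 2 : ℂ) * ‖v‖ ^ 2) := by
    intro v
    rw [hd, Real.coe_toNNReal _ (by positivity)]
    push_cast
    rfl
  have hb : (0 : ℝ) < (1 / 2 : ℂ).re := by norm_num
  have hfin : IsFiniteMeasure ((volume : Measure V).withDensity fun v => (d v : ℝ≥0∞)) := by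
    have hi : Integrable fun v : V => c * Real.exp (-(1 / 2) * ‖v‖ ^ 2) := by
      have := (GaussianFourier.integrable_cexp_neg_mul_sq_norm_add hb 0 (0 : V)).norm
      refine (this.const_mul c).congr (Eventually.of_forall fun v => ?_)
      simp only [Complex.norm_exp]
      congr 2
      simp [← Complex.ofReal_pow]
    exact isFiniteMeasure_withDensity_ofReal hi.2
  have key : stdGaussian V = (volume : Measure V).withDensity fun v => (d v : ℝ≥0∞) := by
    refine Measure.ext_of_charFun (funext fun t => ?_)
    rw [charFun_stdGaussian, charFun_apply, integral_withDensity_eq_integral_smul hdm]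
    have h1 : ∀ v : V, d v • Complex.exp ((inner ℝ v t : ℝ) * Complex.I)
        = c * Complex.exp (-(1 / 2 : ℂ) * ‖v‖ ^ 2 + Complex.I * (inner ℝ t v : ℝ)) := by
      intro v
      rw [NNReal.smul_def, Complex.real_smul, hdc, mul_assoc, ← Complex.exp_add,
        real_inner_comm, mul_comm Complex.I]
    simp_rw [h1]
    rw [integral_const_mul, GaussianFourier.integral_cexp_neg_mul_sq_norm_add hb, ← mul_assoc]
    have h2 : (c : ℂ) * (Real.pi / (1 / 2 : ℂ)) ^ (Module.finrank ℝ V / 2 : ℂ) = 1 := by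
      have : ((Real.pi : ℂ) / (1 / 2 : ℂ)) ^ (Module.finrank ℝ V / 2 : ℂ)
          = (((Real.pi / (1 / 2)) ^ (Module.finrank ℝ V / 2 : ℝ) : ℝ) : ℂ) := by
        rw [Complex.ofReal_cpow (by positivity)]
        push_cast
        rfl
      rw [this, ← Complex.ofReal_mul, hc, inv_mul_cancel₀ (by positivity), Complex.ofReal_one]
    rw [h2, one_mul, Complex.I_sq]
    congr 1
    ring
  rw [key]
  exact withDensity_absolutelyContinuous _ _

theorem integral_sq_strongDual_stdGaussian (L : StrongDual ℝ V) :
    ∫ y, (L y) ^ 2 ∂(stdGaussian V) = ‖L‖ ^ 2 := by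
  rw [← variance_dual_stdGaussian L, variance_of_integral_eq_zero L.continuous.aemeasurable
    (integral_strongDual_stdGaussian L)]

theorem memLp_strongDual_stdGaussian (L : StrongDual ℝ V) : MemLp L 2 (stdGaussian V) :=
  L.comp_memLp' IsGaussian.memLp_two_id

theorem lintegral_sq_strongDual_stdGaussian (L : StrongDual ℝ V) :
    ∫⁻ y, ENNReal.ofReal ((L y) ^ 2) ∂(stdGaussian V) = ENNReal.ofReal (‖L‖ ^ 2) := by
  rw [← integral_sq_strongDual_stdGaussian L, ofReal_integral_eq_lintegral_ofReal]
  · exact (memLp_strongDual_stdGaussian L).integrable_sq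
  · exact Eventually.of_forall fun y => sq_nonneg _

theorem measurePreserving_rotation_stdGaussian (θ : ℝ) :
    MeasurePreserving (ContinuousLinearMap.rotation θ : V × V →L[ℝ] V × V)
      ((stdGaussian V).prod (stdGaussian V)) ((stdGaussian V).prod (stdGaussian V)) :=
  ⟨(ContinuousLinearMap.rotation θ).continuous.measurable,
    IsGaussian.map_rotation_eq_self_of_forall_strongDual_eq_zero
      integral_strongDual_stdGaussian θ⟩

/-- The quarter circle from `p.1` to `p.2` is cut into `n` equal arcs. By rotation invariance of the
product measure all `n` increments of `Φ` have the same second moment, and Cauchy–Schwarz on the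
telescoping sum costs one factor `n`. -/
theorem lintegral_sub_sq_le_of_step {Φ : V → ℝ} (hΦ : Measurable Φ) {n : ℕ} (hn : n ≠ 0) :
    ∫⁻ p : V × V, ENNReal.ofReal ((Φ p.2 - Φ p.1) ^ 2) ∂((stdGaussian V).prod (stdGaussian V)) ≤
    ∫⁻ p : V × V, ENNReal.ofReal ((n * (Φ (Real.cos (Real.pi / 2 / n) • p.1
      + Real.sin (Real.pi / 2 / n) • p.2) - Φ p.1)) ^ 2)
      ∂((stdGaussian V).prod (stdGaussian V)) := by
  set γ := (stdGaussian V).prod (stdGaussian V)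
  set h := Real.pi / 2 / n with hh
  have hn' : (n : ℝ) ≠ 0 := by exact_mod_cast hn
  let G : ℝ → V × V → V := fun θ p => Real.cos θ • p.1 + Real.sin θ • p.2
  have hG : ∀ θ, Measurable (G θ) := fun θ => by dsimp only [G]; fun_prop
  let d : ℝ → V × V → ℝ := fun θ p => Φ (G (θ + h) p) - Φ (G θ p)
  have hdm : ∀ θ, Measurable (d θ) := fun θ =>
    (hΦ.comp (hG _)).sub (hΦ.comp (hG _))
  have hinv : ∀ θ, ∫⁻ p, ENNReal.ofReal (d θ p ^ 2) ∂γ = ∫⁻ p, ENNReal.ofReal (d 0 p ^ 2) ∂γ := by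
    intro θ
    rw [← (measurePreserving_rotation_stdGaussian (V := V) θ).lintegral_comp
      (f := fun p => ENNReal.ofReal (d 0 p ^ 2)) (by have := hdm 0; fun_prop)]
    refine lintegral_congr fun p => ?_
    simp only [d, G, ContinuousLinearMap.rotation_apply, Real.cos_add, Real.sin_add,
      Real.cos_zero, Real.sin_zero, smul_add, smul_smul]
    congr 4 <;> module
  have htel : ∀ p, Φ p.2 - Φ p.1 = ∑ k ∈ Finset.range n, d (k * h) p := by
    intro p
    have := Finset.sum_range_sub (fun k : ℕ => Φ (G (k * h) p)) n
    have e1 : (n : ℝ) * h = Real.pi / 2 := by rw [hh]; field_simp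
    rw [e1] at this
    simp only [G, Real.cos_pi_div_two, Real.sin_pi_div_two, Nat.cast_zero, zero_mul, Real.cos_zero,
      Real.sin_zero, zero_smul, one_smul, zero_add, add_zero] at this
    rw [← this]
    refine Finset.sum_congr rfl fun k _ => ?_
    simp only [d, G]
    push_cast
    rw [add_mul, one_mul]
  calc ∫⁻ p, ENNReal.ofReal ((Φ p.2 - Φ p.1) ^ 2) ∂γ
      ≤ ∫⁻ p, ENNReal.ofReal n * ∑ k ∈ Finset.range n, ENNReal.ofReal (d (k * h) p ^ 2) ∂γ := by
        refine lintegral_mono fun p => ?_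
        dsimp only
        rw [htel, ← ENNReal.ofReal_sum_of_nonneg (fun _ _ => sq_nonneg _),
          ← ENNReal.ofReal_mul (by positivity)]
        refine ENNReal.ofReal_le_ofReal ?_
        simpa using sq_sum_le_card_mul_sum_sq (s := Finset.range n) (f := fun k => d (k * h) p)
    _ = ENNReal.ofReal n * ∑ k ∈ Finset.range n, ∫⁻ p, ENNReal.ofReal (d 0 p ^ 2) ∂γ := by
        rw [lintegral_const_mul' _ _ ENNReal.ofReal_ne_top, lintegral_finsetSum]
        · simp_rw [hinv]
        · intro k _
          have := hdm (k * h)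
          fun_prop
    _ = ∫⁻ p, ENNReal.ofReal ((n * d 0 p) ^ 2) ∂γ := by
        rw [Finset.sum_const, Finset.card_range, nsmul_eq_mul, ← ENNReal.ofReal_natCast,
          ← mul_assoc, ← ENNReal.ofReal_mul (by positivity),
          ← lintegral_const_mul' _ _ ENNReal.ofReal_ne_top]
        refine lintegral_congr fun p => ?_
        rw [← ENNReal.ofReal_mul (by positivity)]
        congr 1
        ring
    _ = _ := by
        refine lintegral_congr fun p => ?_
        simp only [d, G, zero_add, Real.cos_zero, Real.sin_zero, one_smul, zero_smul, add_zero]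

/-- A Gaussian Poincaré inequality with a pointwise bound `S` of the slope. -/
theorem lintegral_sub_sq_le_slope {Φ : V → ℝ} {K : ℝ≥0} (hΦ : LipschitzWith K Φ) {S : V → ℝ}
    {c : ℝ} (hS0 : ∀ x, 0 ≤ S x)
    (hS : ∀ x y, |Φ (x + y) - Φ x| ≤ S x * ‖y‖ + c * ‖y‖ ^ 2) :
    ∫⁻ p : V × V, ENNReal.ofReal ((Φ p.2 - Φ p.1) ^ 2) ∂((stdGaussian V).prod (stdGaussian V)) ≤
      ∫⁻ x, ENNReal.ofReal ((Real.pi / 2 * S x) ^ 2) ∂(stdGaussian V) := by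
  have hΦm : Measurable Φ := hΦ.continuous.measurable
  -- Rademacher's theorem, transferred to the Gaussian measure.
  have hdiff : ∀ᵐ x ∂(stdGaussian V), DifferentiableAt ℝ Φ x :=
    stdGaussian_absolutelyContinuous.ae_le hΦ.ae_differentiableAt
  have hdiff2 : ∀ᵐ p ∂((stdGaussian V).prod (stdGaussian V)), DifferentiableAt ℝ Φ p.1 :=
    Measure.quasiMeasurePreserving_fst.ae hdiff
  have hlim : Tendsto (fun n : ℕ => ∫⁻ p : V × V, ENNReal.ofReal ((n * (Φ (Real.cos
      (Real.pi / 2 / n) • p.1 + Real.sin (Real.pi / 2 / n) • p.2) - Φ p.1)) ^ 2)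
      ∂((stdGaussian V).prod (stdGaussian V))) atTop
      (𝓝 (∫⁻ p : V × V, ENNReal.ofReal ((Real.pi / 2 * fderiv ℝ Φ p.1 p.2) ^ 2)
        ∂((stdGaussian V).prod (stdGaussian V)))) := by
    -- The number of arcs tends to infinity; the Lipschitz bound on `Φ` supplies the square
    -- integrable majorant.
    refine tendsto_lintegral_of_dominated_convergence
      (fun p : V × V => ENNReal.ofReal ((K * (Real.pi / 2)) ^ 2 * (2 * (‖p.1‖ ^ 2 + ‖p.2‖ ^ 2))))
      (fun n => by fun_prop) (fun n => Eventually.of_forall fun p => ?_) ?_ ?_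
    · refine ENNReal.ofReal_le_ofReal ?_
      have hb : |(n : ℝ) * (Φ (Real.cos (Real.pi / 2 / n) • p.1
          + Real.sin (Real.pi / 2 / n) • p.2) - Φ p.1)| ≤
          K * (Real.pi / 2) * (‖p.1‖ + ‖p.2‖) := by
        rcases eq_or_ne n 0 with rfl | hn
        · simp only [CharP.cast_eq_zero, zero_mul, abs_zero]
          positivity
        have hn' : (0 : ℝ) < n := by exact_mod_cast Nat.pos_of_ne_zero hn
        set h := Real.pi / 2 / n with hh
        have hh0 : 0 ≤ h := by positivity
        have hnh : n * h = Real.pi / 2 := by rw [hh]; field_simp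
        have h1 := hΦ.dist_le_mul (Real.cos h • p.1 + Real.sin h • p.2) p.1
        rw [Real.dist_eq, dist_eq_norm] at h1
        have h2 : ‖Real.cos h • p.1 + Real.sin h • p.2 - p.1‖ ≤ h * (‖p.1‖ + ‖p.2‖) := by
          have : Real.cos h • p.1 + Real.sin h • p.2 - p.1
              = (Real.cos h - 1) • p.1 + Real.sin h • p.2 := by module
          rw [this]
          refine (norm_add_le _ _).trans ?_
          rw [norm_smul, norm_smul, Real.norm_eq_abs, Real.norm_eq_abs, mul_add]
          have a1 : |Real.cos h - 1| ≤ h := by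
            have := Real.abs_cos_sub_cos_le h 0
            simpa [abs_of_nonneg hh0] using this
          have a2 : |Real.sin h| ≤ h := by
            have := Real.abs_sin_sub_sin_le h 0
            simpa [abs_of_nonneg hh0] using this
          gcongr
        rw [abs_mul, abs_of_pos hn']
        calc n * |Φ (Real.cos h • p.1 + Real.sin h • p.2) - Φ p.1|
            ≤ n * (K * (h * (‖p.1‖ + ‖p.2‖))) := by
              gcongr
              exact h1.trans (by gcongr)
          _ = K * (n * h) * (‖p.1‖ + ‖p.2‖) := by ring
          _ = _ := by rw [hnh]
      calc _ = |(n : ℝ) * (Φ (Real.cos (Real.pi / 2 / n) • p.1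
          + Real.sin (Real.pi / 2 / n) • p.2) - Φ p.1)| ^ 2 := (sq_abs _).symm
        _ ≤ (K * (Real.pi / 2) * (‖p.1‖ + ‖p.2‖)) ^ 2 := by gcongr
        _ ≤ _ := by
          rw [mul_pow]
          gcongr
          nlinarith [sq_nonneg (‖p.1‖ - ‖p.2‖)]
    · have hi : Integrable (fun x : V => ‖x‖ ^ 2) (stdGaussian V) :=
        (IsGaussian.memLp_two_id (μ := stdGaussian V)).norm.integrable_sq
      have : Integrable (fun p : V × V =>
          (K * (Real.pi / 2)) ^ 2 * (2 * (‖p.1‖ ^ 2 + ‖p.2‖ ^ 2)))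
          ((stdGaussian V).prod (stdGaussian V)) :=
        (((hi.comp_fst _).add (hi.comp_snd _)).const_mul 2).const_mul _
      exact (hasFiniteIntegral_iff_ofReal (Eventually.of_forall fun p => by positivity)).1
        this.2 |>.ne
    · filter_upwards [hdiff2] with p hp
      exact (ENNReal.continuous_ofReal.tendsto _).comp
        ((tendsto_circle_difference_quotient hp p.2).pow 2)
  refine (ge_of_tendsto hlim ((eventually_ne_atTop 0).mono fun n hn =>
    lintegral_sub_sq_le_of_step hΦm hn)).trans ?_
  have hm : Measurable fun p : V × V => ENNReal.ofReal ((Real.pi / 2 * fderiv ℝ Φ p.1 p.2) ^ 2) := by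
    have : Measurable fun p : V × V => fderiv ℝ Φ p.1 p.2 :=
      isBoundedBilinearMap_apply.continuous.measurable.comp
        (((measurable_fderiv ℝ Φ).comp measurable_fst).prodMk measurable_snd)
    fun_prop
  rw [lintegral_prod _ hm.aemeasurable]
  refine lintegral_mono_ae ?_
  filter_upwards [hdiff] with x hx
  have h1 : ∀ y, ENNReal.ofReal ((Real.pi / 2 * fderiv ℝ Φ x y) ^ 2)
      = ENNReal.ofReal ((Real.pi / 2) ^ 2) * ENNReal.ofReal ((fderiv ℝ Φ x y) ^ 2) := fun y => by
    rw [mul_pow, ENNReal.ofReal_mul (by positivity)]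
  simp_rw [h1]
  -- For fixed `x` the derivative is a linear form in the independent variable `y`, whose second
  -- moment is exactly its squared norm; no dimension appears.
  rw [lintegral_const_mul' _ _ ENNReal.ofReal_ne_top, lintegral_sq_strongDual_stdGaussian,
    ← ENNReal.ofReal_mul (by positivity), ← mul_pow]
  refine ENNReal.ofReal_le_ofReal ?_
  have := norm_fderiv_le_of_local_bound (hS0 x) hx (hS x)
  gcongr

end GaussianPoincare

/-- Continuous exponents with the quasi-additivity of negative definite functions, with at most
quadratic growth of the real part and Lipschitz continuous at the origin. -/
structure IsTameExponent {V : Type*} [NormedAddCommGroup V] (Ψ : V → ℂ) (K C r : ℝ) : Prop where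
  continuous : Continuous Ψ
  re_nonneg : ∀ x, 0 ≤ (Ψ x).re
  map_neg : ∀ x, Ψ (-x) = conj (Ψ x)
  quasi_additive : ∀ x y, ‖Ψ x + Ψ y - Ψ (x + y)‖ ≤ 2 * √(Ψ x).re * √(Ψ y).re
  sqrt_re_le : ∀ x, √(Ψ x).re ≤ K * ‖x‖
  norm_le : ∀ x, ‖x‖ ≤ r → ‖Ψ x‖ ≤ C * ‖x‖

/-! ### Increments of tame exponents -/

namespace IsTameExponent

section Increments

variable {V : Type*} [NormedAddCommGroup V] {Ψ : V → ℂ} {K C r : ℝ}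

theorem sqrt_re_add_le (h : IsTameExponent Ψ K C r) (x y : V) :
    √(Ψ (x + y)).re ≤ √(Ψ x).re + √(Ψ y).re := by
  refine Real.sqrt_le_iff.2 ⟨by positivity, ?_⟩
  have h1 := (Complex.abs_re_le_norm _).trans (h.quasi_additive x y)
  have h2 := (abs_le.1 h1).1
  simp only [Complex.sub_re, Complex.add_re] at h2
  nlinarith [Real.sq_sqrt (h.re_nonneg x), Real.sq_sqrt (h.re_nonneg y)]

theorem abs_sqrt_re_sub_le (h : IsTameExponent Ψ K C r) (x y : V) :
    |√(Ψ (x + y)).re - √(Ψ x).re| ≤ K * ‖y‖ := by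
  have h1 := h.sqrt_re_add_le x y
  have h2 := h.sqrt_re_add_le (x + y) (-y)
  rw [add_neg_cancel_right] at h2
  have h3 := h.sqrt_re_le y
  have h4 := h.sqrt_re_le (-y)
  rw [norm_neg] at h4
  exact abs_le.2 ⟨by linarith, by linarith⟩

theorem one_le_one_add_re (h : IsTameExponent Ψ K C r) (x : V) : 1 ≤ 1 + (Ψ x).re := by
  linarith [h.re_nonneg x]

theorem continuous_one_add_re (h : IsTameExponent Ψ K C r) :
    Continuous fun x => 1 + (Ψ x).re :=
  continuous_const.add (Complex.continuous_re.comp h.continuous)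

theorem one_le_sqrt (h : IsTameExponent Ψ K C r) (x : V) : 1 ≤ √(1 + (Ψ x).re) :=
  Real.one_le_sqrt.2 (h.one_le_one_add_re x)

theorem abs_sqrt_one_add_re_sub_le (h : IsTameExponent Ψ K C r) (x y : V) :
    |√(1 + (Ψ (x + y)).re) - √(1 + (Ψ x).re)| ≤ K * ‖y‖ := by
  refine le_trans ?_ (h.abs_sqrt_re_sub_le x y)
  -- Both differences of roots, times the corresponding sum of roots, equal `t - s`, and the sum is
  -- larger after the shift by `1`.
  have key : ∀ s t : ℝ, 0 ≤ s → s ≤ t → |√(1 + t) - √(1 + s)| ≤ |√t - √s| := by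
    intro s t hs hst
    rw [abs_of_nonneg (by linarith [Real.sqrt_le_sqrt (show 1 + s ≤ 1 + t by linarith)]),
      abs_of_nonneg (by linarith [Real.sqrt_le_sqrt hst])]
    have a1 := Real.sq_sqrt (show 0 ≤ 1 + t by linarith)
    have a2 := Real.sq_sqrt (show 0 ≤ 1 + s by linarith)
    have a3 := Real.sq_sqrt (show 0 ≤ t by linarith)
    have a4 := Real.sq_sqrt hs
    have b1 := Real.sqrt_le_sqrt (show t ≤ 1 + t by linarith)
    have b2 := Real.sqrt_le_sqrt (show s ≤ 1 + s by linarith)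
    have b3 := Real.sqrt_le_sqrt hst
    have b4 : 0 < √(1 + s) := Real.sqrt_pos.2 (by linarith)
    have b5 := Real.sqrt_le_sqrt (show 1 + s ≤ 1 + t by linarith)
    have c1 : (√(1 + t) - √(1 + s)) * (√(1 + t) + √(1 + s)) = (√t - √s) * (√t + √s) := by
      nlinarith
    have c2 : (√t - √s) * (√t + √s) ≤ (√t - √s) * (√(1 + t) + √(1 + s)) := by
      gcongr
    exact le_of_mul_le_mul_right (c1.trans_le c2) (by linarith)
  rcases le_total (Ψ x).re (Ψ (x + y)).re with hc | hc
  · exact key _ _ (h.re_nonneg _) hc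
  · rw [abs_sub_comm, abs_sub_comm √(Ψ (x + y)).re]
    exact key _ _ (h.re_nonneg _) hc

/-- The slope is that of `log` at the base point `b`. Keeping the factor `1 / b` is essential, and
the error is quadratic because both arguments are at least `1`. -/
theorem abs_log_sub_log_le {b b' : ℝ} (hb : 1 ≤ b) (hb' : 1 ≤ b') :
    |Real.log b' - Real.log b| ≤ |b' - b| / b + |b' - b| ^ 2 := by
  have h0 : 0 < b := by linarith
  have h0' : 0 < b' := by linarith
  have hq : 0 ≤ |b' - b| / b := by positivity
  rw [abs_le]
  constructor
  · have h1 := Real.log_le_sub_one_of_pos (div_pos h0 h0')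
    rw [Real.log_div h0.ne' h0'.ne'] at h1
    have h2 : b / b' - 1 ≤ |b' - b| / b + |b' - b| ^ 2 := by
      have e : b / b' - 1 = (b - b') / b + (b - b') ^ 2 / (b * b') := by field_simp; ring
      rw [e]
      have e1 : (b - b') / b ≤ |b' - b| / b := by
        gcongr
        rw [abs_sub_comm]
        exact le_abs_self _
      have e2 : (b - b') ^ 2 / (b * b') ≤ |b' - b| ^ 2 := by
        rw [sq_abs, ← neg_sub, neg_sq]
        exact div_le_self (sq_nonneg _) (by nlinarith)
      linarith
    linarith
  · have h1 := Real.log_le_sub_one_of_pos (div_pos h0' h0)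
    rw [Real.log_div h0'.ne' h0.ne'] at h1
    have h2 : b' / b - 1 ≤ |b' - b| / b := by
      have e : b' / b - 1 = (b' - b) / b := by field_simp
      rw [e]
      gcongr
      exact le_abs_self _
    nlinarith [sq_nonneg |b' - b|]

theorem log_eq_two_mul_log_sqrt (h : IsTameExponent Ψ K C r) (x : V) :
    Real.log (1 + (Ψ x).re) = 2 * Real.log √(1 + (Ψ x).re) := by
  rw [Real.log_sqrt (by linarith [h.re_nonneg x])]
  ring

/-- Since `√(1 + Re Ψ)` is `K`-Lipschitz, its logarithm has slope at most `K / √(1 + Re Ψ)`.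
Squared, this is a multiple of `1 / (1 + Re Ψ)`, so the Poincaré inequality bounds the fluctuation
of the logarithm by the very integral to be estimated. -/
theorem abs_log_increment_le (h : IsTameExponent Ψ K C r) (x y : V) :
    |Real.log (1 + (Ψ (x + y)).re) - Real.log (1 + (Ψ x).re)| ≤
      2 * K / √(1 + (Ψ x).re) * ‖y‖ + 2 * K ^ 2 * ‖y‖ ^ 2 := by
  have hb := h.one_le_sqrt x
  have h1 := abs_log_sub_log_le hb (h.one_le_sqrt (x + y))
  have h2 := h.abs_sqrt_one_add_re_sub_le x y
  rw [h.log_eq_two_mul_log_sqrt, h.log_eq_two_mul_log_sqrt x, ← mul_sub, abs_mul, abs_two]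
  set δ := |√(1 + (Ψ (x + y)).re) - √(1 + (Ψ x).re)|
  have h3 : δ / √(1 + (Ψ x).re) ≤ K * ‖y‖ / √(1 + (Ψ x).re) := by gcongr
  have h4 : δ ^ 2 ≤ (K * ‖y‖) ^ 2 := by
    have : 0 ≤ δ := abs_nonneg _
    gcongr
  have e : 2 * K / √(1 + (Ψ x).re) * ‖y‖ = 2 * (K * ‖y‖ / √(1 + (Ψ x).re)) := by ring
  rw [e]
  nlinarith

theorem lipschitzWith_log (h : IsTameExponent Ψ K C r) (hK : 0 ≤ K) :
    LipschitzWith (Real.toNNReal (2 * K)) fun x => Real.log (1 + (Ψ x).re) := by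
  refine LipschitzWith.of_dist_le_mul fun x y => ?_
  rw [Real.coe_toNNReal _ (by positivity), Real.dist_eq, dist_eq_norm]
  have h2 := h.abs_sqrt_one_add_re_sub_le y (x - y)
  rw [add_sub_cancel] at h2
  rw [h.log_eq_two_mul_log_sqrt, h.log_eq_two_mul_log_sqrt y, ← mul_sub, abs_mul, abs_two, mul_assoc]
  gcongr
  refine le_trans ?_ h2
  have key : ∀ b b' : ℝ, 1 ≤ b → 1 ≤ b' → Real.log b' - Real.log b ≤ |b' - b| := by
    intro b b' hb hb'
    have h0 : 0 < b := by linarith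
    have h0' : 0 < b' := by linarith
    have h1 := Real.log_le_sub_one_of_pos (div_pos h0' h0)
    rw [Real.log_div h0'.ne' h0.ne'] at h1
    have e : b' / b - 1 = (b' - b) / b := by field_simp
    rw [e] at h1
    calc _ ≤ (b' - b) / b := h1
      _ ≤ |b' - b| / b := by gcongr; exact le_abs_self _
      _ ≤ _ := div_le_self (abs_nonneg _) hb
  rw [abs_le]
  have k1 := key _ _ (h.one_le_sqrt x) (h.one_le_sqrt y)
  have k2 := key _ _ (h.one_le_sqrt y) (h.one_le_sqrt x)
  rw [abs_sub_comm] at k1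
  constructor <;> linarith

theorem abs_im_sub_le (h : IsTameExponent Ψ K C r) (x : V) {y : V} (hy : ‖y‖ ≤ r) :
    |(Ψ (x + y)).im - (Ψ x).im| ≤ C * ‖y‖ + 2 * √(Ψ x).re * (K * ‖y‖) := by
  have h1 := (Complex.abs_im_le_norm _).trans (h.quasi_additive x y)
  have h2 := (Complex.abs_im_le_norm _).trans (h.norm_le y hy)
  simp only [Complex.sub_im, Complex.add_im] at h1
  have h3 : 2 * √(Ψ x).re * √(Ψ y).re ≤ 2 * √(Ψ x).re * (K * ‖y‖) := by
    gcongr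
    exact h.sqrt_re_le y
  rw [abs_le] at *
  constructor <;> linarith

theorem abs_re_sub_le (h : IsTameExponent Ψ K C r) (x y : V) :
    |(Ψ (x + y)).re - (Ψ x).re| ≤ K * ‖y‖ * (2 * √(Ψ x).re + K * ‖y‖) := by
  have h1 := h.abs_sqrt_re_sub_le x y
  have a1 := Real.sq_sqrt (h.re_nonneg x)
  have a2 := Real.sq_sqrt (h.re_nonneg (x + y))
  have e : (Ψ (x + y)).re - (Ψ x).re
      = (√(Ψ (x + y)).re - √(Ψ x).re) * (√(Ψ (x + y)).re + √(Ψ x).re) := by nlinarith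
  rw [e, abs_mul]
  have h3 : |√(Ψ (x + y)).re + √(Ψ x).re| ≤ 2 * √(Ψ x).re + K * ‖y‖ := by
    rw [abs_of_nonneg (by positivity)]
    linarith [(abs_le.1 h1).2]
  exact mul_le_mul h1 h3 (abs_nonneg _) ((abs_nonneg _).trans h1)

end Increments

end IsTameExponent

/-- A bounded substitute for the argument of the complex number `a + i h`. -/
noncomputable def slopeRatio (a h : ℝ) : ℝ := h / (a + |h|)

theorem abs_slopeRatio_le_one {a h : ℝ} (ha : 0 < a) : |slopeRatio a h| ≤ 1 := by
  have : 0 < a + |h| := by positivity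
  rw [slopeRatio, abs_div, abs_of_pos this, div_le_one this]
  linarith

theorem abs_slopeRatio_sub_le {a h a' h' : ℝ} (ha : 0 < a) (ha' : 0 < a') :
    |slopeRatio a' h' - slopeRatio a h| ≤ 3 * (|h' - h| + |a' - a|) / a := by
  have p : 0 < a + |h| := by positivity
  have p' : 0 < a' + |h'| := by positivity
  have e : slopeRatio a' h' - slopeRatio a h
      = ((h' - h) * a' - h' * (a' - a) + ((h' - h) * |h'| - h' * (|h'| - |h|)))
        / ((a' + |h'|) * (a + |h|)) := by
    rw [slopeRatio, slopeRatio]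
    field_simp
    ring
  rw [e, abs_div, abs_of_pos (mul_pos p' p), div_le_div_iff₀ (mul_pos p' p) ha]
  have t1 : |(h' - h) * a'| = |h' - h| * a' := by rw [abs_mul, abs_of_pos ha']
  have t2 : |h' * (a' - a)| = |h'| * |a' - a| := abs_mul _ _
  have t3 : abs ((h' - h) * |h'|) = |h' - h| * |h'| := by rw [abs_mul, abs_abs]
  have t4 : abs (h' * (|h'| - |h|)) ≤ |h'| * |h' - h| := by
    rw [abs_mul]
    exact mul_le_mul_of_nonneg_left (abs_abs_sub_abs_le h' h) (abs_nonneg _)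
  have t5 : abs ((h' - h) * a' - h' * (a' - a) + ((h' - h) * |h'| - h' * (|h'| - |h|)))
      ≤ |h' - h| * a' + |h'| * |a' - a| + (|h' - h| * |h'| + |h'| * |h' - h|) := by
    refine (abs_add_le _ _).trans ?_
    have := abs_sub ((h' - h) * a') (h' * (a' - a))
    have := abs_sub ((h' - h) * |h'|) (h' * (|h'| - |h|))
    linarith
  have t6 : |h' - h| * a' + |h'| * |a' - a| + (|h' - h| * |h'| + |h'| * |h' - h|)
      ≤ 3 * (|h' - h| + |a' - a|) * (a' + |h'|) := by
    nlinarith [mul_nonneg (abs_nonneg (h' - h)) ha'.le,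
      mul_nonneg (abs_nonneg (a' - a)) ha'.le, mul_nonneg (abs_nonneg (a' - a)) (abs_nonneg h'),
      mul_nonneg (abs_nonneg (h' - h)) (abs_nonneg h')]
  have t7 : 0 ≤ 3 * (|h' - h| + |a' - a|) * (a' + |h'|) := by positivity
  calc _ ≤ 3 * (|h' - h| + |a' - a|) * (a' + |h'|) * a := by gcongr; exact t5.trans t6
    _ ≤ 3 * (|h' - h| + |a' - a|) * (a' + |h'|) * (a + |h|) := by gcongr; linarith [abs_nonneg h]
    _ = _ := by ring

/-- The loss relative to `1 / a` is the factor `h² / (a² + h²)`, which is at most `2 h² / (a +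
|h|)²`. Thus the imaginary part is harmless wherever the slope ratio is small. -/
theorem slopeRatio_re_inv_bound {a : ℝ} (h : ℝ) (ha : 0 < a) :
    1 / a - 2 * slopeRatio a h ^ 2 / a ≤ a / (a ^ 2 + h ^ 2) := by
  have p : 0 < a + |h| := by positivity
  have p2 : 0 < a ^ 2 + h ^ 2 := by positivity
  have e : a / (a ^ 2 + h ^ 2) = 1 / a - (h ^ 2 / (a ^ 2 + h ^ 2)) / a := by
    field_simp
    ring
  rw [e]
  gcongr
  rw [slopeRatio, div_pow, ← mul_div_assoc, div_le_div_iff₀ p2 (by positivity)]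
  have : (a + |h|) ^ 2 ≤ 2 * (a ^ 2 + h ^ 2) := by
    nlinarith [sq_nonneg (a - |h|), sq_abs h]
  nlinarith [sq_nonneg h]

/-! ### The phase of the exponent and pointwise bounds for the resolvent density -/

namespace IsTameExponent

variable {V : Type*} [NormedAddCommGroup V] {Ψ : V → ℂ} {K C r : ℝ}

theorem abs_slopeRatio_increment_le (h : IsTameExponent Ψ K C r) (hK : 0 ≤ K) (hC : 0 ≤ C)
    (hr : 0 < r) (x y : V) :
    |slopeRatio (1 + (Ψ (x + y)).re) (Ψ (x + y)).im - slopeRatio (1 + (Ψ x).re) (Ψ x).im| ≤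
      3 * (C + 4 * K) / √(1 + (Ψ x).re) * ‖y‖ + (3 * K ^ 2 + 2 / r ^ 2) * ‖y‖ ^ 2 := by
  have ha : 0 < 1 + (Ψ x).re := by linarith [h.one_le_one_add_re x]
  have ha' : 0 < 1 + (Ψ (x + y)).re := by linarith [h.one_le_one_add_re (x + y)]
  rcases le_or_gt ‖y‖ r with hy | hy
  · refine (abs_slopeRatio_sub_le ha ha').trans ?_
    have h1 := h.abs_im_sub_le x hy
    have h2 := h.abs_re_sub_le x y
    rw [add_sub_add_left_eq_sub]
    set b := √(1 + (Ψ x).re)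
    have hb : 1 ≤ b := h.one_le_sqrt x
    have hbF : √(Ψ x).re ≤ b := Real.sqrt_le_sqrt (by linarith)
    have hbb : b ^ 2 = 1 + (Ψ x).re := Real.sq_sqrt ha.le
    rw [← hbb]
    have h3 : |(Ψ (x + y)).im - (Ψ x).im| + |(Ψ (x + y)).re - (Ψ x).re| ≤
        (C + 4 * K) * b * ‖y‖ + K ^ 2 * ‖y‖ ^ 2 := by
      have e1 : C * ‖y‖ ≤ C * b * ‖y‖ := by
        gcongr
        nlinarith
      have e2 : 4 * (√(Ψ x).re * (K * ‖y‖)) ≤ 4 * (b * (K * ‖y‖)) := by gcongr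
      nlinarith
    calc 3 * (|(Ψ (x + y)).im - (Ψ x).im| + |(Ψ (x + y)).re - (Ψ x).re|) / b ^ 2
        ≤ 3 * ((C + 4 * K) * b * ‖y‖ + K ^ 2 * ‖y‖ ^ 2) / b ^ 2 := by gcongr
      _ = 3 * (C + 4 * K) / b * ‖y‖ + 3 * K ^ 2 * ‖y‖ ^ 2 / b ^ 2 := by
          field_simp
      _ ≤ 3 * (C + 4 * K) / b * ‖y‖ + 3 * K ^ 2 * ‖y‖ ^ 2 := by
          gcongr
          exact div_le_self (by positivity) (by nlinarith)
      _ ≤ _ := by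
          have : 0 ≤ 2 / r ^ 2 * ‖y‖ ^ 2 := by positivity
          linarith
  -- Beyond radius `r` there is no control of `Ψ` by `norm_le`, but the ratio is bounded by `1`, so
  -- its increment, at most `2`, fits into the quadratic term.
  · have h1 := abs_slopeRatio_le_one (h := (Ψ x).im) ha
    have h2 := abs_slopeRatio_le_one (h := (Ψ (x + y)).im) ha'
    have h3 : 2 ≤ 2 / r ^ 2 * ‖y‖ ^ 2 := by
      rw [div_mul_eq_mul_div, le_div_iff₀ (by positivity)]
      gcongr
    have h4 : 0 ≤ 3 * (C + 4 * K) / √(1 + (Ψ x).re) * ‖y‖ := by positivity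
    have h5 : 0 ≤ 3 * K ^ 2 * ‖y‖ ^ 2 := by positivity
    have h6 := abs_sub (slopeRatio (1 + (Ψ (x + y)).re) (Ψ (x + y)).im)
      (slopeRatio (1 + (Ψ x).re) (Ψ x).im)
    linarith

theorem exists_lipschitzWith_slopeRatio (h : IsTameExponent Ψ K C r) (hK : 0 ≤ K) (hC : 0 ≤ C)
    (hr : 0 < r) : ∃ M, LipschitzWith M fun x => slopeRatio (1 + (Ψ x).re) (Ψ x).im := by
  refine ⟨Real.toNNReal (3 * (C + 4 * K) + (3 * K ^ 2 + 2 / r ^ 2) + 2),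
    LipschitzWith.of_dist_le_mul fun x y => ?_⟩
  rw [Real.coe_toNNReal _ (by positivity), Real.dist_eq, dist_eq_norm]
  have h1 := h.abs_slopeRatio_increment_le hK hC hr y (x - y)
  rw [add_sub_cancel] at h1
  have hn := norm_nonneg (x - y)
  have hA : 0 ≤ 3 * (C + 4 * K) := by positivity
  have hB : 0 ≤ 3 * K ^ 2 + 2 / r ^ 2 := by positivity
  rcases le_or_gt ‖x - y‖ 1 with hy | hy
  · have h2 : 3 * (C + 4 * K) / √(1 + (Ψ y).re) ≤ 3 * (C + 4 * K) :=
      div_le_self hA (h.one_le_sqrt y)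
    have h3 : ‖x - y‖ ^ 2 ≤ ‖x - y‖ := by nlinarith
    nlinarith
  · have h2 := abs_slopeRatio_le_one (h := (Ψ x).im)
      (show 0 < 1 + (Ψ x).re by linarith [h.one_le_one_add_re x])
    have h3 := abs_slopeRatio_le_one (h := (Ψ y).im)
      (show 0 < 1 + (Ψ y).re by linarith [h.one_le_one_add_re y])
    have h6 := abs_sub (slopeRatio (1 + (Ψ x).re) (Ψ x).im) (slopeRatio (1 + (Ψ y).re) (Ψ y).im)
    nlinarith

theorem re_exp_div_lower_bound (h : IsTameExponent Ψ K C r) (t : ℝ) (x : V) :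
    1 / (1 + (Ψ x).re) - 2 * slopeRatio (1 + (Ψ x).re) (Ψ x).im ^ 2 / (1 + (Ψ x).re)
      - min 2 |t| / (1 + (Ψ x).re) ≤ (Complex.exp (t * Complex.I) / (1 + Ψ x)).re := by
  have ha := h.one_le_one_add_re x
  have h1 := slopeRatio_re_inv_bound (Ψ x).im (show 0 < 1 + (Ψ x).re by linarith)
  have hre : (1 + Ψ x).re = 1 + (Ψ x).re := by simp
  have hnorm : 1 + (Ψ x).re ≤ ‖1 + Ψ x‖ := by
    rw [← hre]
    exact Complex.re_le_norm _
  have e1 : ((1 + Ψ x)⁻¹).re = (1 + (Ψ x).re) / ((1 + (Ψ x).re) ^ 2 + (Ψ x).im ^ 2) := by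
    rw [Complex.inv_re, Complex.normSq_apply]
    simp [sq]
  have e2 : Complex.exp (t * Complex.I) / (1 + Ψ x)
      = (1 + Ψ x)⁻¹ + (Complex.exp (t * Complex.I) - 1) * (1 + Ψ x)⁻¹ := by ring
  have h2 : ‖(Complex.exp (t * Complex.I) - 1) * (1 + Ψ x)⁻¹‖ ≤ min 2 |t| / (1 + (Ψ x).re) := by
    rw [norm_mul, norm_inv, ← div_eq_mul_inv]
    have h3 : ‖Complex.exp (t * Complex.I) - 1‖ ≤ min 2 |t| := by
      refine le_min ?_ ?_
      · refine (norm_sub_le _ _).trans ?_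
        rw [Complex.norm_exp_ofReal_mul_I, norm_one]
        norm_num
      · have := Real.norm_exp_I_mul_ofReal_sub_one_le (x := t)
        rwa [mul_comm, Real.norm_eq_abs] at this
    gcongr
  have h4 := (abs_le.1 ((Complex.abs_re_le_norm _).trans h2)).1
  rw [e2, Complex.add_re, e1]
  linarith

/-- A decoupling device: `|t|` and `1 / (1 + Re Ψ)` will depend on the same Gaussian point, so the
density is moved to an independent point `y`. This is possible if the two values differ at most by
the factor `4`. Otherwise the logarithms differ by at least `1`, which the Poincaré inequality makes
rare; small values at `x` are paid for by the indicator. -/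
theorem min_div_le (h : IsTameExponent Ψ K C r) {κ : ℝ} (hκ : 1 ≤ κ) (t : ℝ) (x y : V) :
    min 2 |t| / (1 + (Ψ x).re) ≤ 4 * (|t| * (1 / (1 + (Ψ y).re)))
      + 2 * {x | 1 + (Ψ x).re ≤ κ}.indicator (fun _ => (1 : ℝ)) x
      + 2 / κ * (Real.log (1 + (Ψ y).re) - Real.log (1 + (Ψ x).re)) ^ 2 := by
  have hx := h.one_le_one_add_re x
  have hy := h.one_le_one_add_re y
  have i0 : 0 ≤ {x | 1 + (Ψ x).re ≤ κ}.indicator (fun _ => (1 : ℝ)) x :=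
    Set.indicator_nonneg (fun _ _ => zero_le_one) _
  have i1 : 1 + (Ψ x).re ≤ κ → {x | 1 + (Ψ x).re ≤ κ}.indicator (fun _ => (1 : ℝ)) x = 1 :=
    fun hh => Set.indicator_of_mem (by exact hh) _
  set i := {x | 1 + (Ψ x).re ≤ κ}.indicator (fun _ => (1 : ℝ)) x
  set a := 1 + (Ψ x).re
  set a' := 1 + (Ψ y).re
  have n1 : 0 ≤ |t| * (1 / a') := by positivity
  have n2 : 0 ≤ 2 / κ * (Real.log a' - Real.log a) ^ 2 := by positivity
  by_cases hA : a ≤ κ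
  · rw [i1 hA]
    have : min 2 |t| / a ≤ 2 := (div_le_self (by positivity) hx).trans (min_le_left _ _)
    linarith
  push Not at hA
  rcases le_or_gt a' (4 * a) with h4 | h4
  · have : min 2 |t| / a ≤ 4 * (|t| * (1 / a')) := by
      rw [mul_one_div, ← mul_div_assoc, div_le_div_iff₀ (by linarith) (by linarith)]
      have : min 2 |t| ≤ |t| := min_le_right _ _
      have h0 : 0 ≤ min 2 |t| := by positivity
      calc min 2 |t| * a' ≤ |t| * (4 * a) := by gcongr
        _ = _ := by ring
    linarith
  · have l1 : Real.log 4 + Real.log a ≤ Real.log a' := by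
      rw [← Real.log_mul (by norm_num) (by linarith)]
      exact Real.log_le_log (by linarith) h4.le
    have l2 : 1 ≤ Real.log 4 := by
      rw [Real.le_log_iff_exp_le (by norm_num)]
      linarith [Real.exp_one_lt_d9]
    have l3 : 1 ≤ (Real.log a' - Real.log a) ^ 2 := by nlinarith
    have : min 2 |t| / a ≤ 2 / κ * (Real.log a' - Real.log a) ^ 2 := by
      calc min 2 |t| / a ≤ 2 / κ := by
            gcongr
            exact min_le_left _ _
        _ = 2 / κ * 1 := (mul_one _).symm
        _ ≤ _ := by gcongr
    linarith

theorem slopeRatio_sq_div_le (h : IsTameExponent Ψ K C r) {κ : ℝ} (hκ : 1 ≤ κ) (x : V) :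
    slopeRatio (1 + (Ψ x).re) (Ψ x).im ^ 2 / (1 + (Ψ x).re) ≤
      {x | 1 + (Ψ x).re ≤ κ}.indicator (fun _ => (1 : ℝ)) x
      + 1 / κ * slopeRatio (1 + (Ψ x).re) (Ψ x).im ^ 2 := by
  have ha := h.one_le_one_add_re x
  have hq := abs_slopeRatio_le_one (a := 1 + (Ψ x).re) (h := (Ψ x).im) (by linarith)
  have hq2 : slopeRatio (1 + (Ψ x).re) (Ψ x).im ^ 2 ≤ 1 := (sq_le_one_iff_abs_le_one _).2 hq
  by_cases hA : 1 + (Ψ x).re ≤ κ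
  · rw [Set.indicator_of_mem (by exact hA)]
    have := (div_le_self (sq_nonneg _) ha).trans hq2
    have : 0 ≤ 1 / κ * slopeRatio (1 + (Ψ x).re) (Ψ x).im ^ 2 := by positivity
    linarith
  · rw [Set.indicator_of_notMem (by exact hA), zero_add, one_div_mul_eq_div]
    push Not at hA
    gcongr

theorem continuous_exp_div [NormedSpace ℝ V] (h : IsTameExponent Ψ K C r) (θ : StrongDual ℝ V) :
    Continuous fun x => (Complex.exp (θ x * Complex.I) / (1 + Ψ x)).re := by
  refine Complex.continuous_re.comp (Continuous.div (by fun_prop)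
    (continuous_const.add h.continuous) fun x hx => ?_)
  have := congrArg Complex.re hx
  simp only [Complex.add_re, Complex.one_re, Complex.zero_re] at this
  linarith [h.one_le_one_add_re x]

theorem abs_re_exp_div_le_one (h : IsTameExponent Ψ K C r) (t : ℝ) (x : V) :
    |(Complex.exp (t * Complex.I) / (1 + Ψ x)).re| ≤ 1 := by
  refine (Complex.abs_re_le_norm _).trans ?_
  rw [norm_div, Complex.norm_exp_ofReal_mul_I]
  have h2 : 1 + (Ψ x).re ≤ ‖1 + Ψ x‖ := by
    have := Complex.re_le_norm (1 + Ψ x)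
    simpa using this
  have := h.one_le_one_add_re x
  exact (div_le_one (by linarith)).2 (by linarith)

theorem measurableSet_one_add_re_le [MeasurableSpace V] [BorelSpace V]
    (h : IsTameExponent Ψ K C r) (κ : ℝ) :
    MeasurableSet {x | 1 + (Ψ x).re ≤ κ} :=
  _root_.measurableSet_le h.continuous_one_add_re.measurable measurable_const

end IsTameExponent

/-! ### Gaussian averages -/

section GaussianAverages

variable {V : Type*} [NormedAddCommGroup V] [InnerProductSpace ℝ V] [FiniteDimensional ℝ V]
  [MeasurableSpace V] [BorelSpace V]

theorem integrable_of_continuous_of_bound {X : Type*} [TopologicalSpace X] [MeasurableSpace X]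
    [OpensMeasurableSpace X] {F : Type*} [NormedAddCommGroup F]
    [SecondCountableTopologyEither X F] {μ : Measure X} [IsFiniteMeasure μ] {f : X → F}
    (hf : Continuous f) (M : ℝ) (hM : ∀ x, ‖f x‖ ≤ M) : Integrable f μ :=
  Integrable.of_bound hf.aestronglyMeasurable M (Eventually.of_forall hM)

/-- The Poincaré inequality in the only form needed below: a slope `M / √a` turns into the integral
of `1 / a`. -/
theorem integral_sub_sq_le_of_slope {Φ : V → ℝ} {K : ℝ≥0} (hΦ : LipschitzWith K Φ) {a : V → ℝ}
    (ha : Continuous a) (ha1 : ∀ x, 1 ≤ a x) {M c : ℝ} (hM : 0 ≤ M)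
    (hS : ∀ x y, |Φ (x + y) - Φ x| ≤ M / √(a x) * ‖y‖ + c * ‖y‖ ^ 2) :
    Integrable (fun p : V × V => (Φ p.2 - Φ p.1) ^ 2) ((stdGaussian V).prod (stdGaussian V)) ∧
    ∫ p : V × V, (Φ p.2 - Φ p.1) ^ 2 ∂((stdGaussian V).prod (stdGaussian V)) ≤
      (Real.pi / 2 * M) ^ 2 * ∫ x, 1 / a x ∂(stdGaussian V) := by
  have h1 := lintegral_sub_sq_le_slope hΦ (S := fun x => M / √(a x)) (fun x => by positivity) hS
  have hmeas : AEStronglyMeasurable (fun p : V × V => (Φ p.2 - Φ p.1) ^ 2)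
      ((stdGaussian V).prod (stdGaussian V)) := by
    have := hΦ.continuous
    exact Continuous.aestronglyMeasurable (by fun_prop)
  have hia : Integrable (fun x => 1 / a x) (stdGaussian V) := by
    refine integrable_of_continuous_of_bound
      (continuous_const.div ha fun x => by linarith [ha1 x]) 1 fun x => ?_
    have := ha1 x
    rw [Real.norm_eq_abs, abs_of_nonneg (by positivity)]
    exact (div_le_one (by linarith)).2 this
  have h2 : ∫⁻ x, ENNReal.ofReal ((Real.pi / 2 * (M / √(a x))) ^ 2) ∂(stdGaussian V)
      = ENNReal.ofReal ((Real.pi / 2 * M) ^ 2 * ∫ x, 1 / a x ∂(stdGaussian V)) := by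
    rw [← integral_const_mul, ofReal_integral_eq_lintegral_ofReal (hia.const_mul _)
      (Eventually.of_forall fun x => by have := ha1 x; positivity)]
    refine lintegral_congr fun x => ?_
    have := ha1 x
    congr 1
    rw [← mul_div_assoc, div_pow, Real.sq_sqrt (by linarith)]
    ring
  rw [h2] at h1
  have hint : Integrable (fun p : V × V => (Φ p.2 - Φ p.1) ^ 2)
      ((stdGaussian V).prod (stdGaussian V)) :=
    ⟨hmeas, (hasFiniteIntegral_iff_ofReal (Eventually.of_forall fun p => sq_nonneg _)).2
      (h1.trans_lt ENNReal.ofReal_lt_top)⟩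
  refine ⟨hint, ?_⟩
  rw [← ofReal_integral_eq_lintegral_ofReal hint
    (Eventually.of_forall fun p => sq_nonneg _)] at h1
  refine (ENNReal.ofReal_le_ofReal_iff ?_).1 h1
  have : 0 ≤ ∫ x, 1 / a x ∂(stdGaussian V) := integral_nonneg fun x => by
    have := ha1 x
    dsimp
    positivity
  positivity

theorem integral_comp_neg_stdGaussian (f : V → ℝ) :
    ∫ x, f (-x) ∂(stdGaussian V) = ∫ x, f x ∂(stdGaussian V) := by
  conv_rhs => rw [← stdGaussian_map (LinearIsometryEquiv.neg ℝ (E := V))]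
  exact ((LinearIsometryEquiv.neg ℝ (E := V)).toHomeomorph.measurableEmbedding.integral_map
    (μ := stdGaussian V) f).symm

theorem integral_abs_strongDual_le (θ : StrongDual ℝ V) {ρ : ℝ} (hρ : 0 < ρ) (h : ‖θ‖ ≤ ρ) :
    ∫ x, |θ x| ∂(stdGaussian V) ≤ ρ := by
  have hi : Integrable (fun x => |θ x|) (stdGaussian V) :=
    ((memLp_strongDual_stdGaussian θ).integrable (by norm_num)).norm
  have hi2 : Integrable (fun x => (θ x) ^ 2) (stdGaussian V) :=
    (memLp_strongDual_stdGaussian θ).integrable_sq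
  calc ∫ x, |θ x| ∂(stdGaussian V)
      -- The arithmetic–geometric mean inequality, with the weight that is optimal when `‖θ‖ = ρ`.
      ≤ ∫ x, (ρ / 2 + 1 / (2 * ρ) * (θ x) ^ 2) ∂(stdGaussian V) := by
        refine integral_mono hi ((integrable_const _).add (hi2.const_mul _)) fun x => ?_
        dsimp only
        have : ρ / 2 + 1 / (2 * ρ) * (θ x) ^ 2 - |θ x| = (|θ x| - ρ) ^ 2 / (2 * ρ) := by
          rw [← sq_abs (θ x)]
          field_simp
          ring
        have h2 : 0 ≤ (|θ x| - ρ) ^ 2 / (2 * ρ) := by positivity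
        linarith
    _ = ρ / 2 + 1 / (2 * ρ) * ‖θ‖ ^ 2 := by
        rw [integral_add (integrable_const _) (hi2.const_mul _), integral_const_mul,
          integral_sq_strongDual_stdGaussian]
        simp
    _ ≤ ρ / 2 + 1 / (2 * ρ) * ρ ^ 2 := by gcongr
    _ = ρ := by field_simp; norm_num

end GaussianAverages

/-! ### The main estimate for Gaussian averages of a tame exponent -/

namespace IsTameExponent

variable {V : Type*} [NormedAddCommGroup V] [InnerProductSpace ℝ V] [FiniteDimensional ℝ V]
  [MeasurableSpace V] [BorelSpace V] {Ψ : V → ℂ} {K C r : ℝ}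

theorem integral_log_sub_sq_le (h : IsTameExponent Ψ K C r) (hK : 0 ≤ K) :
    Integrable (fun p : V × V =>
      (Real.log (1 + (Ψ p.2).re) - Real.log (1 + (Ψ p.1).re)) ^ 2)
      ((stdGaussian V).prod (stdGaussian V)) ∧
    ∫ p : V × V, (Real.log (1 + (Ψ p.2).re) - Real.log (1 + (Ψ p.1).re)) ^ 2
      ∂((stdGaussian V).prod (stdGaussian V)) ≤
      (Real.pi * K) ^ 2 * ∫ x, 1 / (1 + (Ψ x).re) ∂(stdGaussian V) := by
  have := integral_sub_sq_le_of_slope (h.lipschitzWith_log hK) h.continuous_one_add_re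
    h.one_le_one_add_re (by positivity : 0 ≤ 2 * K) h.abs_log_increment_le
  convert! this using 3
  ring

theorem integrable_slopeRatio_sq (h : IsTameExponent Ψ K C r) (hK : 0 ≤ K) (hC : 0 ≤ C)
    (hr : 0 < r) :
    Integrable (fun x => slopeRatio (1 + (Ψ x).re) (Ψ x).im ^ 2) (stdGaussian V) := by
  obtain ⟨M, hM⟩ := h.exists_lipschitzWith_slopeRatio hK hC hr
  refine integrable_of_continuous_of_bound (hM.continuous.pow 2) 1 fun x => ?_
  rw [norm_pow, Real.norm_eq_abs]
  exact pow_le_one₀ (abs_nonneg _)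
    (abs_slopeRatio_le_one (by linarith [h.one_le_one_add_re x]))

/-- As `Ψ(-x)` is the conjugate of `Ψ(x)`, the ratio is odd and has mean zero under the symmetric
Gaussian measure. Its second moment is therefore its variance, which Poincaré controls. -/
theorem integral_slopeRatio_sq_le (h : IsTameExponent Ψ K C r) (hK : 0 ≤ K) (hC : 0 ≤ C)
    (hr : 0 < r) :
    ∫ x, slopeRatio (1 + (Ψ x).re) (Ψ x).im ^ 2 ∂(stdGaussian V) ≤
      (Real.pi / 2 * (3 * (C + 4 * K))) ^ 2 * ∫ x, 1 / (1 + (Ψ x).re) ∂(stdGaussian V) := by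
  obtain ⟨M, hM⟩ := h.exists_lipschitzWith_slopeRatio hK hC hr
  have key := (integral_sub_sq_le_of_slope hM h.continuous_one_add_re
    h.one_le_one_add_re (by positivity : 0 ≤ 3 * (C + 4 * K))
    (h.abs_slopeRatio_increment_le hK hC hr)).2
  set q : V → ℝ := fun x => slopeRatio (1 + (Ψ x).re) (Ψ x).im with hq
  have hqi : Integrable q (stdGaussian V) :=
    integrable_of_continuous_of_bound hM.continuous 1 fun x =>
      abs_slopeRatio_le_one (by linarith [h.one_le_one_add_re x])
  have hq2 : Integrable (fun x => q x ^ 2) (stdGaussian V) := h.integrable_slopeRatio_sq hK hC hr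
  have hq0 : ∫ x, q x ∂(stdGaussian V) = 0 := by
    have h1 := integral_comp_neg_stdGaussian q
    have h2 : ∀ x, q (-x) = - q x := by
      intro x
      simp only [hq, h.map_neg, slopeRatio, Complex.conj_re, Complex.conj_im, abs_neg, neg_div]
    simp_rw [h2, integral_neg] at h1
    linarith
  have e : ∫ p : V × V, (q p.2 - q p.1) ^ 2 ∂((stdGaussian V).prod (stdGaussian V))
      = 2 * ∫ x, q x ^ 2 ∂(stdGaussian V) := by
    have e1 : ∀ p : V × V, (q p.2 - q p.1) ^ 2 = (q p.2 ^ 2 + q p.1 ^ 2) - 2 * (q p.1 * q p.2) :=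
      fun p => by ring
    simp_rw [e1]
    rw [integral_sub ?_ ((hqi.mul_prod hqi).const_mul 2), integral_add (hq2.comp_snd _)
      (hq2.comp_fst _), integral_const_mul, integral_prod_mul,
      integral_fun_snd (fun x => q x ^ 2), integral_fun_fst (fun x => q x ^ 2), hq0]
    · simp
      ring
    · exact (hq2.comp_snd _).add (hq2.comp_fst _)
  have hnn : 0 ≤ ∫ x, q x ^ 2 ∂(stdGaussian V) := integral_nonneg fun x => sq_nonneg _
  linarith

/-- If `1 + Re Ψ ≥ L` with probability at least `1 / 2`, small values of `Re Ψ` are unlikely. -/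
theorem measureReal_le_mul (h : IsTameExponent Ψ K C r) (hK : 0 ≤ K) {κ L : ℝ} (hκ : 1 ≤ κ)
    (hκL : κ ≤ L) (hL : 1 / 2 ≤ (stdGaussian V).real {x | L ≤ 1 + (Ψ x).re}) :
    (stdGaussian V).real {x | 1 + (Ψ x).re ≤ κ} * (Real.log L - Real.log κ) ^ 2 ≤
      2 * ((Real.pi * K) ^ 2 * ∫ x, 1 / (1 + (Ψ x).re) ∂(stdGaussian V)) := by
  obtain ⟨hi, hle⟩ := h.integral_log_sub_sq_le hK
  have hc := h.continuous_one_add_re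
  set A := {x | 1 + (Ψ x).re ≤ κ}
  set B := {x | L ≤ 1 + (Ψ x).re}
  have hA : MeasurableSet A := measurableSet_le hc.measurable measurable_const
  have hB : MeasurableSet B := measurableSet_le measurable_const hc.measurable
  -- The Poincaré integral is restricted to pairs with the first point in `A` and the second in `B`,
  -- where the logarithms differ at least by `log L - log κ`.
  have h1 : ∫ p : V × V, (A ×ˢ B).indicator (fun _ => (Real.log L - Real.log κ) ^ 2) p
      ∂((stdGaussian V).prod (stdGaussian V)) ≤ ∫ p : V × V, (Real.log (1 + (Ψ p.2).re)
        - Real.log (1 + (Ψ p.1).re)) ^ 2 ∂((stdGaussian V).prod (stdGaussian V)) := by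
    refine integral_mono ((integrable_const _).indicator (hA.prod hB)) hi fun p => ?_
    by_cases hp : p ∈ A ×ˢ B
    · rw [Set.indicator_of_mem hp]
      have l1 : Real.log L ≤ Real.log (1 + (Ψ p.2).re) := Real.log_le_log (by linarith) hp.2
      have l2 : Real.log (1 + (Ψ p.1).re) ≤ Real.log κ :=
        Real.log_le_log (by linarith [h.one_le_one_add_re p.1]) hp.1
      have l3 : Real.log κ ≤ Real.log L := Real.log_le_log (by linarith) hκL
      dsimp only
      nlinarith
    · rw [Set.indicator_of_notMem hp]
      positivity
  rw [integral_indicator (hA.prod hB), setIntegral_const, measureReal_prod_prod, smul_eq_mul] at h1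
  have h2 : (stdGaussian V).real A * (1 / 2) ≤
      (stdGaussian V).real A * (stdGaussian V).real B := by gcongr
  nlinarith [sq_nonneg (Real.log L - Real.log κ)]

theorem integrable_one_div (h : IsTameExponent Ψ K C r) :
    Integrable (fun x => 1 / (1 + (Ψ x).re)) (stdGaussian V) := by
  refine integrable_of_continuous_of_bound (continuous_const.div h.continuous_one_add_re
    fun x => by linarith [h.one_le_one_add_re x]) 1 fun x => ?_
  have := h.one_le_one_add_re x
  rw [Real.norm_eq_abs, abs_of_nonneg (by positivity)]
  exact (div_le_one (by linarith)).2 this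

theorem integral_one_div_sq_le (h : IsTameExponent Ψ K C r) {κ : ℝ} (hκ : 1 ≤ κ) :
    ∫ x, 1 / (1 + (Ψ x).re) ^ 2 ∂(stdGaussian V) ≤
      (stdGaussian V).real {x | 1 + (Ψ x).re ≤ κ} +
        1 / κ * ∫ x, 1 / (1 + (Ψ x).re) ∂(stdGaussian V) := by
  have hA := h.measurableSet_one_add_re_le κ
  have hi1 : Integrable ({x | 1 + (Ψ x).re ≤ κ}.indicator fun _ => (1 : ℝ)) (stdGaussian V) :=
    (integrable_const _).indicator hA
  calc _ ≤ ∫ x, ({x | 1 + (Ψ x).re ≤ κ}.indicator (fun _ => (1 : ℝ)) x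
        + 1 / κ * (1 / (1 + (Ψ x).re))) ∂(stdGaussian V) := by
        refine integral_mono_of_nonneg (Eventually.of_forall fun x => by positivity)
          (hi1.add (h.integrable_one_div.const_mul _)) (Eventually.of_forall fun x => ?_)
        have h1 := h.one_le_one_add_re x
        dsimp only
        set a := 1 + (Ψ x).re
        by_cases hx : a ≤ κ
        · rw [Set.indicator_of_mem (by exact hx)]
          have : 1 / a ^ 2 ≤ 1 := (div_le_one (by positivity)).2 (by nlinarith)
          have : 0 ≤ 1 / κ * (1 / a) := by positivity
          linarith
        · rw [Set.indicator_of_notMem (by exact hx), zero_add, sq, ← one_div_mul_one_div]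
          push Not at hx
          gcongr
    _ = _ := by
        rw [integral_add hi1 (h.integrable_one_div.const_mul _), integral_const_mul,
          integral_indicator hA, setIntegral_const, smul_eq_mul, mul_one]

/-- The pointwise bounds are integrated over two independent Gaussian points, the second serving
only to decouple `θ` from the density. The probability of small values has coefficient `4`: `2` from
the slope ratio and `2` from the decoupling. -/
theorem integral_re_exp_div_lower_bound (h : IsTameExponent Ψ K C r) (hK : 0 ≤ K) (hC : 0 ≤ C)
    (hr : 0 < r) {κ : ℝ} (hκ : 1 ≤ κ) (θ : StrongDual ℝ V) {ρ : ℝ} (hρ : 0 < ρ) (hθ : ‖θ‖ ≤ ρ) :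
    (1 - 4 * ρ - 2 / κ * ((Real.pi / 2 * (3 * (C + 4 * K))) ^ 2 + (Real.pi * K) ^ 2))
        * ∫ x, 1 / (1 + (Ψ x).re) ∂(stdGaussian V)
      - 4 * (stdGaussian V).real {x | 1 + (Ψ x).re ≤ κ} ≤
    ∫ x, (Complex.exp (θ x * Complex.I) / (1 + Ψ x)).re ∂(stdGaussian V) := by
  obtain ⟨hWi, hW⟩ := h.integral_log_sub_sq_le hK
  have hQ := h.integral_slopeRatio_sq_le hK hC hr
  have hQi := h.integrable_slopeRatio_sq hK hC hr
  have hT := integral_abs_strongDual_le θ hρ hθ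
  have hTi : Integrable (fun x => |θ x|) (stdGaussian V) :=
    ((memLp_strongDual_stdGaussian θ).integrable (by norm_num)).norm
  have hA := h.measurableSet_one_add_re_le κ
  have hDi := h.integrable_one_div
  set A := {x | 1 + (Ψ x).re ≤ κ} with hAdef
  have hIi : Integrable (A.indicator fun _ => (1 : ℝ)) (stdGaussian V) :=
    (integrable_const _).indicator hA
  have hI : ∫ x, A.indicator (fun _ => (1 : ℝ)) x ∂(stdGaussian V) = (stdGaussian V).real A := by
    rw [integral_indicator hA, setIntegral_const, smul_eq_mul, mul_one]
  have hgi : Integrable (fun x => (Complex.exp (θ x * Complex.I) / (1 + Ψ x)).re)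
      (stdGaussian V) := integrable_of_continuous_of_bound (h.continuous_exp_div θ) 1
        fun x => h.abs_re_exp_div_le_one _ _
  set D := ∫ x, 1 / (1 + (Ψ x).re) ∂(stdGaussian V)
  have hD0 : 0 ≤ D := integral_nonneg fun x => by
    have := h.one_le_one_add_re x
    dsimp
    positivity
  have i1 : Integrable (fun p : V × V => 1 / (1 + (Ψ p.1).re))
    ((stdGaussian V).prod (stdGaussian V)) := hDi.comp_fst _
  have i2 : Integrable (fun p : V × V => 4 * A.indicator (fun _ => (1 : ℝ)) p.1)
    ((stdGaussian V).prod (stdGaussian V)) := (hIi.comp_fst _).const_mul 4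
  have i3 : Integrable (fun p : V × V => 2 / κ * slopeRatio (1 + (Ψ p.1).re) (Ψ p.1).im ^ 2)
    ((stdGaussian V).prod (stdGaussian V)) := (hQi.comp_fst _).const_mul (2 / κ)
  have i4 : Integrable (fun p : V × V => 4 * (|θ p.1| * (1 / (1 + (Ψ p.2).re))))
    ((stdGaussian V).prod (stdGaussian V)) := (hTi.mul_prod hDi).const_mul 4
  have i5 := hWi.const_mul (2 / κ)
  have hmono : ∫ p : V × V, ((((1 / (1 + (Ψ p.1).re) - 4 * A.indicator (fun _ => (1 : ℝ)) p.1)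
      - 2 / κ * slopeRatio (1 + (Ψ p.1).re) (Ψ p.1).im ^ 2)
      - 4 * (|θ p.1| * (1 / (1 + (Ψ p.2).re))))
      - 2 / κ * (Real.log (1 + (Ψ p.2).re) - Real.log (1 + (Ψ p.1).re)) ^ 2)
      ∂((stdGaussian V).prod (stdGaussian V)) ≤
      ∫ p : V × V, (Complex.exp (θ p.1 * Complex.I) / (1 + Ψ p.1)).re
      ∂((stdGaussian V).prod (stdGaussian V)) := by
    refine integral_mono ((((i1.sub i2).sub i3).sub i4).sub i5) (hgi.comp_fst _) fun p => ?_
    have b1 := h.re_exp_div_lower_bound (θ p.1) p.1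
    have b2 := h.min_div_le hκ (θ p.1) p.1 p.2
    have b3 := h.slopeRatio_sq_div_le hκ p.1
    rw [← hAdef] at b2 b3
    have e3 : 2 / κ * slopeRatio (1 + (Ψ p.1).re) (Ψ p.1).im ^ 2
      = 2 * (1 / κ * slopeRatio (1 + (Ψ p.1).re) (Ψ p.1).im ^ 2) := by ring
    have e4 : 2 * slopeRatio (1 + (Ψ p.1).re) (Ψ p.1).im ^ 2 / (1 + (Ψ p.1).re)
      = 2 * (slopeRatio (1 + (Ψ p.1).re) (Ψ p.1).im ^ 2 / (1 + (Ψ p.1).re)) := by ring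
    dsimp only
    linarith
  rw [integral_sub (by exact ((i1.sub i2).sub i3).sub i4) i5,
    integral_sub (by exact (i1.sub i2).sub i3) i4, integral_sub (by exact i1.sub i2) i3,
    integral_sub i1 i2, integral_const_mul, integral_const_mul, integral_const_mul,
    integral_const_mul, integral_prod_mul (fun x => |θ x|) (fun x => 1 / (1 + (Ψ x).re)),
    integral_fun_fst (fun x => 1 / (1 + (Ψ x).re)),
    integral_fun_fst (fun x => A.indicator (fun _ => (1 : ℝ)) x),
    integral_fun_fst (fun x => slopeRatio (1 + (Ψ x).re) (Ψ x).im ^ 2),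
    integral_fun_fst (fun x => (Complex.exp (θ x * Complex.I) / (1 + Ψ x)).re), hI] at hmono
  simp only [probReal_univ, one_smul] at hmono
  refine le_trans ?_ hmono
  have c1 : (∫ x, |θ x| ∂(stdGaussian V)) * D ≤ ρ * D := by gcongr
  have c2 : 2 / κ * ∫ x, slopeRatio (1 + (Ψ x).re) (Ψ x).im ^ 2 ∂(stdGaussian V) ≤
    2 / κ * ((Real.pi / 2 * (3 * (C + 4 * K))) ^ 2 * D) := by gcongr
  have c3 := mul_le_mul_of_nonneg_left hW (show 0 ≤ 2 / κ by positivity)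
  linarith

/-- The main estimate: once `1 + Re Ψ` is at least `L` with probability at least `1 / 2`, the
resolvent density is comparable with `∫ 1 / (1 + Re Ψ)` near the origin, whereas its smoothed
version is negligible. -/
theorem exists_threshold (hK : 0 ≤ K) (hC : 0 ≤ C) (hr : 0 < r) {η : ℝ} (hη : 0 < η) :
    ∃ L : ℝ, ∀ (V : Type*) [NormedAddCommGroup V] [InnerProductSpace ℝ V] [FiniteDimensional ℝ V]
      [MeasurableSpace V] [BorelSpace V] (Ψ : V → ℂ), IsTameExponent Ψ K C r →
      1 / 2 ≤ (stdGaussian V).real {x | L ≤ 1 + (Ψ x).re} →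
      ∫ x, 1 / (1 + (Ψ x).re) ^ 2 ∂(stdGaussian V)
        ≤ η * ∫ x, 1 / (1 + (Ψ x).re) ∂(stdGaussian V) ∧
      ∀ θ : StrongDual ℝ V, ‖θ‖ ≤ 1 / 16 →
        1 / 2 * ∫ x, 1 / (1 + (Ψ x).re) ∂(stdGaussian V) ≤
          ∫ x, (Complex.exp (θ x * Complex.I) / (1 + Ψ x)).re ∂(stdGaussian V) := by
  set A := (Real.pi * K) ^ 2 with hA
  set B := (Real.pi / 2 * (3 * (C + 4 * K))) ^ 2 with hB
  have hA0 : 0 ≤ A := sq_nonneg _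
  have hB0 : 0 ≤ B := sq_nonneg _
  -- Chosen so that `1 / κ ≤ η / 2` and `2 / κ * (B + A) ≤ 1 / 8`.
  set κ : ℝ := 1 + 2 / η + 16 * (A + B) with hκdef
  have hη2 : 0 ≤ 2 / η := by positivity
  have hκ : 1 ≤ κ := by linarith
  have hκη : 1 / κ ≤ η / 2 := by
    rw [div_le_div_iff₀ (by linarith) two_pos]
    have : η * (2 / η) = 2 := by field_simp
    nlinarith [mul_nonneg hη.le (by linarith : 0 ≤ 16 * (A + B))]
  have hκAB : 2 / κ * (B + A) ≤ 1 / 8 := by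
    rw [div_mul_eq_mul_div, div_le_iff₀ (by linarith)]
    linarith
  -- With `L = κ e^T`, the probability `m` of `1 + Re Ψ ≤ κ` satisfies `m T² ≤ 2 A D`, and this `T`
  -- yields both `m ≤ η D / 2` and `4 m ≤ D / 8`. The final constant is then `1 - 1/4 - 1/8 - 1/8 =
  -- 1/2`.
  set T : ℝ := 1 + 2 * A * (2 / η + 32) with hTdef
  have hT1 : 1 ≤ T := by
    have : 0 ≤ 2 * A * (2 / η + 32) := by positivity
    linarith
  refine ⟨κ * Real.exp T, fun V _ _ _ _ _ Ψ h hL => ?_⟩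
  set D := ∫ x, 1 / (1 + (Ψ x).re) ∂(stdGaussian V)
  have hD0 : 0 ≤ D := integral_nonneg fun x => by
    have := h.one_le_one_add_re x
    dsimp
    positivity
  have hm := h.measureReal_le_mul hK hκ
    (le_mul_of_one_le_right (by linarith) (Real.one_le_exp (by linarith))) hL
  rw [Real.log_mul (by linarith) (Real.exp_pos _).ne', Real.log_exp, add_sub_cancel_left] at hm
  set m := (stdGaussian V).real {x | 1 + (Ψ x).re ≤ κ}
  have hm0 : 0 ≤ m := measureReal_nonneg
  have hmT : m * T ≤ 2 * (A * D) := by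
    refine le_trans ?_ hm
    gcongr
    nlinarith
  have hmm : ∀ b : ℝ, 0 < b → b ≤ 2 / η + 32 → m * b ≤ D := by
    intro b hb hb'
    -- If `A = 0` there is nothing to divide by, but then `m = 0`.
    rcases hA0.eq_or_lt with h0 | h0
    · rw [← h0] at hmT
      have : m = 0 := by nlinarith
      rw [this, zero_mul]
      exact hD0
    · have h1 : m * (2 * A * b) ≤ 2 * (A * D) := by
        refine le_trans ?_ hmT
        gcongr
        have : 2 * A * b ≤ 2 * A * (2 / η + 32) := by gcongr
        linarith
      have : (2 * A) * (m * b) ≤ (2 * A) * D := by linarith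
      exact le_of_mul_le_mul_left this (by positivity)
  constructor
  · have h1 := h.integral_one_div_sq_le hκ
    have h2 := hmm (2 / η) (by positivity) (by linarith)
    have h3 : m ≤ η / 2 * D := by
      have : m * (2 / η) * (η / 2) ≤ D * (η / 2) := by gcongr
      have e : m * (2 / η) * (η / 2) = m := by field_simp
      linarith
    have h4 : 1 / κ * D ≤ η / 2 * D := by gcongr
    linarith
  · intro θ hθ
    have h1 := h.integral_re_exp_div_lower_bound hK hC hr hκ θ (by norm_num) hθ
    have h2 := hmm 32 (by norm_num) (by linarith)
    change (1 - 4 * (1 / 16) - 2 / κ * (B + A)) * D - 4 * m ≤ _ at h1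
    refine le_trans ?_ h1
    have h3 : 2 / κ * (B + A) * D ≤ 1 / 8 * D := by gcongr
    linarith

end IsTameExponent

namespace WienerLevy

set_option linter.unusedSectionVars false

/-! ### Countable sums of excessive functions and a criterion for polarity -/

section CountableSums

variable {E : Type*} [AddCommGroup E] [MeasurableSpace E] [MeasurableAdd E] {ν : ℝ → Measure E}

theorem transition_mono {t : ℝ} {f g : E → ℝ≥0∞} (h : f ≤ g) (x : E) :
    transition ν t f x ≤ transition ν t g x := lintegral_mono fun _ => h _

theorem resolventKernel_mono {α : ℝ} {f g : E → ℝ≥0∞} (h : f ≤ g) (x : E) :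
    resolventKernel ν α f x ≤ resolventKernel ν α g x :=
  lintegral_mono fun _ => mul_le_mul_right (transition_mono h x) _

theorem resolventKernel_tsum {u : ℕ → E → ℝ≥0∞} (hu : ∀ n, Measurable (u n)) {x : E}
    (ht : ∀ n, AEMeasurable (fun t => transition ν t (u n) x) (volume.restrict (Set.Ioi 0)))
    (α : ℝ) :
    resolventKernel ν α (fun y => ∑' n, u n y) x = ∑' n, resolventKernel ν α (u n) x := by
  have h1 : ∀ t, transition ν t (fun y => ∑' n, u n y) x = ∑' n, transition ν t (u n) x := by
    intro t
    exact lintegral_tsum fun n => ((hu n).comp (measurable_const_add x)).aemeasurable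
  simp only [resolventKernel, h1, ← ENNReal.tsum_mul_left]
  exact lintegral_tsum fun n => AEMeasurable.mul (by fun_prop) (ht n)

theorem isExcessive_tsum {β : ℝ} {u : ℕ → E → ℝ≥0∞} (hu : ∀ n, IsExcessive ν β (u n))
    (ht : ∀ n x, AEMeasurable (fun t => transition ν t (u n) x) (volume.restrict (Set.Ioi 0))) :
    IsExcessive ν β fun y => ∑' n, u n y := by
  have key : ∀ (α : ℝ) x, ENNReal.ofReal α * resolventKernel ν (β + α) (fun y => ∑' n, u n y) x
      = ∑' n, ENNReal.ofReal α * resolventKernel ν (β + α) (u n) x := fun α x => by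
    rw [resolventKernel_tsum (fun n => (hu n).measurable) (fun n => ht n x), ENNReal.tsum_mul_left]
  have hle : ∀ α : ℝ, 0 < α → ∀ x,
      ENNReal.ofReal α * resolventKernel ν (β + α) (fun y => ∑' n, u n y) x ≤ ∑' n, u n x := by
    intro α hα x
    rw [key]
    exact ENNReal.tsum_le_tsum fun n => (hu n).supermedian α hα x
  refine ⟨Measurable.tsum fun n => (hu n).measurable, hle, fun x => ?_⟩
  -- A finite partial sum already exceeds a level below the limit, and there the limits can be
  -- added; from above, supermedianity of the sum suffices.
  refine tendsto_order.2 ⟨fun c hc => ?_, fun c hc => ?_⟩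
  · have h1 : Tendsto (fun s : Finset ℕ => ∑ n ∈ s, u n x) atTop (𝓝 (∑' n, u n x)) :=
      ENNReal.summable.hasSum
    obtain ⟨s, hs⟩ := (h1.eventually (lt_mem_nhds hc)).exists
    have h2 : Tendsto (fun α : ℝ => ∑ n ∈ s, ENNReal.ofReal α * resolventKernel ν (β + α) (u n) x)
        atTop (𝓝 (∑ n ∈ s, u n x)) := tendsto_finsetSum _ fun n _ => (hu n).tendsto x
    filter_upwards [h2.eventually (lt_mem_nhds hs)] with α hα
    rw [key]
    exact hα.trans_le (ENNReal.sum_le_tsum s)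
  · filter_upwards [eventually_gt_atTop 0] with α hα
    exact (hle α hα x).trans_lt hc

/-- A criterion for polarity: excessive functions that dominate `1` on `M` and whose smoothed
values at a given point are arbitrarily small. -/
theorem regularization_reduced_eq_zero {β : ℝ} {M : Set E} {x : E}
    (h : ∀ α : ℝ, 0 < α → ∀ ε : ℝ≥0, 0 < ε → ∃ u : E → ℝ≥0∞, IsExcessive ν β u ∧
      (∀ y ∈ M, 1 ≤ u y) ∧ ENNReal.ofReal α * resolventKernel ν (β + α) u x ≤ ε) :
    regularization ν β (reduced ν β M (fun _ => 1)) x = 0 := by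
  refine le_antisymm (iSup₂_le fun α hα => ?_) bot_le
  refine ENNReal.le_of_forall_pos_le_add fun ε hε _ => ?_
  obtain ⟨u, hu, hM, hle⟩ := h α hα ε hε
  rw [zero_add]
  refine le_trans ?_ hle
  gcongr
  exact resolventKernel_mono (fun y => iInf₂_le u ⟨hu, hM⟩) x

end CountableSums

/-! ### Functions given by Fourier integrals -/

section Fourier

variable {E : Type*} [NormedAddCommGroup E] [NormedSpace ℝ E]
  {V : Type*} [NormedAddCommGroup V] [NormedSpace ℝ V] [MeasurableSpace V]

/-- The Fourier integral `x ↦ ∫ exp(i ⟨Ξ v, x⟩) k(v) γ(dv)`. -/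
noncomputable def fourierIntegral (γ : Measure V) (Ξ : V →L[ℝ] StrongDual ℝ E) (k : V → ℂ)
    (x : E) : ℂ :=
  ∫ v, Complex.exp (Ξ v x * Complex.I) * k v ∂γ

variable {γ : Measure V} [IsFiniteMeasure γ] {Ξ : V →L[ℝ] StrongDual ℝ E} {k : V → ℂ} {M : ℝ}

theorem norm_exp_mul_le (hM : ∀ v, ‖k v‖ ≤ M) (x : E) (v : V) :
    ‖Complex.exp (Ξ v x * Complex.I) * k v‖ ≤ M := by
  rw [norm_mul, Complex.norm_exp_ofReal_mul_I, one_mul]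
  exact hM v

variable [BorelSpace V] [SecondCountableTopology V]

theorem integrable_exp_mul (hk : Continuous k) (hM : ∀ v, ‖k v‖ ≤ M) (x : E) :
    Integrable (fun v => Complex.exp (Ξ v x * Complex.I) * k v) γ :=
  integrable_of_continuous_of_bound (by fun_prop) M (norm_exp_mul_le hM x)

theorem continuous_fourierIntegral (hk : Continuous k) (hM : ∀ v, ‖k v‖ ≤ M) :
    Continuous (fourierIntegral γ Ξ k) := by
  refine continuous_of_dominated (bound := fun _ => M)
    (fun x => (integrable_exp_mul (Ξ := Ξ) hk hM x).aestronglyMeasurable)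
    (fun x => Eventually.of_forall (norm_exp_mul_le hM x)) (integrable_const _)
    (Eventually.of_forall fun v => ?_)
  fun_prop

theorem norm_fourierIntegral_le (x : E) : ‖fourierIntegral γ Ξ k x‖ ≤ ∫ v, ‖k v‖ ∂γ := by
  refine (norm_integral_le_integral_norm _).trans_eq ?_
  refine integral_congr_ae (Eventually.of_forall fun v => ?_)
  simp only [norm_mul, Complex.norm_exp_ofReal_mul_I, one_mul]

theorem fourierIntegral_sub {k' : V → ℂ} {M' : ℝ} (hk : Continuous k) (hM : ∀ v, ‖k v‖ ≤ M)
    (hk' : Continuous k') (hM' : ∀ v, ‖k' v‖ ≤ M') (x : E) :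
    fourierIntegral γ Ξ (fun v => k v - k' v) x
      = fourierIntegral γ Ξ k x - fourierIntegral γ Ξ k' x := by
  rw [fourierIntegral, fourierIntegral, fourierIntegral,
    ← integral_sub (integrable_exp_mul hk hM x) (integrable_exp_mul hk' hM' x)]
  simp_rw [mul_sub]

theorem fourierIntegral_const_mul (c : ℂ) (x : E) :
    fourierIntegral γ Ξ (fun v => c * k v) x = c * fourierIntegral γ Ξ k x := by
  rw [fourierIntegral, fourierIntegral, ← integral_const_mul]
  congr 1
  ext v
  ring

variable [MeasurableSpace E] [BorelSpace E] [SecondCountableTopology E] {ν : ℝ → Measure E}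
  {Ψ : V → ℂ}

/-- `Ψ` is the characteristic exponent of `ν` along `Ξ`. -/
structure IsExponentAlong (ν : ℝ → Measure E) (Ξ : V →L[ℝ] StrongDual ℝ E) (Ψ : V → ℂ) :
    Prop where
  isProbabilityMeasure : ∀ t : ℝ, 0 < t → IsProbabilityMeasure (ν t)
  continuous : Continuous Ψ
  re_nonneg : ∀ v, 0 ≤ (Ψ v).re
  charFunDual_eq : ∀ t : ℝ, 0 < t → ∀ v, charFunDual (ν t) (Ξ v) = Complex.exp (-(t : ℂ) * Ψ v)

theorem norm_exp_neg_mul_le {z : ℂ} (hz : 0 ≤ z.re) {t : ℝ} (ht : 0 ≤ t) :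
    ‖Complex.exp (-(t : ℂ) * z)‖ ≤ 1 := by
  rw [Complex.norm_exp]
  have : (-(t : ℂ) * z).re = -(t * z.re) := by simp
  rw [this, Real.exp_le_one_iff]
  nlinarith [mul_nonneg ht hz]

theorem norm_exp_neg_mul_mul_le {z : ℂ} (hz : 0 ≤ z.re) {t : ℝ} (ht : 0 ≤ t) {w : ℂ}
    (hw : ‖w‖ ≤ M) : ‖Complex.exp (-(t : ℂ) * z) * w‖ ≤ M := by
  rw [norm_mul]
  calc _ ≤ 1 * ‖w‖ := by gcongr; exact norm_exp_neg_mul_le hz ht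
    _ ≤ M := by rwa [one_mul]

/-- By Fubini, the transition operator acts on the symbol `k` as multiplication by `exp(-t Ψ)`. -/
theorem integral_fourierIntegral_add (h : IsExponentAlong ν Ξ Ψ) (hk : Continuous k)
    (hM : ∀ v, ‖k v‖ ≤ M) {t : ℝ} (ht : 0 < t) (x : E) :
    ∫ y, fourierIntegral γ Ξ k (x + y) ∂(ν t)
      = fourierIntegral γ Ξ (fun v => Complex.exp (-(t : ℂ) * Ψ v) * k v) x := by
  have := h.isProbabilityMeasure t ht
  simp only [fourierIntegral]
  have hint : Integrable (Function.uncurry fun y v =>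
      Complex.exp (Ξ v (x + y) * Complex.I) * k v) ((ν t).prod γ) := by
    refine integrable_of_continuous_of_bound ?_ M fun p => norm_exp_mul_le hM _ _
    simp only [Function.uncurry_def]
    fun_prop
  rw [integral_integral_swap hint]
  refine integral_congr_ae (Eventually.of_forall fun v => ?_)
  dsimp only
  rw [← h.charFunDual_eq t ht, charFunDual_apply, integral_mul_const]
  have : ∀ y, Complex.exp (Ξ v (x + y) * Complex.I)
      = Complex.exp (Ξ v x * Complex.I) * Complex.exp (Ξ v y * Complex.I) := by
    intro y
    rw [← Complex.exp_add, map_add]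
    push_cast
    ring_nf
  simp_rw [this, integral_const_mul, mul_assoc]

theorem integrable_fourierIntegral_add (h : IsExponentAlong ν Ξ Ψ) (hk : Continuous k)
    (hM : ∀ v, ‖k v‖ ≤ M) {t : ℝ} (ht : 0 < t) (x : E) :
    Integrable (fun y => fourierIntegral γ Ξ k (x + y)) (ν t) := by
  have := h.isProbabilityMeasure t ht
  refine integrable_of_continuous_of_bound
    ((continuous_fourierIntegral hk hM).comp (by fun_prop)) (∫ v, ‖k v‖ ∂γ) fun y =>
      norm_fourierIntegral_le _

theorem integral_re_fourierIntegral_add (h : IsExponentAlong ν Ξ Ψ) (hk : Continuous k)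
    (hM : ∀ v, ‖k v‖ ≤ M) {t : ℝ} (ht : 0 < t) (x : E) :
    ∫ y, (fourierIntegral γ Ξ k (x + y)).re ∂(ν t)
      = (fourierIntegral γ Ξ (fun v => Complex.exp (-(t : ℂ) * Ψ v) * k v) x).re := by
  rw [← integral_fourierIntegral_add h hk hM ht x]
  exact integral_re (integrable_fourierIntegral_add h hk hM ht x)

theorem transition_fourierIntegral (h : IsExponentAlong ν Ξ Ψ) (hk : Continuous k)
    (hM : ∀ v, ‖k v‖ ≤ M) (hnn : ∀ x, 0 ≤ (fourierIntegral γ Ξ k x).re) {t : ℝ} (ht : 0 < t)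
    (x : E) :
    transition ν t (fun y => ENNReal.ofReal (fourierIntegral γ Ξ k y).re) x
      = ENNReal.ofReal
        (fourierIntegral γ Ξ (fun v => Complex.exp (-(t : ℂ) * Ψ v) * k v) x).re := by
  rw [transition, ← integral_re_fourierIntegral_add h hk hM ht x,
    ofReal_integral_eq_lintegral_ofReal (f := fun y => (fourierIntegral γ Ξ k (x + y)).re)
      (integrable_fourierIntegral_add h hk hM ht x).re (Eventually.of_forall fun y => hnn _)]

theorem fourierIntegral_exp_nonneg (h : IsExponentAlong ν Ξ Ψ) (hk : Continuous k)
    (hM : ∀ v, ‖k v‖ ≤ M) (hnn : ∀ x, 0 ≤ (fourierIntegral γ Ξ k x).re) {t : ℝ} (ht : 0 < t)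
    (x : E) :
    0 ≤ (fourierIntegral γ Ξ (fun v => Complex.exp (-(t : ℂ) * Ψ v) * k v) x).re := by
  rw [← integral_re_fourierIntegral_add h hk hM ht x]
  exact integral_nonneg fun y => hnn _

/-- No measurability of `t ↦ ν t` is assumed; it is recovered from the Fourier formula, which is
continuous in `t > 0`. -/
theorem aemeasurable_transition_fourierIntegral (h : IsExponentAlong ν Ξ Ψ) (hk : Continuous k)
    (hM : ∀ v, ‖k v‖ ≤ M) (hnn : ∀ x, 0 ≤ (fourierIntegral γ Ξ k x).re) (x : E) :
    AEMeasurable (fun t => transition ν t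
      (fun y => ENNReal.ofReal (fourierIntegral γ Ξ k y).re) x)
      (volume.restrict (Set.Ioi 0)) := by
  have hc : ContinuousOn (fun t : ℝ => ENNReal.ofReal
      (fourierIntegral γ Ξ (fun v => Complex.exp (-(t : ℂ) * Ψ v) * k v) x).re) (Set.Ioi 0) := by
    refine ENNReal.continuous_ofReal.comp_continuousOn
      (Complex.continuous_re.comp_continuousOn ?_)
    have hΨ := h.continuous
    refine continuousOn_of_dominated (bound := fun _ => M) (fun t ht => ?_) (fun t ht => ?_)
      (integrable_const _) (Eventually.of_forall fun v => ?_)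
    · exact Continuous.aestronglyMeasurable (by fun_prop)
    · exact Eventually.of_forall (norm_exp_mul_le (k := fun v => Complex.exp (-(t : ℂ) * Ψ v) * k v)
        (fun v => norm_exp_neg_mul_mul_le (h.re_nonneg v) (le_of_lt ht) (hM v)) x)
    · exact Continuous.continuousOn (by fun_prop)
  refine (hc.aemeasurable measurableSet_Ioi).congr ?_
  filter_upwards [ae_restrict_mem measurableSet_Ioi] with t ht
  exact (transition_fourierIntegral h hk hM hnn ht x).symm

theorem add_ne_zero_of_re_nonneg {α : ℝ} (hα : 0 < α) {z : ℂ} (hz : 0 ≤ z.re) :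
    (α : ℂ) + z ≠ 0 := by
  intro h0
  have := congrArg Complex.re h0
  simp only [Complex.add_re, Complex.ofReal_re, Complex.zero_re] at this
  linarith

theorem le_norm_add {α : ℝ} {z : ℂ} : α + z.re ≤ ‖(α : ℂ) + z‖ := by
  have := Complex.re_le_norm ((α : ℂ) + z)
  simpa using this

theorem norm_div_add_le {α : ℝ} (hα : 0 < α) {z w : ℂ} (hz : 0 ≤ z.re) (hw : ‖w‖ ≤ M) :
    ‖w / (α + z)‖ ≤ M / α := by
  rw [norm_div]
  have := le_norm_add (α := α) (z := z)
  have hM : 0 ≤ M := (norm_nonneg w).trans hw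
  gcongr
  linarith

theorem continuous_div_add (h : IsExponentAlong ν Ξ Ψ) (hk : Continuous k) {α : ℝ} (hα : 0 < α) :
    Continuous fun v => k v / (α + Ψ v) :=
  hk.div (continuous_const.add h.continuous) fun v => add_ne_zero_of_re_nonneg hα (h.re_nonneg v)

/-- The Laplace transform in `t`: the resolvent operator divides the symbol by `α + Ψ`, whose real
part is positive. -/
theorem integral_exp_mul_fourierIntegral (h : IsExponentAlong ν Ξ Ψ) (hk : Continuous k)
    (hM : ∀ v, ‖k v‖ ≤ M) {α : ℝ} (hα : 0 < α) (x : E) :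
    Integrable (fun t : ℝ => (Real.exp (-α * t) : ℂ) *
        fourierIntegral γ Ξ (fun v => Complex.exp (-(t : ℂ) * Ψ v) * k v) x)
        (volume.restrict (Set.Ioi 0)) ∧
    ∫ t in Set.Ioi (0 : ℝ), (Real.exp (-α * t) : ℂ) *
        fourierIntegral γ Ξ (fun v => Complex.exp (-(t : ℂ) * Ψ v) * k v) x
      = fourierIntegral γ Ξ (fun v => k v / (α + Ψ v)) x := by
  have hΨ := h.continuous
  let F : ℝ → V → ℂ := fun t v => (Real.exp (-α * t) : ℂ) *
    (Complex.exp (Ξ v x * Complex.I) * (Complex.exp (-(t : ℂ) * Ψ v) * k v))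
  have hFc : Continuous (Function.uncurry F) := by
    simp only [F, Function.uncurry_def]
    fun_prop
  have hexp : Integrable (fun t : ℝ => Real.exp (-α * t)) (volume.restrict (Set.Ioi 0)) :=
    exp_neg_integrableOn_Ioi 0 hα
  have hint : Integrable (Function.uncurry F) ((volume.restrict (Set.Ioi (0 : ℝ))).prod γ) := by
    refine Integrable.mono' (g := fun p : ℝ × V => Real.exp (-α * p.1) * M)
      (hexp.mul_prod (integrable_const M)) hFc.aestronglyMeasurable ?_
    have h0 : ∀ᵐ p ∂((volume.restrict (Set.Ioi (0 : ℝ))).prod γ), p.1 ∈ Set.Ioi (0 : ℝ) :=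
      Measure.quasiMeasurePreserving_fst.ae (ae_restrict_mem measurableSet_Ioi)
    filter_upwards [h0] with p hp
    simp only [F, Function.uncurry_def]
    rw [norm_mul, Complex.norm_real, Real.norm_eq_abs, abs_of_pos (Real.exp_pos _)]
    gcongr
    exact norm_exp_mul_le (k := fun v => Complex.exp (-(p.1 : ℂ) * Ψ v) * k v)
      (fun v => norm_exp_neg_mul_mul_le (h.re_nonneg v) (le_of_lt hp) (hM v)) x p.2
  have e1 : ∀ t : ℝ, (Real.exp (-α * t) : ℂ) *
        fourierIntegral γ Ξ (fun v => Complex.exp (-(t : ℂ) * Ψ v) * k v) x = ∫ v, F t v ∂γ := by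
    intro t
    rw [fourierIntegral, ← integral_const_mul]
  simp_rw [e1]
  refine ⟨hint.integral_prod_left, ?_⟩
  rw [integral_integral_swap hint]
  refine integral_congr_ae (Eventually.of_forall fun v => ?_)
  dsimp only
  have hre : (-((α : ℂ) + Ψ v)).re < 0 := by
    have := h.re_nonneg v
    simp only [Complex.neg_re, Complex.add_re, Complex.ofReal_re]
    linarith
  have e2 : ∀ t : ℝ, F t v = Complex.exp (Ξ v x * Complex.I) * k v *
      Complex.exp (-((α : ℂ) + Ψ v) * t) := by
    intro t
    have : Complex.exp (-((α : ℂ) + Ψ v) * t)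
        = (Real.exp (-α * t) : ℂ) * Complex.exp (-(t : ℂ) * Ψ v) := by
      rw [Complex.ofReal_exp, ← Complex.exp_add]
      push_cast
      ring_nf
    rw [this]
    simp only [F]
    ring
  simp_rw [e2]
  rw [integral_const_mul, integral_exp_mul_complex_Ioi hre]
  simp only [Complex.ofReal_zero, mul_zero, Complex.exp_zero, neg_div_neg_eq]
  ring

theorem fourierIntegral_div_nonneg (h : IsExponentAlong ν Ξ Ψ) (hk : Continuous k)
    (hM : ∀ v, ‖k v‖ ≤ M) (hnn : ∀ x, 0 ≤ (fourierIntegral γ Ξ k x).re) {α : ℝ} (hα : 0 < α)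
    (x : E) : 0 ≤ (fourierIntegral γ Ξ (fun v => k v / (α + Ψ v)) x).re := by
  obtain ⟨hi, he⟩ := integral_exp_mul_fourierIntegral (γ := γ) h hk hM hα x
  rw [← he, ← RCLike.re_eq_complex_re, ← integral_re hi]
  refine setIntegral_nonneg measurableSet_Ioi fun t ht => ?_
  rw [RCLike.re_eq_complex_re, Complex.re_ofReal_mul]
  exact mul_nonneg (Real.exp_pos _).le (fourierIntegral_exp_nonneg h hk hM hnn ht x)

theorem resolventKernel_fourierIntegral (h : IsExponentAlong ν Ξ Ψ) (hk : Continuous k)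
    (hM : ∀ v, ‖k v‖ ≤ M) (hnn : ∀ x, 0 ≤ (fourierIntegral γ Ξ k x).re) {α : ℝ} (hα : 0 < α)
    (x : E) :
    resolventKernel ν α (fun y => ENNReal.ofReal (fourierIntegral γ Ξ k y).re) x
      = ENNReal.ofReal (fourierIntegral γ Ξ (fun v => k v / (α + Ψ v)) x).re := by
  obtain ⟨hi, he⟩ := integral_exp_mul_fourierIntegral (γ := γ) h hk hM hα x
  rw [← he, ← RCLike.re_eq_complex_re, ← integral_re hi, ofReal_integral_eq_lintegral_ofReal hi.re]
  · refine setLIntegral_congr_fun measurableSet_Ioi fun t ht => ?_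
    rw [RCLike.re_eq_complex_re, Complex.re_ofReal_mul, ENNReal.ofReal_mul (Real.exp_pos _).le,
      transition_fourierIntegral h hk hM hnn ht x]
  · filter_upwards [ae_restrict_mem measurableSet_Ioi] with t ht
    rw [RCLike.re_eq_complex_re, Complex.re_ofReal_mul]
    exact mul_nonneg (Real.exp_pos _).le (fourierIntegral_exp_nonneg h hk hM hnn ht x)

/-- The resolvent equation, which for symbols is a partial fraction decomposition. The difference is
formed in `ℝ`, before truncation to `ℝ≥0∞`. -/
theorem mul_resolventKernel_fourierIntegral_div (h : IsExponentAlong ν Ξ Ψ) (hk : Continuous k)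
    (hM : ∀ v, ‖k v‖ ≤ M) (hnn : ∀ x, 0 ≤ (fourierIntegral γ Ξ k x).re) {α β : ℝ} (hα : 0 < α)
    (hβ : 0 < β) (x : E) :
    ENNReal.ofReal α * resolventKernel ν (β + α) (fun y => ENNReal.ofReal
        (fourierIntegral γ Ξ (fun v => k v / (β + Ψ v)) y).re) x
      = ENNReal.ofReal ((fourierIntegral γ Ξ (fun v => k v / (β + Ψ v)) x).re
        - (fourierIntegral γ Ξ (fun v => k v / ((β + α : ℝ) + Ψ v)) x).re) := by
  have hk1 := continuous_div_add h hk hβ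
  have hk2 := continuous_div_add h hk (add_pos hβ hα)
  have hM1 : ∀ v, ‖k v / (β + Ψ v)‖ ≤ M / β := fun v =>
    norm_div_add_le hβ (h.re_nonneg v) (hM v)
  have hM2 : ∀ v, ‖k v / ((β + α : ℝ) + Ψ v)‖ ≤ M / (β + α) := fun v =>
    norm_div_add_le (add_pos hβ hα) (h.re_nonneg v) (hM v)
  rw [resolventKernel_fourierIntegral h hk1 hM1
    (fun y => fourierIntegral_div_nonneg h hk hM hnn hβ y) (add_pos hβ hα),
    ← ENNReal.ofReal_mul hα.le, ← Complex.re_ofReal_mul, ← fourierIntegral_const_mul,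
    ← Complex.sub_re, ← fourierIntegral_sub hk1 hM1 hk2 hM2]
  congr 3
  ext v
  have n1 := add_ne_zero_of_re_nonneg hβ (h.re_nonneg v)
  have n2 := add_ne_zero_of_re_nonneg (add_pos hβ hα) (h.re_nonneg v)
  push_cast at n2 ⊢
  field_simp
  ring

/-- The function is a `β`-potential of a nonnegative bounded function. By the resolvent equation,
supermedianity is the positivity of the `(β + α)`-potential, and the convergence is its decay like
`1 / (β + α)`. -/
theorem isExcessive_fourierIntegral_div (h : IsExponentAlong ν Ξ Ψ) (hk : Continuous k)
    (hM : ∀ v, ‖k v‖ ≤ M) (hnn : ∀ x, 0 ≤ (fourierIntegral γ Ξ k x).re) {β : ℝ} (hβ : 0 < β) :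
    IsExcessive ν β fun y => ENNReal.ofReal
        (fourierIntegral γ Ξ (fun v => k v / (β + Ψ v)) y).re := by
  refine ⟨?_, fun α hα x => ?_, fun x => ?_⟩
  · exact (ENNReal.continuous_ofReal.comp (Complex.continuous_re.comp
      (continuous_fourierIntegral (continuous_div_add h hk hβ) fun v =>
        norm_div_add_le hβ (h.re_nonneg v) (hM v)))).measurable
  · rw [mul_resolventKernel_fourierIntegral_div h hk hM hnn hα hβ]
    refine ENNReal.ofReal_le_ofReal ?_
    linarith [fourierIntegral_div_nonneg h hk hM hnn (add_pos hβ hα) x]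
  · have h1 : Tendsto (fun α : ℝ =>
        (fourierIntegral γ Ξ (fun v => k v / ((β + α : ℝ) + Ψ v)) x).re) atTop (𝓝 0) := by
      refine squeeze_zero_norm' (a := fun α => γ.real Set.univ * M / (β + α)) ?_ ?_
      · filter_upwards [eventually_gt_atTop 0] with α hα
        refine (Complex.abs_re_le_norm _).trans ((norm_fourierIntegral_le x).trans ?_)
        calc _ ≤ ∫ v, M / (β + α) ∂γ := by
              refine integral_mono_of_nonneg (Eventually.of_forall fun v => norm_nonneg _)
                (integrable_const _) (Eventually.of_forall fun v => ?_)
              exact norm_div_add_le (add_pos hβ hα) (h.re_nonneg v) (hM v)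
          _ = _ := by
              rw [integral_const, smul_eq_mul, mul_div_assoc]
      · exact (tendsto_const_nhds.div_atTop (tendsto_atTop_add_const_left _ _ tendsto_id))
    have h2 := (tendsto_const_nhds
      (x := (fourierIntegral γ Ξ (fun v => k v / (β + Ψ v)) x).re)).sub h1
    rw [sub_zero] at h2
    refine ((ENNReal.continuous_ofReal.tendsto _).comp h2).congr' ?_
    filter_upwards [eventually_gt_atTop 0] with α hα
    exact (mul_resolventKernel_fourierIntegral_div h hk hM hnn hα hβ x).symm

end Fourier

/-! ### Elementary inequalities for negative definite functions -/

section NegativeDefinite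

variable {H : Type*} [NormedAddCommGroup H] [InnerProductSpace ℝ H] {ψ : H → ℂ}

namespace IsLevyExponent

theorem re_nonneg (h : IsLevyExponent ψ) (x : H) : 0 ≤ (ψ x).re := by
  have h1 := (h.negativeDefinite 1 ![x]).diag_nonneg (i := 0)
  have h2 := (Complex.le_def.1 h1).1
  simp only [Matrix.of_apply, Matrix.cons_val_zero, sub_self, h.map_zero, sub_zero,
    Complex.add_re, Complex.conj_re, Complex.zero_re] at h2
  linarith

theorem map_neg (h : IsLevyExponent ψ) (x : H) : ψ (-x) = conj (ψ x) := by
  have h1 := (h.negativeDefinite 2 ![x, 0]).isHermitian.apply 1 0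
  simp [h.map_zero] at h1
  exact (sub_eq_zero.1 h1.symm).symm

/-- The `2 × 2` matrix for the points `x` and `-y` has diagonal `2 Re ψ(x)`, `2 Re ψ(y)` and the
quantity in question off the diagonal; its determinant is nonnegative. -/
theorem norm_add_sub_le (h : IsLevyExponent ψ) (x y : H) :
    ‖ψ x + ψ y - ψ (x + y)‖ ≤ 2 * √(ψ x).re * √(ψ y).re := by
  have hP := h.negativeDefinite 2 ![x, -y]
  have h1 := (Complex.le_def.1 hP.det_nonneg).1
  have h2 := hP.isHermitian.apply 1 0
  rw [Matrix.det_fin_two, ← h2] at h1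
  simp only [Matrix.of_apply, Matrix.cons_val_zero, Matrix.cons_val_one, sub_self, h.map_zero,
    sub_zero, h.map_neg, Complex.conj_conj, sub_neg_eq_add, Complex.star_def] at h1
  rw [Complex.mul_conj, Complex.add_conj, add_comm (conj (ψ y)), Complex.add_conj,
    ← Complex.ofReal_mul, ← Complex.ofReal_sub, Complex.ofReal_re, Complex.zero_re,
    Complex.normSq_eq_norm_sq] at h1
  refine abs_le_of_sq_le_sq' ?_ (by positivity) |>.2
  rw [mul_pow, mul_pow, Real.sq_sqrt (h.re_nonneg x), Real.sq_sqrt (h.re_nonneg y)]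
  linarith

theorem sqrt_re_add_le (h : IsLevyExponent ψ) (x y : H) :
    √(ψ (x + y)).re ≤ √(ψ x).re + √(ψ y).re := by
  refine Real.sqrt_le_iff.2 ⟨by positivity, ?_⟩
  have h1 := (Complex.abs_re_le_norm _).trans (h.norm_add_sub_le x y)
  have h2 := (abs_le.1 h1).1
  simp only [Complex.sub_re, Complex.add_re] at h2
  nlinarith [Real.sq_sqrt (h.re_nonneg x), Real.sq_sqrt (h.re_nonneg y)]

theorem sqrt_re_nsmul_le (h : IsLevyExponent ψ) (n : ℕ) (x : H) :
    √(ψ (n • x)).re ≤ n * √(ψ x).re := by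
  induction n with
  | zero => simp [h.map_zero]
  | succ n ih =>
    rw [succ_nsmul]
    refine (h.sqrt_re_add_le _ _).trans ?_
    push_cast
    linarith

end IsLevyExponent

end NegativeDefinite

/-! ### The embedding of `E'` into `H` -/

section DualEmbedding

variable {H E : Type*} [NormedAddCommGroup H] [InnerProductSpace ℝ H] [CompleteSpace H]
  [NormedAddCommGroup E] [NormedSpace ℝ E] (i : H →L[ℝ] E)

theorem norm_dualToH (ξ : StrongDual ℝ E) : ‖dualToH i ξ‖ = ‖ξ.comp i‖ :=
  LinearIsometryEquiv.norm_map _ _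

theorem inner_dualToH (ξ : StrongDual ℝ E) (h : H) : inner ℝ (dualToH i ξ) h = ξ (i h) := by
  rw [dualToH, InnerProductSpace.toDual_symm_apply]
  rfl

theorem dualToH_add (ξ η : StrongDual ℝ E) : dualToH i (ξ + η) = dualToH i ξ + dualToH i η := by
  refine ext_inner_right ℝ fun h => ?_
  simp [inner_add_left, inner_dualToH]

theorem dualToH_smul (c : ℝ) (ξ : StrongDual ℝ E) : dualToH i (c • ξ) = c • dualToH i ξ := by
  refine ext_inner_right ℝ fun h => ?_
  simp [real_inner_smul_left, inner_dualToH]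

/-- `dualToH` as a continuous linear map. -/
noncomputable def dualToHCLM : StrongDual ℝ E →L[ℝ] H :=
  LinearMap.mkContinuous
    { toFun := dualToH i, map_add' := dualToH_add i, map_smul' := dualToH_smul i } ‖i‖ fun ξ => by
      change ‖dualToH i ξ‖ ≤ _
      rw [norm_dualToH, mul_comm]
      exact ξ.opNorm_comp_le i

theorem dualToHCLM_apply (ξ : StrongDual ℝ E) : dualToHCLM i ξ = dualToH i ξ := rfl

theorem dualToH_injective {i : H →L[ℝ] E} (hi : IsDenseInclusion i) :
    Function.Injective (dualToHCLM i) := by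
  refine (injective_iff_map_eq_zero _).2 fun ξ hξ => ?_
  have h1 : ∀ h, ξ (i h) = 0 := fun h => by
    rw [← inner_dualToH, ← dualToHCLM_apply, hξ, inner_zero_left]
  have h2 : (ξ : E → ℝ) = fun _ => 0 :=
    hi.denseRange.equalizer ξ.continuous continuous_const (funext h1)
  ext z
  exact congrFun h2 z

end DualEmbedding

/-! ### Growth of the exponent from second moments -/

section MomentBounds

variable {H E : Type*} [NormedAddCommGroup H] [InnerProductSpace ℝ H] [CompleteSpace H]
  [NormedAddCommGroup E] [NormedSpace ℝ E] [MeasurableSpace E] [BorelSpace E]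
  {i : H →L[ℝ] E} {ψ : H → ℂ} {ν : ℝ → Measure E}

theorem integral_sq_le_of_lintegral {μ : Measure E} {ξ : StrongDual ℝ E} {B : ℝ} (hB : 0 ≤ B)
    (h : ∫⁻ z, ENNReal.ofReal (ξ z ^ 2) ∂μ ≤ ENNReal.ofReal B) :
    Integrable (fun z => ξ z ^ 2) μ ∧ ∫ z, ξ z ^ 2 ∂μ ≤ B := by
  have hi : Integrable (fun z => ξ z ^ 2) μ :=
    ⟨(Measurable.aestronglyMeasurable (by fun_prop)),
      (hasFiniteIntegral_iff_ofReal (Eventually.of_forall fun z => sq_nonneg _)).2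
        (h.trans_lt ENNReal.ofReal_lt_top)⟩
  refine ⟨hi, ?_⟩
  rw [← ofReal_integral_eq_lintegral_ofReal hi (Eventually.of_forall fun z => sq_nonneg _)] at h
  exact (ENNReal.ofReal_le_ofReal_iff hB).1 h

theorem norm_one_sub_charFunDual_le {μ : Measure E} [IsProbabilityMeasure μ] {ξ : StrongDual ℝ E}
    (hi : Integrable (fun z => ξ z ^ 2) μ) {A s : ℝ} (hs : 0 < s)
    (h : ∫ z, ξ z ^ 2 ∂μ ≤ A * s ^ 2) : ‖charFunDual μ ξ - 1‖ ≤ (1 + A) / 2 * s := by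
  have hexp : Integrable (fun z => Complex.exp (ξ z * Complex.I)) μ :=
    Integrable.of_bound (Measurable.aestronglyMeasurable (by fun_prop)) 1
      (Eventually.of_forall fun z => by rw [Complex.norm_exp_ofReal_mul_I])
  have e : charFunDual μ ξ - 1 = ∫ z, (Complex.exp (ξ z * Complex.I) - 1) ∂μ := by
    rw [integral_sub hexp (integrable_const _), charFunDual_apply]
    simp
  rw [e]
  calc _ ≤ ∫ z, (s / 2 + 1 / (2 * s) * ξ z ^ 2) ∂μ := by
        refine norm_integral_le_of_norm_le ((integrable_const _).add (hi.const_mul _))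
          (Eventually.of_forall fun z => ?_)
        have h1 := Real.norm_exp_I_mul_ofReal_sub_one_le (x := ξ z)
        rw [mul_comm, Real.norm_eq_abs] at h1
        refine h1.trans ?_
        have : s / 2 + 1 / (2 * s) * ξ z ^ 2 - |ξ z| = (|ξ z| - s) ^ 2 / (2 * s) := by
          rw [← sq_abs (ξ z)]
          field_simp
          ring
        have h2 : 0 ≤ (|ξ z| - s) ^ 2 / (2 * s) := by positivity
        linarith
    _ = s / 2 + 1 / (2 * s) * ∫ z, ξ z ^ 2 ∂μ := by
        rw [integral_add (integrable_const _) (hi.const_mul _), integral_const_mul]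
        simp
    _ ≤ s / 2 + 1 / (2 * s) * (A * s ^ 2) := by gcongr
    _ = _ := by field_simp

theorem one_sub_le_norm_charFunDual {μ : Measure E} [IsProbabilityMeasure μ] {ξ : StrongDual ℝ E}
    (hi : Integrable (fun z => ξ z ^ 2) μ) : 1 - (∫ z, ξ z ^ 2 ∂μ) / 2 ≤ ‖charFunDual μ ξ‖ := by
  have hexp : Integrable (fun z => Complex.exp (ξ z * Complex.I)) μ :=
    Integrable.of_bound (Measurable.aestronglyMeasurable (by fun_prop)) 1
      (Eventually.of_forall fun z => by rw [Complex.norm_exp_ofReal_mul_I])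
  have h1 : ∫ z, Real.cos (ξ z) ∂μ = (charFunDual μ ξ).re := by
    rw [charFunDual_apply, ← RCLike.re_eq_complex_re, ← integral_re hexp]
    simp [Complex.exp_ofReal_mul_I_re]
  refine le_trans ?_ (Complex.re_le_norm _)
  rw [← h1]
  have hcos : Integrable (fun z => Real.cos (ξ z)) μ :=
    Integrable.of_bound (Measurable.aestronglyMeasurable (by fun_prop)) 1
      (Eventually.of_forall fun z => Real.abs_cos_le_one _)
  calc _ = ∫ z, (1 - ξ z ^ 2 / 2) ∂μ := by
        rw [integral_sub (integrable_const _) (hi.div_const _), integral_div]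
        simp
    _ ≤ _ := integral_mono ((integrable_const _).sub (hi.div_const _)) hcos fun z =>
        Real.one_sub_sq_div_two_le_cos

/-- Local bounds of the exponent that follow from the second moments. -/
theorem exists_local_bounds (hψ : IsLevyExponent ψ) (hν : IsLevySemigroup i ψ ν)
    (hm : HypothesisH i ν) :
    ∃ A r : ℝ, 0 ≤ A ∧ 0 < r ∧ ∀ ξ : StrongDual ℝ E, ‖dualToH i ξ‖ ≤ r →
      ‖ψ (dualToH i ξ)‖ ≤ (1 + A) * ‖dualToH i ξ‖ ∧
      (ψ (dualToH i ξ)).re ≤ A * ‖dualToH i ξ‖ ^ 2 := by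
  obtain ⟨C, hC, hmom⟩ := hm.moments
  have hcont := hψ.continuous.tendsto 0
  rw [hψ.map_zero] at hcont
  -- On this ball `‖ψ‖ ≤ 1/2`, so `ψ` can be recovered from `exp(-ψ)` by a first-order expansion.
  -- The constant `A = 2 C` below is `C (1 + t²)` at `t = 1`.
  obtain ⟨r, hr, hball⟩ := Metric.nhds_basis_closedBall.eventually_iff.1
    (hcont.norm.eventually (ge_mem_nhds (show ‖(0 : ℂ)‖ < 1 / 2 by norm_num)))
  refine ⟨2 * C, r, by positivity, hr, fun ξ hξ => ?_⟩
  have hp := hν.isProbabilityMeasure 1 one_pos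
  set η := dualToH i ξ with hη
  have hsmall : ‖ψ η‖ ≤ 1 / 2 := hball (by simpa using hξ)
  have hF := hν.fourier 1 one_pos ξ
  rw [← hη] at hF
  rcases eq_or_ne η 0 with h0 | h0
  · rw [h0, hψ.map_zero]
    simp
  have hs : 0 < ‖η‖ := norm_pos_iff.2 h0
  obtain ⟨hi, hle⟩ := integral_sq_le_of_lintegral (B := 2 * C * ‖η‖ ^ 2) (by positivity)
    ((hmom ξ 1 one_pos).trans_eq (by rw [hη, norm_dualToH]; congr 1; ring))
  have hre := hψ.re_nonneg η
  have hre2 : (ψ η).re ≤ 1 / 2 := (Complex.re_le_norm _).trans hsmall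
  have e1 : (-((1 : ℝ) : ℂ) * ψ η) = - ψ η := by simp
  constructor
  · have h1 := norm_one_sub_charFunDual_le hi hs hle
    rw [hF, e1] at h1
    -- The quadratic remainder is at most `‖ψ‖ / 2`, which leaves `‖ψ‖ / 2 ≤ ‖exp(-ψ) - 1‖`.
    have h2 := Complex.norm_exp_sub_one_sub_id_le (x := - ψ η) (by rw [norm_neg]; linarith)
    rw [norm_neg] at h2
    have h3 : ‖ψ η‖ ≤ ‖Complex.exp (-ψ η) - 1 - -ψ η‖ + ‖Complex.exp (-ψ η) - 1‖ := by
      have : ψ η = (Complex.exp (-ψ η) - 1 - -ψ η) - (Complex.exp (-ψ η) - 1) := by ring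
      conv_lhs => rw [this]
      exact norm_sub_le _ _
    nlinarith [norm_nonneg (ψ η)]
  · have h1 := one_sub_le_norm_charFunDual hi
    rw [hF, e1, Complex.norm_exp, Complex.neg_re] at h1
    have h2 := Real.abs_exp_sub_one_sub_id_le (x := -(ψ η).re)
      (by rw [abs_neg, abs_of_nonneg hre]; linarith)
    have h3 := (abs_le.1 h2).2
    nlinarith

/-- Scaling by `1 / n` moves `ξ` into the ball where the quadratic bound holds, and subadditivity of
`√(Re ψ)` carries the linear bound back without loss. -/
theorem sqrt_re_le_of_local_bounds (hψ : IsLevyExponent ψ) {A r : ℝ} (hA : 0 ≤ A) (hr : 0 < r)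
    (hloc : ∀ ξ : StrongDual ℝ E, ‖dualToH i ξ‖ ≤ r →
      (ψ (dualToH i ξ)).re ≤ A * ‖dualToH i ξ‖ ^ 2) (ξ : StrongDual ℝ E) :
    √(ψ (dualToH i ξ)).re ≤ √A * ‖dualToH i ξ‖ := by
  obtain ⟨n, hn⟩ := exists_nat_gt (‖dualToH i ξ‖ / r)
  have hn0 : (0 : ℝ) < n := lt_of_le_of_lt (by positivity) hn
  have hsc : ‖dualToH i ((n : ℝ)⁻¹ • ξ)‖ = (n : ℝ)⁻¹ * ‖dualToH i ξ‖ := by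
    rw [dualToH_smul, norm_smul, norm_inv, Real.norm_natCast]
  have h1 := hloc ((n : ℝ)⁻¹ • ξ) (by
    rw [hsc, inv_mul_le_iff₀ hn0]
    rw [div_lt_iff₀ hr] at hn
    exact hn.le)
  have h2 := hψ.sqrt_re_nsmul_le n (dualToH i ((n : ℝ)⁻¹ • ξ))
  have e : n • dualToH i ((n : ℝ)⁻¹ • ξ) = dualToH i ξ := by
    rw [dualToH_smul, ← Nat.cast_smul_eq_nsmul ℝ, smul_smul, mul_inv_cancel₀ hn0.ne', one_smul]
  rw [e] at h2
  refine h2.trans ?_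
  have h3 := Real.sqrt_le_sqrt h1
  rw [Real.sqrt_mul hA, Real.sqrt_sq (norm_nonneg _), hsc] at h3
  calc _ ≤ n * (√A * ((n : ℝ)⁻¹ * ‖dualToH i ξ‖)) := by gcongr
    _ = _ := by field_simp

/-- The exponents on finite dimensional spaces obtained from `ψ / β` are tame, uniformly. -/
theorem exists_isTameExponent (hψ : IsLevyExponent ψ) (hν : IsLevySemigroup i ψ ν)
    (hm : HypothesisH i ν) {β : ℝ} (hβ : 0 < β) :
    ∃ K C r : ℝ, 0 ≤ K ∧ 0 ≤ C ∧ 0 < r ∧ ∀ (V : Type) [NormedAddCommGroup V] [NormedSpace ℝ V]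
      (Ξ : V →L[ℝ] StrongDual ℝ E), (∀ v, ‖dualToH i (Ξ v)‖ ≤ ‖v‖) →
      IsTameExponent (fun v => ψ (dualToH i (Ξ v)) / β) K C r := by
  obtain ⟨A, r, hA, hr, hloc⟩ := exists_local_bounds hψ hν hm
  refine ⟨√A / √β, (1 + A) / β, r, by positivity, by positivity, hr, fun V _ _ Ξ hΞ => ?_⟩
  have hlin : ∀ v, dualToH i (Ξ v) = ((dualToHCLM i).comp Ξ) v := fun v => rfl
  have hreβ : ∀ z : ℂ, (z / β).re = z.re / β := fun z => Complex.div_ofReal_re _ _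
  refine ⟨?_, fun v => ?_, fun v => ?_, fun v w => ?_, fun v => ?_, fun v hv => ?_⟩
  · have := hψ.continuous
    simp_rw [hlin]
    fun_prop
  · rw [hreβ]
    exact div_nonneg (hψ.re_nonneg _) hβ.le
  · rw [hlin, _root_.map_neg, hψ.map_neg, map_div₀, Complex.conj_ofReal, ← hlin]
  · rw [hreβ, hreβ, Real.sqrt_div (hψ.re_nonneg _), Real.sqrt_div (hψ.re_nonneg _),
      hlin (v + w), map_add, ← hlin, ← hlin, ← add_div, ← sub_div, norm_div, Complex.norm_real,
      Real.norm_eq_abs, abs_of_pos hβ]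
    have h1 := hψ.norm_add_sub_le (dualToH i (Ξ v)) (dualToH i (Ξ w))
    calc _ ≤ 2 * √(ψ (dualToH i (Ξ v))).re * √(ψ (dualToH i (Ξ w))).re / β := by gcongr
      _ = 2 * √(ψ (dualToH i (Ξ v))).re * √(ψ (dualToH i (Ξ w))).re / (√β * √β) := by
          rw [Real.mul_self_sqrt hβ.le]
      _ = _ := by
          have : √β ≠ 0 := (Real.sqrt_pos.2 hβ).ne'
          field_simp
  · rw [hreβ, Real.sqrt_div (hψ.re_nonneg _)]
    have h1 := sqrt_re_le_of_local_bounds hψ hA hr (fun ξ hξ => (hloc ξ hξ).2) (Ξ v)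
    rw [div_mul_eq_mul_div]
    gcongr
    exact h1.trans (by gcongr; exact hΞ v)
  · rw [norm_div, Complex.norm_real, Real.norm_eq_abs, abs_of_pos hβ, div_mul_eq_mul_div]
    gcongr
    exact ((hloc _ ((hΞ v).trans hv)).1).trans (by gcongr; exact hΞ v)

end MomentBounds

/-! ### An orthonormal basis of `H` consisting of functionals on `E` -/

section OrthonormalFunctionals

/-- Norming functionals at the points of a dense sequence: if all vanish at `z`, each dense point
`x` has `‖x‖ ≤ ‖z - x‖`, which is impossible for `x` close to a nonzero `z`. -/
theorem exists_separating_sequence (E : Type*) [NormedAddCommGroup E] [NormedSpace ℝ E]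
    [TopologicalSpace.SeparableSpace E] :
    ∃ f : ℕ → StrongDual ℝ E, ∀ z, (∀ n, f n z = 0) → z = 0 := by
  choose g hg1 hg2 using exists_dual_vector'' ℝ (E := E)
  refine ⟨fun n => g (TopologicalSpace.denseSeq E n), fun z hz => ?_⟩
  by_contra h0
  obtain ⟨n, hn⟩ := (TopologicalSpace.denseRange_denseSeq E).exists_dist_lt z
    (half_pos (norm_pos_iff.2 h0))
  set x := TopologicalSpace.denseSeq E n
  rw [dist_eq_norm] at hn
  have h1 : ‖x‖ ≤ ‖z - x‖ := by
    have h2 : g x (x - z) = ‖x‖ := by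
      rw [map_sub, hg2, hz n]
      simp
    rw [← h2, norm_sub_rev z x]
    calc _ ≤ ‖g x (x - z)‖ := le_abs_self _
      _ ≤ ‖g x‖ * ‖x - z‖ := (g x).le_opNorm _
      _ ≤ 1 * ‖x - z‖ := by gcongr; exact hg1 x
      _ = _ := one_mul _
  have h3 : ‖z‖ ≤ ‖z - x‖ + ‖x‖ := by simpa using norm_add_le (z - x) x
  linarith

variable {H E : Type*} [NormedAddCommGroup H] [InnerProductSpace ℝ H] [CompleteSpace H]
  [NormedAddCommGroup E] [NormedSpace ℝ E] {i : H →L[ℝ] E}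

/-- There are countably many functionals on `E` which form an orthonormal basis of `H`, and whose
square summability characterizes `H` inside `E`. -/
theorem exists_hilbertBasis_dual [TopologicalSpace.SeparableSpace E] (hi : IsDenseInclusion i) :
    ∃ (ι : Set ℕ) (ξ : ι → StrongDual ℝ E) (b : HilbertBasis ι ℝ H),
      (∀ k, b k = dualToH i (ξ k)) ∧
      ∀ z : E, (Summable fun k => ξ k z ^ 2) → z ∈ Set.range i := by
  obtain ⟨f, hf⟩ := exists_separating_sequence E
  set d : ℕ → H := fun n => dualToHCLM i (f n) with hd
  set g := InnerProductSpace.gramSchmidtNormed ℝ d with hg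
  set ι : Set ℕ := {n | g n ≠ 0} with hι
  have horth : Orthonormal ℝ fun k : ι => g k :=
    InnerProductSpace.gramSchmidtNormed_orthonormal' d
  have hspan : Submodule.span ℝ (Set.range g) = Submodule.span ℝ (Set.range d) := by
    rw [hg, InnerProductSpace.span_gramSchmidtNormed_range, InnerProductSpace.span_gramSchmidt]
  have hspan2 : Submodule.span ℝ (Set.range fun k : ι => g k)
      = Submodule.span ℝ (Set.range g) := by
    refine le_antisymm (Submodule.span_mono ?_) (Submodule.span_le.2 ?_)
    · rintro _ ⟨k, rfl⟩
      exact ⟨k, rfl⟩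
    · rintro _ ⟨n, rfl⟩
      by_cases hn : g n = 0
      · rw [hn]
        exact Submodule.zero_mem _
      · exact Submodule.subset_span ⟨⟨n, hn⟩, rfl⟩
  have hdmem : ∀ n, d n ∈ Submodule.span ℝ (Set.range fun k : ι => g k) := fun n => by
    rw [hspan2, hspan]
    exact Submodule.subset_span ⟨n, rfl⟩
  -- Gram–Schmidt forms only finite linear combinations, so the orthonormal vectors still come from
  -- functionals on `E`.
  have hlift : ∀ k : ι, ∃ ξ : StrongDual ℝ E, dualToHCLM i ξ = g k := by
    intro k
    have h1 : g k ∈ Submodule.span ℝ (Set.range d) := hspan ▸ Submodule.subset_span ⟨k, rfl⟩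
    have h2 : Submodule.span ℝ (Set.range d) ≤ LinearMap.range (dualToHCLM i).toLinearMap :=
      Submodule.span_le.2 (by rintro _ ⟨n, rfl⟩; exact ⟨f n, rfl⟩)
    exact h2 h1
  choose ξ hξ using hlift
  have hbot : (Submodule.span ℝ (Set.range fun k : ι => g k))ᗮ = ⊥ := by
    refine (Submodule.eq_bot_iff _).2 fun x hx => ?_
    refine hi.injective ?_
    rw [map_zero]
    refine hf _ fun n => ?_
    rw [← inner_dualToH]
    exact (Submodule.mem_orthogonal _ _).1 hx _ (hdmem n)
  let b := HilbertBasis.mkOfOrthogonalEqBot horth hbot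
  have hb : ∀ k, b k = dualToH i (ξ k) := fun k => by
    rw [← dualToHCLM_apply, hξ k]
    exact congrFun (HilbertBasis.coe_mkOfOrthogonalEqBot horth hbot) k
  refine ⟨ι, ξ, b, hb, fun z hz => ?_⟩
  have hmem : Memℓp (fun k : ι => ξ k z) 2 := memℓp_gen (by simpa using hz)
  -- The vector of `H` with the same coordinates as `z`. Since the separating functionals lie in the
  -- span of the `ξ k`, they cannot distinguish `i h` from `z`.
  set h := b.repr.symm ⟨_, hmem⟩ with hh
  have hco : ∀ k, ξ k (i h) = ξ k z := fun k => by
    rw [← inner_dualToH, ← hb, ← b.repr_apply_apply, hh, LinearIsometryEquiv.apply_symm_apply]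
  have hall : ∀ η ∈ Submodule.span ℝ (Set.range ξ), η (i h) = η z := by
    intro η hη
    induction hη using Submodule.span_induction with
    | mem η hη => obtain ⟨k, rfl⟩ := hη; exact hco k
    | zero => rfl
    | add a b _ _ ha hb => simp [ha, hb]
    | smul c a _ ha => simp [ha]
  refine ⟨h, ?_⟩
  rw [← sub_eq_zero]
  refine hf _ fun n => ?_
  rw [map_sub, sub_eq_zero]
  refine hall _ ?_
  have h1 : d n ∈ (Submodule.span ℝ (Set.range ξ)).map (dualToHCLM i).toLinearMap := by
    rw [Submodule.map_span, ← Set.range_comp]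
    have : (⇑(dualToHCLM i).toLinearMap ∘ ξ) = fun k : ι => g k := funext hξ
    rw [this]
    exact hdmem n
  obtain ⟨η, hη, he⟩ := h1
  rwa [← dualToH_injective hi he]

variable {ι : Type} {ξ : ι → StrongDual ℝ E} {b : HilbertBasis ι ℝ H}

theorem norm_sq_dualToH_sum (hb : ∀ k, b k = dualToH i (ξ k)) (s : Finset ι) (c : ι → ℝ) :
    ‖dualToH i (∑ k ∈ s, c k • ξ k)‖ ^ 2 = ∑ k ∈ s, c k ^ 2 := by
  rw [← dualToHCLM_apply, map_sum]
  have h1 : ∀ k ∈ s, dualToHCLM i (c k • ξ k) = c k • b k := fun k _ => by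
    rw [map_smul, dualToHCLM_apply, hb]
  rw [Finset.sum_congr rfl h1, ← real_inner_self_eq_norm_sq, b.orthonormal.inner_sum]
  simp [sq]

/-- Testing with `η = ∑ ξ_k(y) ξ_k` over a finite set turns the hypothesis into `S² ≤ B S` for the
partial sum `S` of squares, so `S ≤ B`. -/
theorem mem_range_of_sq_le (hb : ∀ k, b k = dualToH i (ξ k))
    (hsum : ∀ z : E, (Summable fun k => ξ k z ^ 2) → z ∈ Set.range i) {y : E} {B : ℝ}
    (hB : 0 ≤ B) (h : ∀ η : StrongDual ℝ E, η y ^ 2 ≤ B * ‖dualToH i η‖ ^ 2) : y ∈ Set.range i := by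
  refine hsum y (summable_of_sum_le (c := B) (fun k => sq_nonneg _) fun s => ?_)
  have h1 := h (∑ k ∈ s, ξ k y • ξ k)
  rw [norm_sq_dualToH_sum hb] at h1
  have h2 : (∑ k ∈ s, ξ k y • ξ k) y = ∑ k ∈ s, ξ k y ^ 2 := by
    simp [sq]
  rw [h2] at h1
  have h3 : 0 ≤ ∑ k ∈ s, ξ k y ^ 2 := Finset.sum_nonneg fun k _ => sq_nonneg _
  rcases h3.eq_or_lt with h0 | h0
  · rwa [← h0]
  · nlinarith

end OrthonormalFunctionals

/-! ### Cylindrical parametrizations -/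

section Cylinders

variable {H E : Type*} [NormedAddCommGroup H] [InnerProductSpace ℝ H] [CompleteSpace H]
  [NormedAddCommGroup E] [NormedSpace ℝ E] {i : H →L[ℝ] E}
  {ι : Type} {ξ : ι → StrongDual ℝ E} {b : HilbertBasis ι ℝ H}

/-- The linear parametrization `v ↦ δ ∑ v_k ξ_k` of the span of finitely many functionals. -/
noncomputable def cylinderMap (ξ : ι → StrongDual ℝ E) (δ : ℝ) (s : Finset ι) :
    EuclideanSpace ℝ s →L[ℝ] StrongDual ℝ E :=
  ∑ k : s, (δ • EuclideanSpace.proj (𝕜 := ℝ) k).smulRight (ξ k)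

theorem cylinderMap_apply (δ : ℝ) (s : Finset ι) (v : EuclideanSpace ℝ s) :
    cylinderMap ξ δ s v = ∑ k : s, (δ * v k) • ξ k := by
  simp [cylinderMap]

theorem cylinderMap_apply_apply (δ : ℝ) (s : Finset ι) (v : EuclideanSpace ℝ s) (z : E) :
    cylinderMap ξ δ s v z = δ * ∑ k : s, v k * ξ k z := by
  rw [cylinderMap_apply, sum_apply, Finset.mul_sum]
  simp [mul_assoc]

theorem norm_dualToH_cylinderMap (hb : ∀ k, b k = dualToH i (ξ k)) {δ : ℝ} (hδ : 0 ≤ δ)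
    (s : Finset ι) (v : EuclideanSpace ℝ s) :
    ‖dualToH i (cylinderMap ξ δ s v)‖ = δ * ‖v‖ := by
  classical
  have h1 : cylinderMap ξ δ s v
      = ∑ k ∈ s, (if hk : k ∈ s then δ * v ⟨k, hk⟩ else 0) • ξ k := by
    rw [cylinderMap_apply, ← Finset.sum_coe_sort s]
    refine Finset.sum_congr rfl fun k _ => ?_
    simp
  have h2 : ‖dualToH i (cylinderMap ξ δ s v)‖ ^ 2 = (δ * ‖v‖) ^ 2 := by
    rw [h1, norm_sq_dualToH_sum hb, ← Finset.sum_coe_sort s, mul_pow,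
      EuclideanSpace.real_norm_sq_eq, Finset.mul_sum]
    refine Finset.sum_congr rfl fun k _ => ?_
    simp [mul_pow]
  exact (pow_left_inj₀ (norm_nonneg _) (by positivity) two_ne_zero).1 h2

/-- The transpose of `δ` times an isometry into `H` has norm at most `δ` on `H`, uniformly in the
finite set `s`. On points outside `H`, by contrast, its norm is unbounded as `s` grows. -/
theorem norm_flip_cylinderMap_le (hb : ∀ k, b k = dualToH i (ξ k)) {δ : ℝ} (hδ : 0 ≤ δ)
    (s : Finset ι) (h : H) : ‖(cylinderMap ξ δ s).flip (i h)‖ ≤ δ * ‖h‖ := by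
  refine ContinuousLinearMap.opNorm_le_bound _ (by positivity) fun v => ?_
  rw [ContinuousLinearMap.flip_apply, ← inner_dualToH, Real.norm_eq_abs]
  refine (abs_real_inner_le_norm _ _).trans_eq ?_
  rw [norm_dualToH_cylinderMap hb hδ]
  ring

theorem le_norm_flip_cylinderMap {δ : ℝ} (hδ : 0 ≤ δ) (s : Finset ι) (z : E) :
    δ ^ 2 * ∑ k ∈ s, ξ k z ^ 2 ≤ ‖(cylinderMap ξ δ s).flip z‖ ^ 2 := by
  set w : EuclideanSpace ℝ s := WithLp.toLp 2 fun k => ξ k z with hw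
  have hw2 : ‖w‖ ^ 2 = ∑ k ∈ s, ξ k z ^ 2 := by
    rw [EuclideanSpace.real_norm_sq_eq, ← Finset.sum_coe_sort s]
  have h1 : (cylinderMap ξ δ s).flip z w = δ * ‖w‖ ^ 2 := by
    rw [ContinuousLinearMap.flip_apply, cylinderMap_apply_apply, hw2, ← Finset.sum_coe_sort s]
    simp [hw, sq]
  have h2 := (le_abs_self _).trans (((cylinderMap ξ δ s).flip z).le_opNorm w)
  rw [h1] at h2
  rw [← hw2]
  rcases (norm_nonneg w).eq_or_lt with h0 | h0
  · rw [← h0]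
    simp
  · have h3 : δ * ‖w‖ ≤ ‖(cylinderMap ξ δ s).flip z‖ := by
      refine le_of_mul_le_mul_right ?_ h0
      linarith
    rw [← mul_pow]
    gcongr

end Cylinders

/-! ### Translates of `H` are null -/

section NullTranslates

variable {H E : Type*} [NormedAddCommGroup H] [InnerProductSpace ℝ H] [CompleteSpace H]
  [NormedAddCommGroup E] [NormedSpace ℝ E] [MeasurableSpace E] [BorelSpace E]
  {i : H →L[ℝ] E} {ψ : H → ℂ} {ν : ℝ → Measure E}

/-- By the moment bounds, all translates of `H` are null sets, once `H` is. -/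
theorem measure_translate_eq_zero (hm : HypothesisH i ν)
    (hrange : ∀ (y : E) (B : ℝ), 0 ≤ B →
      (∀ η : StrongDual ℝ E, η y ^ 2 ≤ B * ‖dualToH i η‖ ^ 2) → y ∈ Set.range i)
    {t : ℝ} (ht : 0 < t) [IsProbabilityMeasure (ν t)] (y : E) :
    ν t {z | z - y ∈ Set.range i} = 0 := by
  by_cases hy : y ∈ Set.range i
  · obtain ⟨h, rfl⟩ := hy
    have : {z | z - i h ∈ Set.range i} = Set.range i := by
      ext z
      constructor
      · rintro ⟨h', hh'⟩
        exact ⟨h' + h, by rw [map_add, hh', sub_add_cancel]⟩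
      · rintro ⟨h', rfl⟩
        exact ⟨h' - h, map_sub i h' h⟩
    rw [this]
    exact hm.null t ht
  obtain ⟨C, hC, hmom⟩ := hm.moments
  have hcover : {z | z - y ∈ Set.range i} ⊆ ⋃ n : ℕ, {z | ∃ h : H, ‖h‖ ≤ n ∧ z - y = i h} := by
    rintro z ⟨h, hh⟩
    obtain ⟨n, hn⟩ := exists_nat_ge ‖h‖
    exact Set.mem_iUnion.2 ⟨n, h, hn, hh.symm⟩
  refine measure_mono_null hcover (measure_iUnion_null fun n => ?_)
  -- If a translate by `y` of a ball of `H` had positive mass, then `z` would be within bounded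
  -- `H`-distance of `y` with positive probability. Chebyshev's inequality for `η(z)` then bounds
  -- `η(y)²` by a multiple of `|η|²`, forcing `y ∈ H`.
  by_contra h0
  refine hy ?_
  set c := ν t {z | ∃ h : H, ‖h‖ ≤ n ∧ z - y = i h} with hc
  have hcpos : 0 < c.toReal := ENNReal.toReal_pos h0 (measure_ne_top _ _)
  refine hrange y ((2 * (C * (1 + t ^ 2)) + 2 * n ^ 2) / c.toReal) (by positivity) fun η => ?_
  set σ := ‖dualToH i η‖
  have h1 : ENNReal.ofReal (η y ^ 2) * c ≤
      ENNReal.ofReal (2 * (C * (1 + t ^ 2) * σ ^ 2) + 2 * n ^ 2 * σ ^ 2) := by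
    calc ENNReal.ofReal (η y ^ 2) * c
        ≤ ENNReal.ofReal (η y ^ 2) * ν t {z | ENNReal.ofReal (η y ^ 2) ≤
            ENNReal.ofReal 2 * ENNReal.ofReal (η z ^ 2) + ENNReal.ofReal (2 * n ^ 2 * σ ^ 2)} := by
          gcongr
          refine measure_mono ?_
          rintro z ⟨h, hh, hz⟩
          have e1 : η z = η y + η (i h) := by rw [← hz, map_sub]; ring
          have e2 : |η (i h)| ≤ n * σ := by
            rw [← inner_dualToH]
            refine (abs_real_inner_le_norm _ _).trans ?_
            rw [mul_comm]
            gcongr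
          have e3 : η (i h) ^ 2 ≤ n ^ 2 * σ ^ 2 := by
            rw [← sq_abs, ← mul_pow]
            gcongr
          rw [Set.mem_ofPred_eq, ← ENNReal.ofReal_mul zero_le_two,
            ← ENNReal.ofReal_add (by positivity) (by positivity)]
          refine ENNReal.ofReal_le_ofReal ?_
          have e4 : η y ^ 2 ≤ 2 * η z ^ 2 + 2 * η (i h) ^ 2 := by
            rw [e1]
            nlinarith [sq_nonneg (η y + 2 * η (i h))]
          linarith
      _ ≤ ∫⁻ z, (ENNReal.ofReal 2 * ENNReal.ofReal (η z ^ 2)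
            + ENNReal.ofReal (2 * n ^ 2 * σ ^ 2)) ∂(ν t) :=
          mul_meas_ge_le_lintegral (by fun_prop) _
      _ = ENNReal.ofReal 2 * ∫⁻ z, ENNReal.ofReal (η z ^ 2) ∂(ν t)
            + ENNReal.ofReal (2 * n ^ 2 * σ ^ 2) := by
          rw [lintegral_add_right _ measurable_const,
            lintegral_const_mul' _ _ ENNReal.ofReal_ne_top, lintegral_const, measure_univ, mul_one]
      _ ≤ ENNReal.ofReal 2 * ENNReal.ofReal (C * (1 + t ^ 2) * σ ^ 2)
            + ENNReal.ofReal (2 * n ^ 2 * σ ^ 2) := by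
          gcongr
          refine (hmom η t ht).trans_eq ?_
          rw [← norm_dualToH]
      _ = _ := by
          rw [← ENNReal.ofReal_mul zero_le_two,
            ← ENNReal.ofReal_add (by positivity) (by positivity)]
  have hctop : c ≠ ∞ := measure_ne_top _ _
  rw [← ENNReal.ofReal_toReal hctop, ← ENNReal.ofReal_mul (sq_nonneg _),
    ENNReal.ofReal_le_ofReal_iff (by positivity)] at h1
  rw [div_mul_eq_mul_div, le_div_iff₀ hcpos]
  linarith

end NullTranslates

/-! ### The exponent is large along cylindrical averages -/

section LargeExponent

variable {H E : Type*} [NormedAddCommGroup H] [InnerProductSpace ℝ H] [CompleteSpace H]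
  [NormedAddCommGroup E] [NormedSpace ℝ E] [MeasurableSpace E] [BorelSpace E]
  [SecondCountableTopology E]
  {i : H →L[ℝ] E} {ψ : H → ℂ} {ν : ℝ → Measure E}

theorem isExponentAlong_of_isLevySemigroup (hψ : IsLevyExponent ψ) (hν : IsLevySemigroup i ψ ν)
    {V : Type*} [NormedAddCommGroup V] [NormedSpace ℝ V] (Ξ : V →L[ℝ] StrongDual ℝ E) :
    IsExponentAlong ν Ξ fun v => ψ (dualToH i (Ξ v)) where
  isProbabilityMeasure := hν.isProbabilityMeasure
  continuous := hψ.continuous.comp ((dualToHCLM i).comp Ξ).continuous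
  re_nonneg _ := hψ.re_nonneg _
  charFunDual_eq t ht _ := hν.fourier t ht _

theorem integral_exp_sub_eq (hψ : IsLevyExponent ψ) (hν : IsLevySemigroup i ψ ν)
    (η : StrongDual ℝ E) :
    ∫ p : E × E, Complex.exp (η (p.1 - p.2) * Complex.I) ∂((ν 1).prod (ν 1))
      = Real.exp (-(2 * (ψ (dualToH i η)).re)) := by
  have := hν.isProbabilityMeasure 1 one_pos
  have e1 : ∀ p : E × E, Complex.exp (η (p.1 - p.2) * Complex.I)
      = Complex.exp (η p.1 * Complex.I) * Complex.exp ((-η) p.2 * Complex.I) := by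
    intro p
    rw [← Complex.exp_add, map_sub]
    congr 1
    simp
    ring
  simp_rw [e1]
  rw [integral_prod_mul (fun z => Complex.exp (η z * Complex.I))
    (fun z => Complex.exp ((-η) z * Complex.I)), ← charFunDual_apply, ← charFunDual_apply,
    hν.fourier 1 one_pos, hν.fourier 1 one_pos, ← Complex.exp_add, ← neg_one_smul ℝ η,
    dualToH_smul, neg_one_smul, hψ.map_neg, Complex.ofReal_exp]
  congr 1
  apply Complex.ext <;> simp
  ring

theorem integral_exp_stdGaussian {V : Type*} [NormedAddCommGroup V] [InnerProductSpace ℝ V]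
    [FiniteDimensional ℝ V] [MeasurableSpace V] [BorelSpace V] (Ξ : V →L[ℝ] StrongDual ℝ E)
    (z : E) :
    ∫ v, Complex.exp (Ξ v z * Complex.I) ∂(stdGaussian V)
      = Real.exp (-‖Ξ.flip z‖ ^ 2 / 2) := by
  have h1 := charFunDual_stdGaussian (Ξ.flip z)
  rw [charFunDual_apply] at h1
  simp only [ContinuousLinearMap.flip_apply] at h1
  rw [h1]
  push_cast
  rfl

/-- `exp(-2 Re ψ)` is the Fourier transform of the law of the difference of two independent copies,
and `exp(-‖·‖² / 2)` that of the Gaussian measure; Fubini exchanges the two roles. -/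
theorem integral_exp_neg_two_re (hψ : IsLevyExponent ψ) (hν : IsLevySemigroup i ψ ν)
    {V : Type*} [NormedAddCommGroup V] [InnerProductSpace ℝ V]
    [FiniteDimensional ℝ V] [MeasurableSpace V] [BorelSpace V] (Ξ : V →L[ℝ] StrongDual ℝ E) :
    ∫ v, Real.exp (-(2 * (ψ (dualToH i (Ξ v))).re)) ∂(stdGaussian V)
      = ∫ p : E × E, Real.exp (-‖Ξ.flip (p.1 - p.2)‖ ^ 2 / 2) ∂((ν 1).prod (ν 1)) := by
  have := hν.isProbabilityMeasure 1 one_pos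
  have hc : ∫ v, ((Real.exp (-(2 * (ψ (dualToH i (Ξ v))).re)) : ℝ) : ℂ) ∂(stdGaussian V)
      = ∫ p : E × E, ((Real.exp (-‖Ξ.flip (p.1 - p.2)‖ ^ 2 / 2) : ℝ) : ℂ)
        ∂((ν 1).prod (ν 1)) := by
    simp_rw [← integral_exp_sub_eq hψ hν, ← integral_exp_stdGaussian]
    refine integral_integral_swap ?_
    refine integrable_of_continuous_of_bound ?_ 1 fun q => ?_
    · simp only [Function.uncurry_def]
      fun_prop
    · simp only [Function.uncurry_def]
      rw [Complex.norm_exp_ofReal_mul_I]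
  rw [integral_complex_ofReal, integral_complex_ofReal] at hc
  exact_mod_cast hc

variable {ι : Type} [Countable ι] {ξ : ι → StrongDual ℝ E}

/-- Almost surely the difference of two independent copies lies outside `H`, so its squared
coordinates are not summable and the Gaussian function tends to zero along finite sets. -/
theorem tendsto_integral_exp_cylinderMap (hν : IsLevySemigroup i ψ ν)
    (hsum : ∀ z : E, (Summable fun k => ξ k z ^ 2) → z ∈ Set.range i)
    (hmeas : MeasurableSet (Set.range i))
    (hnull : ∀ y, ν 1 {z | z - y ∈ Set.range i} = 0) {δ : ℝ} (hδ : 0 < δ) :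
    Tendsto (fun s : Finset ι => ∫ p : E × E,
      Real.exp (-‖(cylinderMap ξ δ s).flip (p.1 - p.2)‖ ^ 2 / 2) ∂((ν 1).prod (ν 1)))
      atTop (𝓝 0) := by
  have := hν.isProbabilityMeasure 1 one_pos
  have hae : ∀ᵐ p ∂((ν 1).prod (ν 1)), p.1 - p.2 ∉ Set.range i := by
    have hms : MeasurableSet {p : E × E | p.2 - p.1 ∈ Set.range i} :=
      (measurable_snd.sub measurable_fst) hmeas
    have h1 := (Measure.measure_prod_null (μ := ν 1) (ν := ν 1) hms).2
      (Eventually.of_forall fun x => hnull x)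
    filter_upwards [measure_eq_zero_iff_ae_notMem.1 h1] with p hp ⟨h, hh⟩
    exact hp ⟨-h, by rw [map_neg, hh, neg_sub]⟩
  have h0 : ∫ p : E × E, (0 : ℝ) ∂((ν 1).prod (ν 1)) = 0 := integral_zero _ _
  rw [← h0]
  refine tendsto_integral_filter_of_dominated_convergence (fun _ => (1 : ℝ))
    (Eventually.of_forall fun s => ?_) (Eventually.of_forall fun s => Eventually.of_forall
      fun p => ?_) (integrable_const _) ?_
  · exact Continuous.aestronglyMeasurable (by fun_prop)
  · rw [Real.norm_eq_abs, Real.abs_exp, Real.exp_le_one_iff]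
    have : 0 ≤ ‖(cylinderMap ξ δ s).flip (p.1 - p.2)‖ ^ 2 := sq_nonneg _
    linarith
  · filter_upwards [hae] with p hp
    set z := p.1 - p.2
    have hns : ¬ Summable fun k => ξ k z ^ 2 := fun h => hp (hsum z h)
    have htop : Tendsto (fun s : Finset ι => ∑ k ∈ s, ξ k z ^ 2) atTop atTop := by
      refine tendsto_atTop_atTop_of_monotone (fun s t hst =>
        Finset.sum_le_sum_of_subset_of_nonneg hst fun k _ _ => sq_nonneg _) fun B => ?_
      by_contra hB
      push Not at hB
      exact hns (summable_of_sum_le (fun k => sq_nonneg _) fun s => (hB s).le)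
    refine squeeze_zero (fun s => (Real.exp_pos _).le) (fun s => ?_)
      (Real.tendsto_exp_atBot.comp (tendsto_neg_atTop_atBot.comp
        (htop.const_mul_atTop (show 0 < δ ^ 2 / 2 by positivity))))
    simp only [Function.comp]
    rw [Real.exp_le_exp]
    have := le_norm_flip_cylinderMap (ξ := ξ) hδ.le s z
    linarith

/-- Along cylindrical Gaussian averages the exponent is eventually large. -/
theorem exists_finset_large_exponent (hψ : IsLevyExponent ψ) (hν : IsLevySemigroup i ψ ν)
    (hsum : ∀ z : E, (Summable fun k => ξ k z ^ 2) → z ∈ Set.range i)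
    (hmeas : MeasurableSet (Set.range i))
    (hnull : ∀ y, ν 1 {z | z - y ∈ Set.range i} = 0) {δ : ℝ} (hδ : 0 < δ) {β : ℝ} (hβ : 0 < β)
    (L : ℝ) :
    ∃ s : Finset ι, 1 / 2 ≤ (stdGaussian (EuclideanSpace ℝ s)).real
      {v | L ≤ 1 + (ψ (dualToH i (cylinderMap ξ δ s v)) / β).re} := by
  have h1 := tendsto_integral_exp_cylinderMap hν hsum hmeas hnull hδ
  -- Where the exponent is below the threshold, `exp(-2 Re ψ)` exceeds `exp(-2 β (L - 1))`. Markov's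
  -- inequality with half of that value makes this event have probability below `1/2`.
  obtain ⟨s, hs⟩ := (h1.eventually (gt_mem_nhds
    (show 0 < Real.exp (-(2 * β * (L - 1))) / 2 by positivity))).exists
  refine ⟨s, ?_⟩
  rw [← integral_exp_neg_two_re hψ hν] at hs
  set γ := stdGaussian (EuclideanSpace ℝ s)
  have hcont : Continuous fun v => ψ (dualToH i (cylinderMap ξ δ s v)) :=
    (isExponentAlong_of_isLevySemigroup hψ hν (cylinderMap ξ δ s)).continuous
  have hA : MeasurableSet {v | L ≤ 1 + (ψ (dualToH i (cylinderMap ξ δ s v)) / β).re} :=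
    measurableSet_le measurable_const
      (continuous_const.add (Complex.continuous_re.comp (hcont.div_const _))).measurable
  set A := {v | L ≤ 1 + (ψ (dualToH i (cylinderMap ξ δ s v)) / β).re} with hAdef
  have h2 : γ.real Aᶜ * Real.exp (-(2 * β * (L - 1))) ≤
      ∫ v, Real.exp (-(2 * (ψ (dualToH i (cylinderMap ξ δ s v))).re)) ∂γ := by
    rw [← smul_eq_mul, ← setIntegral_const, ← integral_indicator hA.compl]
    refine integral_mono ((integrable_const _).indicator hA.compl)
      (integrable_of_continuous_of_bound (Real.continuous_exp.comp
        ((Complex.continuous_re.comp hcont).const_mul 2).neg) 1 fun v => ?_) fun v => ?_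
    · rw [Real.norm_eq_abs, Real.abs_exp, Real.exp_le_one_iff]
      linarith [hψ.re_nonneg (dualToH i (cylinderMap ξ δ s v))]
    · refine Set.indicator_apply_le' (fun hv => ?_) fun _ => (Real.exp_pos _).le
      rw [Real.exp_le_exp]
      simp only [hAdef, Set.mem_compl_iff, Set.mem_ofPred_eq, not_le, Complex.div_ofReal_re] at hv
      have h3 : (ψ (dualToH i (cylinderMap ξ δ s v))).re / β < L - 1 := by linarith
      rw [div_lt_iff₀ hβ] at h3
      linarith
  have h3 : γ.real Aᶜ = 1 - γ.real A := probReal_compl_eq_one_sub hA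
  rw [h3] at h2
  have h4 := Real.exp_pos (-(2 * β * (L - 1)))
  nlinarith

end LargeExponent

/-! ### Polarity of `H` under hypothesis (H) -/

section Polarity

variable {H E : Type*} [NormedAddCommGroup H] [InnerProductSpace ℝ H] [CompleteSpace H]
  [NormedAddCommGroup E] [NormedSpace ℝ E] [MeasurableSpace E] [BorelSpace E]
  [SecondCountableTopology E]
  {i : H →L[ℝ] E} {ψ : H → ℂ} {ν : ℝ → Measure E}

theorem fourierIntegral_const_nonneg {V : Type*} [NormedAddCommGroup V] [InnerProductSpace ℝ V]
    [FiniteDimensional ℝ V] [MeasurableSpace V] [BorelSpace V] (Ξ : V →L[ℝ] StrongDual ℝ E)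
    {c : ℝ} (hc : 0 ≤ c) (x : E) :
    0 ≤ (fourierIntegral (stdGaussian V) Ξ (fun _ => (c : ℂ)) x).re := by
  rw [fourierIntegral, integral_mul_const, integral_exp_stdGaussian, ← Complex.ofReal_mul,
    Complex.ofReal_re]
  positivity

theorem norm_div_add_sub_div_add_le {z : ℂ} (hz : 0 ≤ z.re) {α β c : ℝ} (hα : 0 < α)
    (hβ : 0 < β) (hc : 0 ≤ c) :
    ‖(c : ℂ) / (β + z) - c / ((β + α : ℝ) + z)‖
      ≤ α * c / β ^ 2 * (1 / (1 + (z / β).re) ^ 2) := by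
  have n1 := add_ne_zero_of_re_nonneg hβ hz
  have n2 := add_ne_zero_of_re_nonneg (add_pos hβ hα) hz
  have h1 : (c : ℂ) / (β + z) - c / ((β + α : ℝ) + z)
      = (α * c : ℝ) / ((β + z) * ((β + α : ℝ) + z)) := by
    push_cast at n2 ⊢
    field_simp
    ring
  have h2 := le_norm_add (α := β) (z := z)
  have h3 := le_norm_add (α := β + α) (z := z)
  have h4 : α * c / β ^ 2 * (1 / (1 + (z / β).re) ^ 2) = α * c / ((β + z.re) * (β + z.re)) := by
    rw [Complex.div_ofReal_re]
    have : β + z.re ≠ 0 := by positivity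
    field_simp
  rw [h1, h4, norm_div, norm_mul, Complex.norm_real, Real.norm_eq_abs,
    abs_of_nonneg (by positivity)]
  have : 0 < β + z.re := by positivity
  gcongr
  linarith

theorem const_div_add_eq {z : ℂ} {β : ℝ} (hβ : 0 < β) (c : ℝ) :
    (c : ℂ) / (β + z) = (c / β : ℝ) * (1 / (1 + z / β)) := by
  have hβ' : (β : ℂ) ≠ 0 := by exact_mod_cast hβ.ne'
  have : (β : ℂ) + z = β * (1 + z / β) := by field_simp
  rw [this]
  push_cast
  rw [div_mul_div_comm, mul_one]

/-- Along a finite dimensional Gaussian average of large and tame exponent, there is an excessive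
function that dominates `1` on a large part of `H` and has a small smoothed value. -/
theorem exists_isExcessive_of_threshold {V : Type*} [NormedAddCommGroup V]
    [InnerProductSpace ℝ V] [FiniteDimensional ℝ V] [MeasurableSpace V] [BorelSpace V]
    {Ξ : V →L[ℝ] StrongDual ℝ E} {Ψ : V → ℂ} (h : IsExponentAlong ν Ξ Ψ) {β η : ℝ} (hβ : 0 < β)
    (h1 : ∫ v, 1 / (1 + (Ψ v / β).re) ^ 2 ∂(stdGaussian V)
      ≤ η * ∫ v, 1 / (1 + (Ψ v / β).re) ∂(stdGaussian V))
    (h2 : ∀ θ : StrongDual ℝ V, ‖θ‖ ≤ 1 / 16 →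
      1 / 2 * ∫ v, 1 / (1 + (Ψ v / β).re) ∂(stdGaussian V) ≤
        ∫ v, (Complex.exp (θ v * Complex.I) / (1 + Ψ v / β)).re ∂(stdGaussian V)) :
    ∃ u : E → ℝ≥0∞, IsExcessive ν β u ∧
      (∀ x, AEMeasurable (fun t => transition ν t u x) (volume.restrict (Set.Ioi 0))) ∧
      (∀ y, ‖Ξ.flip y‖ ≤ 1 / 16 → 1 ≤ u y) ∧
      ∀ α, 0 < α → ∀ x,
        ENNReal.ofReal α * resolventKernel ν (β + α) u x ≤ ENNReal.ofReal (2 * α * η / β) := by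
  set γ := stdGaussian V
  have hreβ : ∀ v, 0 ≤ (Ψ v / β).re := fun v => by
    rw [Complex.div_ofReal_re]
    exact div_nonneg (h.re_nonneg v) hβ.le
  have hcont : Continuous fun v => (Ψ v / β).re :=
    Complex.continuous_re.comp (h.continuous.div_const _)
  have hpos : ∀ v, 0 < 1 + (Ψ v / β).re := fun v => by linarith [hreβ v]
  have hcont1 : Continuous fun v => 1 / (1 + (Ψ v / β).re) :=
    continuous_const.div (continuous_const.add hcont) fun v => (hpos v).ne'
  have hle1 : ∀ v, 1 / (1 + (Ψ v / β).re) ≤ 1 := fun v => by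
    rw [div_le_one (hpos v)]
    linarith [hreβ v]
  set D := ∫ v, 1 / (1 + (Ψ v / β).re) ∂γ with hD
  have hDpos : 0 < D := by
    have hint : Integrable (fun v => 1 / (1 + (Ψ v / β).re)) γ :=
      integrable_of_continuous_of_bound hcont1 1 fun v => by
        rw [Real.norm_eq_abs, abs_of_nonneg (one_div_pos.2 (hpos v)).le]
        exact hle1 v
    rw [hD, integral_pos_iff_support_of_nonneg (fun v => (one_div_pos.2 (hpos v)).le) hint]
    have : Function.support (fun v => 1 / (1 + (Ψ v / β).re)) = Set.univ := by
      ext v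
      simpa using (hpos v).ne'
    rw [this, measure_univ]
    exact one_pos
  -- Normalization: the lower bound `c / β * (D / 2)` for the potential near the origin becomes
  -- exactly `1`.
  set c := 2 * β / D with hc
  have hcpos : 0 < c := by positivity
  have hk : Continuous fun _ : V => (c : ℂ) := continuous_const
  have hM : ∀ _ : V, ‖(c : ℂ)‖ ≤ c := fun _ => by
    rw [Complex.norm_real, Real.norm_eq_abs, abs_of_pos hcpos]
  have hnn := fourierIntegral_const_nonneg Ξ hcpos.le
  have hk1 := continuous_div_add h hk hβ
  have hM1 : ∀ v, ‖(c : ℂ) / (β + Ψ v)‖ ≤ c / β := fun v =>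
    norm_div_add_le hβ (h.re_nonneg v) (hM v)
  refine ⟨_, isExcessive_fourierIntegral_div h hk hM hnn hβ, fun x =>
    aemeasurable_transition_fourierIntegral h hk1 hM1
      (fun y => fourierIntegral_div_nonneg h hk hM hnn hβ y) x, fun y hy => ?_, fun α hα x => ?_⟩
  · rw [← ENNReal.ofReal_one]
    refine ENNReal.ofReal_le_ofReal ?_
    have e1 : (fourierIntegral γ Ξ (fun v => (c : ℂ) / (β + Ψ v)) y).re = c / β *
        ∫ v, (Complex.exp (Ξ.flip y v * Complex.I) / (1 + Ψ v / β)).re ∂γ := by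
      rw [fourierIntegral, ← integral_const_mul, ← RCLike.re_eq_complex_re,
        ← integral_re (integrable_exp_mul hk1 hM1 y)]
      refine integral_congr_ae (Eventually.of_forall fun v => ?_)
      dsimp only
      rw [RCLike.re_eq_complex_re, const_div_add_eq hβ, ← Complex.re_ofReal_mul,
        ContinuousLinearMap.flip_apply]
      congr 1
      ring
    rw [e1]
    calc 1 = c / β * (1 / 2 * D) := by
          rw [hc]
          field_simp
      _ ≤ _ := by
          gcongr
          exact h2 _ hy
  · have hk2 := continuous_div_add h hk (add_pos hβ hα)
    have hM2 : ∀ v, ‖(c : ℂ) / ((β + α : ℝ) + Ψ v)‖ ≤ c / (β + α) := fun v =>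
      norm_div_add_le (add_pos hβ hα) (h.re_nonneg v) (hM v)
    rw [mul_resolventKernel_fourierIntegral_div h hk hM hnn hα hβ]
    refine ENNReal.ofReal_le_ofReal ?_
    rw [← Complex.sub_re, ← fourierIntegral_sub hk1 hM1 hk2 hM2]
    refine (Complex.re_le_norm _).trans ((norm_fourierIntegral_le x).trans ?_)
    have hint2 : Integrable (fun v => α * c / β ^ 2 * (1 / (1 + (Ψ v / β).re) ^ 2)) γ := by
      have hcont2 : Continuous fun v => 1 / (1 + (Ψ v / β).re) ^ 2 := continuous_const.div
        ((continuous_const.add hcont).pow 2) fun v => (pow_pos (hpos v) 2).ne'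
      refine (integrable_of_continuous_of_bound hcont2 1 fun v => ?_).const_mul _
      rw [Real.norm_eq_abs, abs_of_nonneg (by have := hpos v; positivity), ← one_div_pow]
      exact pow_le_one₀ (one_div_pos.2 (hpos v)).le (hle1 v)
    calc _ ≤ ∫ v, α * c / β ^ 2 * (1 / (1 + (Ψ v / β).re) ^ 2) ∂γ :=
          integral_mono_of_nonneg (Eventually.of_forall fun v => norm_nonneg _) hint2
            (Eventually.of_forall fun v =>
              norm_div_add_sub_div_add_le (h.re_nonneg v) hα hβ hcpos.le)
      _ = α * c / β ^ 2 * ∫ v, 1 / (1 + (Ψ v / β).re) ^ 2 ∂γ := integral_const_mul _ _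
      _ ≤ α * c / β ^ 2 * (η * D) := by gcongr
      _ = 2 * α * η / β := by
          rw [hc]
          field_simp

/-- Under hypothesis (H), the space `H` is polar. -/
theorem isPolar_range [TopologicalSpace.SeparableSpace H] (hi : IsDenseInclusion i)
    (hψ : IsLevyExponent ψ) (hν : IsLevySemigroup i ψ ν) (hm : HypothesisH i ν) :
    IsPolar ν (Set.range i) := by
  have : SecondCountableTopology H := UniformSpace.secondCountable_of_separable H
  -- The Lusin–Souslin theorem: an injective continuous image of a Polish space is Borel.
  have hmeas : MeasurableSet (Set.range i) := by
    borelize H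
    exact measurableSet_range_of_continuous_injective i.continuous hi.injective
  refine ⟨hmeas, fun β hβ x => regularization_reduced_eq_zero fun α hα ε hε => ?_⟩
  obtain ⟨ι, ξ, b, hb, hsum⟩ := exists_hilbertBasis_dual hi
  obtain ⟨K, C, r, hK, hC, hr, htame⟩ := exists_isTameExponent hψ hν hm hβ
  have hprob := hν.isProbabilityMeasure 1 one_pos
  have hnull : ∀ y, ν 1 {z | z - y ∈ Set.range i} = 0 :=
    measure_translate_eq_zero hm (fun y B hB h => mem_range_of_sq_le hb hsum hB h) one_pos
  obtain ⟨ε', hε', hε'sum⟩ := ENNReal.exists_pos_sum_of_countable (ENNReal.coe_ne_zero.2 hε.ne') ℕ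
  have key : ∀ n : ℕ, ∃ u : E → ℝ≥0∞, IsExcessive ν β u ∧
      (∀ x, AEMeasurable (fun t => transition ν t u x) (volume.restrict (Set.Ioi 0))) ∧
      (∀ h : H, ‖h‖ ≤ n → 1 ≤ u (i h)) ∧
      ENNReal.ofReal α * resolventKernel ν (β + α) u x ≤ ε' n := by
    intro n
    -- The ball of radius `n` in `H` is sent into phases of norm at most `1/16`, as the threshold
    -- estimate requires. The value of `η` below makes the smoothed bound `2 α η / β` equal to `ε'
    -- n`.
    set δ : ℝ := 1 / (16 * (n + 1)) with hδdef
    have hδ : 0 < δ := by positivity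
    have hη : 0 < (ε' n : ℝ) * β / (2 * α) := by
      have := NNReal.coe_pos.2 (hε' n)
      positivity
    obtain ⟨L, hL⟩ := IsTameExponent.exists_threshold hK hC hr hη
    obtain ⟨s, hs⟩ := exists_finset_large_exponent hψ hν hsum hmeas hnull hδ hβ L
    have hδ1 : δ ≤ 1 := by
      rw [hδdef, div_le_one (by positivity)]
      have : (0 : ℝ) ≤ n := n.cast_nonneg
      linarith
    obtain ⟨h1, h2⟩ := hL _ _ (htame _ (cylinderMap ξ δ s) fun v => by
      rw [norm_dualToH_cylinderMap hb hδ.le]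
      exact mul_le_of_le_one_left (norm_nonneg _) hδ1) hs
    obtain ⟨u, hu, hut, hu1, hu2⟩ := exists_isExcessive_of_threshold
      (isExponentAlong_of_isLevySemigroup hψ hν (cylinderMap ξ δ s)) hβ h1 h2
    refine ⟨u, hu, hut, fun h hh => hu1 _ ?_, (hu2 α hα x).trans_eq ?_⟩
    · refine (norm_flip_cylinderMap_le hb hδ.le s h).trans ?_
      calc δ * ‖h‖ ≤ δ * (n + 1) := by gcongr; linarith
        _ = 1 / 16 := by
            rw [hδdef]
            field_simp
    · have : 2 * α * ((ε' n : ℝ) * β / (2 * α)) / β = ε' n := by field_simp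
      rw [this, ENNReal.ofReal_coe_nnreal]
  choose u hu hut hu1 hu2 using key
  refine ⟨_, isExcessive_tsum hu hut, ?_, ?_⟩
  · rintro _ ⟨h, rfl⟩
    obtain ⟨n, hn⟩ := exists_nat_ge ‖h‖
    exact (hu1 n h hn).trans (ENNReal.le_tsum n)
  · rw [resolventKernel_tsum (fun n => (hu n).measurable) fun n => hut n x,
      ← ENNReal.tsum_mul_left]
    exact (ENNReal.tsum_le_tsum hu2).trans hε'sum.le

end Polarity

/-! ### The Gaussian semigroup as a Lévy semigroup -/

section Gaussian

variable {H E : Type*} [NormedAddCommGroup H] [InnerProductSpace ℝ H]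
  [NormedAddCommGroup E] [NormedSpace ℝ E] [MeasurableSpace E] [BorelSpace E]
  {i : H →L[ℝ] E} {μ : Measure E}

open scoped MatrixOrder Matrix.Norms.L2Operator in
-- By polarization the matrix in question is the Gram matrix of the points. Its real factorization
-- `B* B` survives the passage to complex entries.
theorem isLevyExponent_norm_sq_div_two : IsLevyExponent fun h : H => ((‖h‖ ^ 2 / 2 : ℝ) : ℂ) where
  continuous := by fun_prop
  negativeDefinite n x := by
    have h1 : (Matrix.of fun j k : Fin n => ((‖x j‖ ^ 2 / 2 : ℝ) : ℂ)
        + conj ((‖x k‖ ^ 2 / 2 : ℝ) : ℂ) - ((‖x j - x k‖ ^ 2 / 2 : ℝ) : ℂ))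
        = (Matrix.gram ℝ x).map (algebraMap ℝ ℂ) := by
      ext j k
      rw [Matrix.of_apply, Complex.conj_ofReal, Matrix.map_apply, Matrix.gram_apply,
        norm_sub_sq_real]
      simp only [Complex.coe_algebraMap]
      push_cast
      ring
    obtain ⟨B, hB⟩ := CStarAlgebra.nonneg_iff_eq_star_mul_self.1
      (Matrix.posSemidef_gram ℝ x).nonneg
    rw [Matrix.star_eq_conjTranspose] at hB
    have h2 : (Matrix.gram ℝ x).map (algebraMap ℝ ℂ)
        = (B.map (algebraMap ℝ ℂ)).conjTranspose * B.map (algebraMap ℝ ℂ) := by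
      rw [hB, Matrix.map_mul]
      congr 1
      ext j k
      simp
    rw [h1, h2]
    exact Matrix.posSemidef_conjTranspose_mul_self _
  map_zero := by simp

theorem lintegral_ofReal_sq_gaussianReal (v : ℝ≥0) :
    ∫⁻ x, ENNReal.ofReal (x ^ 2) ∂(gaussianReal 0 v) = v := by
  have h1 := variance_id_gaussianReal (μ := 0) (v := v)
  rw [variance_of_integral_eq_zero measurable_id.aemeasurable (by simp)] at h1
  simp only [id] at h1
  rw [← ofReal_integral_eq_lintegral_ofReal (f := fun x : ℝ => x ^ 2)
    (memLp_id_gaussianReal 2).integrable_sq (Eventually.of_forall fun x => sq_nonneg x)]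
  rw [h1, ENNReal.ofReal_coe_nnreal]

theorem IsAbstractWienerSpace.isLevySemigroup [CompleteSpace H] (h : IsAbstractWienerSpace i μ) :
    IsLevySemigroup i (fun h : H => ((‖h‖ ^ 2 / 2 : ℝ) : ℂ)) (gaussianSemigroup μ) where
  isProbabilityMeasure t _ := by
    have := h.isProbabilityMeasure
    exact Measure.isProbabilityMeasure_map (by fun_prop)
  fourier t ht ξ := by
    have := h.isProbabilityMeasure
    have h1 : charFunDual (gaussianSemigroup μ t) ξ = charFun (μ.map ξ) √t := by
      rw [charFunDual_apply, charFun_apply_real, gaussianSemigroup,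
        integral_map (by fun_prop) (by fun_prop), integral_map (by fun_prop) (by fun_prop)]
      simp
    rw [h1, h.gaussian, charFun_gaussianReal, norm_dualToH]
    congr 1
    push_cast
    have : ((√t : ℝ) : ℂ) ^ 2 = t := by
      rw [← Complex.ofReal_pow, Real.sq_sqrt ht.le]
    rw [this]
    ring

theorem IsAbstractWienerSpace.lintegral_sq_le (h : IsAbstractWienerSpace i μ)
    (ξ : StrongDual ℝ E) {t : ℝ} (ht : 0 < t) :
    ∫⁻ z, ENNReal.ofReal (ξ z ^ 2) ∂(gaussianSemigroup μ t)
      ≤ ENNReal.ofReal (1 * (1 + t ^ 2) * ‖ξ.comp i‖ ^ 2) := by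
  have h1 : ∫⁻ z, ENNReal.ofReal (ξ z ^ 2) ∂(gaussianSemigroup μ t)
      = ENNReal.ofReal t * ∫⁻ x, ENNReal.ofReal (x ^ 2) ∂(μ.map ξ) := by
    rw [gaussianSemigroup, lintegral_map (by fun_prop) (by fun_prop),
      lintegral_map (by fun_prop) (by fun_prop), ← lintegral_const_mul' _ _ ENNReal.ofReal_ne_top]
    refine lintegral_congr fun z => ?_
    rw [← ENNReal.ofReal_mul ht.le, map_smul, smul_eq_mul, mul_pow, Real.sq_sqrt ht.le]
  rw [h1, h.gaussian, lintegral_ofReal_sq_gaussianReal, ← ENNReal.ofReal_coe_nnreal,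
    ← ENNReal.ofReal_mul ht.le]
  refine ENNReal.ofReal_le_ofReal ?_
  push_cast
  gcongr
  nlinarith [sq_nonneg (t - 1)]

end Gaussian

/-! ### The Cameron–Martin space is null -/

section WienerNull

variable {H E : Type*} [NormedAddCommGroup H] [InnerProductSpace ℝ H] [CompleteSpace H]
  [NormedAddCommGroup E] [NormedSpace ℝ E] [MeasurableSpace E] [BorelSpace E]
  [SecondCountableTopology E]
  {i : H →L[ℝ] E} {μ : Measure E}

theorem IsAbstractWienerSpace.charFunDual_eq (h : IsAbstractWienerSpace i μ)
    (ξ : StrongDual ℝ E) : charFunDual μ ξ = Real.exp (-‖dualToH i ξ‖ ^ 2 / 2) := by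
  have h1 : charFunDual μ ξ = charFun (μ.map ξ) 1 := by
    rw [charFunDual_apply, charFun_apply_real, integral_map (by fun_prop) (by fun_prop)]
    simp
  rw [h1, h.gaussian, charFun_gaussianReal, norm_dualToH]
  push_cast
  congr 1
  simp
  ring

variable {ι : Type} {ξ : ι → StrongDual ℝ E} {b : HilbertBasis ι ℝ H}

/-- Under `μ`, the coordinates `ξ_k`, `k ∈ s`, are independent standard Gaussian variables. -/
theorem IsAbstractWienerSpace.integral_exp_sum_sq (h : IsAbstractWienerSpace i μ)
    (hb : ∀ k, b k = dualToH i (ξ k)) (s : Finset ι) :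
    ∫ z, Real.exp (-‖(cylinderMap ξ 1 s).flip z‖ ^ 2 / 2) ∂μ
      = (∫ x, Real.exp (-x ^ 2 / 2) ∂(gaussianReal 0 1)) ^ s.card := by
  have := h.isProbabilityMeasure
  have h1 : ∫ z, ((Real.exp (-‖(cylinderMap ξ 1 s).flip z‖ ^ 2 / 2) : ℝ) : ℂ) ∂μ
      = ∫ v, ((Real.exp (-‖v‖ ^ 2 / 2) : ℝ) : ℂ) ∂(stdGaussian (EuclideanSpace ℝ s)) := by
    simp_rw [← integral_exp_stdGaussian]
    have e : ∀ v : EuclideanSpace ℝ s, ((Real.exp (-‖v‖ ^ 2 / 2) : ℝ) : ℂ)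
        = ∫ z, Complex.exp (cylinderMap ξ 1 s v z * Complex.I) ∂μ := fun v => by
      rw [← charFunDual_apply, h.charFunDual_eq, norm_dualToH_cylinderMap hb zero_le_one, one_mul]
    simp_rw [e]
    refine integral_integral_swap ?_
    refine integrable_of_continuous_of_bound ?_ 1 fun q => ?_
    · simp only [Function.uncurry_def]
      fun_prop
    · simp only [Function.uncurry_def]
      rw [Complex.norm_exp_ofReal_mul_I]
  rw [integral_complex_ofReal, integral_complex_ofReal] at h1
  have h2 : ∫ z, Real.exp (-‖(cylinderMap ξ 1 s).flip z‖ ^ 2 / 2) ∂μ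
      = ∫ v, Real.exp (-‖v‖ ^ 2 / 2) ∂(stdGaussian (EuclideanSpace ℝ s)) := by exact_mod_cast h1
  rw [h2, ← map_pi_eq_stdGaussian, integral_map (by fun_prop) (by fun_prop)]
  have e : ∀ x : s → ℝ, Real.exp (-‖WithLp.toLp 2 x‖ ^ 2 / 2) = ∏ k, Real.exp (-x k ^ 2 / 2) := by
    intro x
    rw [EuclideanSpace.real_norm_sq_eq, ← Real.exp_sum, ← Finset.sum_div, ← Finset.sum_neg_distrib]
  simp_rw [e]
  rw [integral_fintype_prod_eq_pow fun x : ℝ => Real.exp (-x ^ 2 / 2)]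
  simp

theorem integral_exp_neg_sq_gaussianReal_lt_one :
    ∫ x, Real.exp (-x ^ 2 / 2) ∂(gaussianReal 0 1) < 1 := by
  have hint : Integrable (fun x : ℝ => Real.exp (-x ^ 2 / 2)) (gaussianReal 0 1) :=
    integrable_of_continuous_of_bound (by fun_prop) 1 fun x => by
      rw [Real.norm_eq_abs, Real.abs_exp, Real.exp_le_one_iff]
      nlinarith [sq_nonneg x]
  have h1 : 0 < ∫ x, (1 - Real.exp (-x ^ 2 / 2)) ∂(gaussianReal 0 1) := by
    rw [integral_pos_iff_support_of_nonneg (fun x => ?_) (by fun_prop)]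
    · have := nullSingletonClass_gaussianReal (μ := 0) (v := 1) one_ne_zero
      have e : Function.support (fun x : ℝ => 1 - Real.exp (-x ^ 2 / 2)) = {0}ᶜ := by
        ext x
        simp [sub_eq_zero, eq_comm (a := (1 : ℝ))]
      rw [e, prob_compl_eq_one_sub (measurableSet_singleton 0), measure_singleton]
      simp
    · simp only [Pi.zero_apply, sub_nonneg, Real.exp_le_one_iff]
      nlinarith [sq_nonneg x]
  rw [integral_sub (integrable_const _) hint] at h1
  simp at h1
  simpa using h1

/-- The Cameron–Martin space of an infinite dimensional abstract Wiener space is a null set. -/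
theorem IsAbstractWienerSpace.measure_range_eq_zero [TopologicalSpace.SeparableSpace H]
    (h : IsAbstractWienerSpace i μ) (hdim : ¬ FiniteDimensional ℝ H) : μ (Set.range i) = 0 := by
  have := h.isProbabilityMeasure
  obtain ⟨ι, ξ, b, hb, -⟩ := exists_hilbertBasis_dual h.inclusion
  have hinf : Infinite ι := by
    by_contra hfin
    rw [not_infinite_iff_finite] at hfin
    have := Fintype.ofFinite ι
    exact hdim (b.toOrthonormalBasis.toBasis.finiteDimensional_of_finite)
  set c := ∫ x, Real.exp (-x ^ 2 / 2) ∂(gaussianReal 0 1)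
  have hc0 : 0 ≤ c := integral_nonneg fun x => (Real.exp_pos _).le
  have hc1 : c < 1 := integral_exp_neg_sq_gaussianReal_lt_one
  have hcover : Set.range i ⊆ ⋃ n : ℕ, i '' Metric.closedBall 0 n := by
    rintro _ ⟨x, rfl⟩
    obtain ⟨n, hn⟩ := exists_nat_ge ‖x‖
    exact Set.mem_iUnion.2 ⟨n, x, by simpa using hn, rfl⟩
  refine measure_mono_null hcover (measure_iUnion_null fun n => ?_)
  by_contra h0
  have hpos : 0 < μ.real (i '' Metric.closedBall 0 n) := ENNReal.toReal_pos h0 (measure_ne_top _ _)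
  -- On a ball of radius `n` in `H` the function `exp(-‖·‖² / 2)` of any `m` coordinates is at least
  -- `exp(-n² / 2)`, but its mean is `c ^ m`. For this `m` that contradicts Markov's inequality if
  -- the ball has positive mass.
  obtain ⟨m, hm⟩ := exists_pow_lt_of_lt_one
    (mul_pos hpos (Real.exp_pos (-(n : ℝ) ^ 2 / 2))) hc1
  obtain ⟨s, hs⟩ := Infinite.exists_subset_card_eq ι m
  rw [← hs, ← h.integral_exp_sum_sq hb] at hm
  refine hm.not_ge ?_
  have hcont : Continuous fun z => Real.exp (-‖(cylinderMap ξ 1 s).flip z‖ ^ 2 / 2) := by fun_prop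
  have hint : Integrable (fun z => Real.exp (-‖(cylinderMap ξ 1 s).flip z‖ ^ 2 / 2)) μ :=
    integrable_of_continuous_of_bound hcont 1 fun z => by
      rw [Real.norm_eq_abs, Real.abs_exp, Real.exp_le_one_iff]
      have : 0 ≤ ‖(cylinderMap ξ 1 s).flip z‖ ^ 2 := sq_nonneg _
      linarith
  have hsub : i '' Metric.closedBall 0 n ⊆ {z | Real.exp (-(n : ℝ) ^ 2 / 2) ≤
      Real.exp (-‖(cylinderMap ξ 1 s).flip z‖ ^ 2 / 2)} := by
    rintro _ ⟨x, hx, rfl⟩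
    rw [Set.mem_ofPred_eq, Real.exp_le_exp]
    have h3 := norm_flip_cylinderMap_le hb zero_le_one s x
    rw [one_mul] at h3
    have h4 := h3.trans (mem_closedBall_zero_iff.1 hx)
    gcongr
  have h5 := mul_meas_ge_le_integral_of_nonneg
    (Eventually.of_forall fun z => (Real.exp_pos _).le) hint (Real.exp (-(n : ℝ) ^ 2 / 2))
  refine le_trans ?_ h5
  rw [mul_comm]
  exact mul_le_mul_of_nonneg_left (measureReal_mono hsub) (Real.exp_pos _).le

theorem IsAbstractWienerSpace.hypothesisH [TopologicalSpace.SeparableSpace H]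
    (h : IsAbstractWienerSpace i μ) (hdim : ¬ FiniteDimensional ℝ H) :
    HypothesisH i (gaussianSemigroup μ) where
  moments := ⟨1, one_pos, fun ξ _ ht => h.lintegral_sq_le ξ ht⟩
  null t ht := by
    have : SecondCountableTopology H := UniformSpace.secondCountable_of_separable H
    have hmeas : MeasurableSet (Set.range i) := by
      borelize H
      exact measurableSet_range_of_continuous_injective i.continuous h.inclusion.injective
    rw [gaussianSemigroup, Measure.map_apply (by fun_prop) hmeas]
    -- `H` is a linear subspace, hence invariant under the scaling by `√t`.
    convert h.measure_range_eq_zero hdim using 2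
    ext z
    have ht' := (Real.sqrt_pos.2 ht).ne'
    constructor
    · rintro ⟨x, hx⟩
      exact ⟨(√t)⁻¹ • x, by rw [map_smul, hx, inv_smul_smul₀ ht']⟩
    · rintro ⟨x, rfl⟩
      exact ⟨√t • x, map_smul i _ _⟩

end WienerNull

theorem IsDenseInclusion.secondCountableTopology {H E : Type*} [NormedAddCommGroup H]
    [InnerProductSpace ℝ H] [TopologicalSpace.SeparableSpace H] [NormedAddCommGroup E]
    [NormedSpace ℝ E] {i : H →L[ℝ] E} (hi : IsDenseInclusion i) : SecondCountableTopology E := by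
  have := hi.denseRange.separableSpace i.continuous
  exact UniformSpace.secondCountable_of_separable E

end WienerLevy
theorem proposition4p7 :
    -- Brownian motion on an (infinite dimensional) abstract Wiener space
    (∀ (H E : Type*)
      [NormedAddCommGroup H] [InnerProductSpace ℝ H] [CompleteSpace H]
      [TopologicalSpace.SeparableSpace H]
      [NormedAddCommGroup E] [NormedSpace ℝ E] [CompleteSpace E]
      [MeasurableSpace E] [BorelSpace E]
      (i : H →L[ℝ] E) (μ : Measure E),
      WienerLevy.IsAbstractWienerSpace i μ → ¬ FiniteDimensional ℝ H →
        WienerLevy.IsPolar (WienerLevy.gaussianSemigroup μ) (Set.range i)) ∧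
    -- Lévy processes on a Hilbert space
    (∀ (H E : Type*)
      [NormedAddCommGroup H] [InnerProductSpace ℝ H] [CompleteSpace H]
      [TopologicalSpace.SeparableSpace H]
      [NormedAddCommGroup E] [InnerProductSpace ℝ E] [CompleteSpace E]
      [MeasurableSpace E] [BorelSpace E]
      (i : H →L[ℝ] E) (ψ : H → ℂ) (ν : ℝ → Measure E),
      WienerLevy.IsDenseInclusion i → WienerLevy.IsLevyExponent ψ →
      WienerLevy.IsHilbertSchmidt i → WienerLevy.IsLevySemigroup i ψ ν →
      WienerLevy.HypothesisH i ν →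
        WienerLevy.IsPolar ν (Set.range i)) := by

  refine ⟨fun H E _ _ _ _ _ _ _ _ _ i μ h hdim => ?_,
    fun H E _ _ _ _ _ _ _ _ _ i ψ ν hi hψ _ hν hm => ?_⟩
  · have := h.inclusion.secondCountableTopology
    exact WienerLevy.isPolar_range h.inclusion WienerLevy.isLevyExponent_norm_sq_div_two
      h.isLevySemigroup (h.hypothesisH hdim)
  · have := hi.secondCountableTopology
    exact WienerLevy.isPolar_range hi hψ hν hm
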